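/- An instance of the strongly stable matching problem is a finite bipartite graph $G=(A\cup B,E)$ of men $A$ and women $B$, in which the adjacency list of every vertex is a linearly ordered list of disjoint non-empty ties; let $n=|A|+|B|$ and $m=|E|$. A vertex prefers $x$ to $y$ strictly if the tie of $x$ comes before that of $y$, and weakly if the tie of $x$ is not after that of $y$. An edge $e\in E\setminus M$ blocks a matching $M\subseteq E$ if one endpoint of $e$ is unmatched in $M$ or strictly prefers the other endpoint to its partner, while the other endpoint is unmatched or weakly prefers the first one to its partner; $M$ is strongly stable if no edge blocks it. For strongly stable matchings, $M$ dominates $N$ if every man weakly prefers his partner in $M$ to his partner in $N$ (being unmatched is ranked below every neighbour), and $M$ strictly dominates $N$ if moreover some man has a strict preference; $M\sim N$ if every man is indifferent between his partners in $M$ and $N$. Write $[N]\prec[M]$ if $M$ strictly dominates $N$. A $\sim$-class of strongly stable matchings is irreducible if it is the class $M(a,b)$ of some strongly stable matching that, for some edge $(a,b)$, contains $(a,b)$ and dominates all strongly stable matchings containing $(a,b)$. Let $I(\mathcal M_G)$ be the set of irreducible classes. **Theorem.** The representation $(I(\mathcal M_G),\prec)$ can be constructed in time $O(nm^2)$. Precisely: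 there are a program for a random-access machine with unit-cost operations (addition, truncated subtraction, multiplication, division with rounding down, comparisons, access to array entries at computed indices) and constants $C,d$ such that, for every instance, given by its $n$ adjacency lists with the rank of each entry, the program halts after at most $C\,(nm^2+1)$ steps, uses only numbers of size at most $(n+m+2)^d$ (words of $O(\log(n+m+2))$ bits), and outputs the number $k=|I(\mathcal M_G)|$, a list of $k$ strongly stable matchings $N_0,\dots,N_{k-1}$ (each as the table of the men's partners) which represent every irreducible class exactly once, and the $k\times k$ table that tells for all $i,j$ whether $[N_i]\prec[N_j]$. -/

import Mathlib

/-! ### Instances of the strongly stable matching problem -/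

namespace SSM

/-- Preference lists of `p` vertices over `q` vertices on the other side: every vertex has a
linearly ordered list of ties, best tie first. The order of the vertices inside one tie has no
meaning. -/
abbrev PrefLists (p q : ℕ) := Fin p → List (List (Fin q))

namespace PrefLists

variable {p q : ℕ} (L : PrefLists p q)

/-- The neighbours of `v`, in the order in which they are listed. -/
def nbrs (v : Fin p) : List (Fin q) := (L v).flatten

/-- The rank of `w` on the list of `v`: the first tie has rank 1, the second tie has rank 2, ...
(only used for neighbours `w` of `v`). -/
def rank (v : Fin p) (w : Fin q) : ℕ := (L v).findIdx (fun t => decide (w ∈ t)) + 1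

/-- Number of list entries of the vertices that come before vertex number `i`. -/
def offset (i : ℕ) : ℕ := ∑ v : Fin p with v.val < i, (L.nbrs v).length

/-- All preference lists, written one after the other. -/
def adjList : List ℕ := (List.finRange p).flatMap (fun v => (L.nbrs v).map Fin.val)

/-- The ranks of the entries of `adjList`. -/
def rankList : List ℕ := (List.finRange p).flatMap (fun v => (L.nbrs v).map (L.rank v))

end PrefLists

/-- An instance of the strongly stable matching problem: a finite bipartite graph with `numMen` men
and `numWomen` women, given by the adjacency lists (lists of ties) of its vertices. -/
structure Inst where
  numMen : ℕ
  numWomen : ℕ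
  menPref : PrefLists numMen numWomen
  womenPref : PrefLists numWomen numMen
  men_ties_nonempty : ∀ a, ∀ t ∈ menPref a, t ≠ []
  women_ties_nonempty : ∀ b, ∀ t ∈ womenPref b, t ≠ []
  /-- Ties are disjoint and list no vertex twice. -/
  men_nodup : ∀ a, (menPref.nbrs a).Nodup
  women_nodup : ∀ b, (womenPref.nbrs b).Nodup
  /-- Adjacency is symmetric. -/
  mem_nbrs_iff : ∀ a b, b ∈ menPref.nbrs a ↔ a ∈ womenPref.nbrs b

namespace Inst

variable (I : Inst)

/-- The edge set. -/
def edges : Finset (Fin I.numMen × Fin I.numWomen) :=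
  Finset.univ.filter (fun e => e.2 ∈ I.menPref.nbrs e.1)

/-- The number `n` of vertices. -/
def numVertices : ℕ := I.numMen + I.numWomen

/-- The number `m` of edges. -/
def numEdges : ℕ := I.edges.card

/-- Sets of man-woman pairs. -/
abbrev PairSet := Finset (Fin I.numMen × Fin I.numWomen)

/-- A matching: a set of edges, no two of which share an endpoint. -/
structure IsMatching (M : I.PairSet) : Prop where
  subset_edges : M ⊆ I.edges
  eq_of_man : ∀ e ∈ M, ∀ f ∈ M, e.1 = f.1 → e = f
  eq_of_woman : ∀ e ∈ M, ∀ f ∈ M, e.2 = f.2 → e = f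

/-- The rank for man `a` of his partner in the matching `M`; it is `⊤` if `a` is unmatched. -/
noncomputable def manRank (M : I.PairSet) (a : Fin I.numMen) : ℕ∞ :=
  ⨅ b, ⨅ (_ : (a, b) ∈ M), (I.menPref.rank a b : ℕ∞)

/-- The rank for woman `b` of her partner in the matching `M`; it is `⊤` if `b` is unmatched. -/
noncomputable def womanRank (M : I.PairSet) (b : Fin I.numWomen) : ℕ∞ :=
  ⨅ a, ⨅ (_ : (a, b) ∈ M), (I.womenPref.rank b a : ℕ∞)

/-- The edge `(a, b)`, not in `M`, blocks `M`: one endpoint is unmatched or strictly prefers the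
other endpoint to its partner, and the other endpoint is unmatched or weakly prefers the first
one to its partner. -/
def Blocks (M : I.PairSet) (a : Fin I.numMen) (b : Fin I.numWomen) : Prop :=
  (a, b) ∈ I.edges ∧ (a, b) ∉ M ∧
    (((I.menPref.rank a b : ℕ∞) < I.manRank M a ∧ (I.womenPref.rank b a : ℕ∞) ≤ I.womanRank M b) ∨
     ((I.menPref.rank a b : ℕ∞) ≤ I.manRank M a ∧ (I.womenPref.rank b a : ℕ∞) < I.womanRank M b))

/-- A strongly stable matching. -/
def IsStronglyStable (M : I.PairSet) : Prop :=
  I.IsMatching M ∧ ∀ a b, ¬ I.Blocks M a b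

/-- The set of all strongly stable matchings of the instance. -/
abbrev Stable := {M : I.PairSet // I.IsStronglyStable M}

/-- `M` dominates `N`: every man weakly prefers his partner in `M` to his partner in `N`. -/
def Dominates (M N : I.Stable) : Prop := ∀ a, I.manRank M.1 a ≤ I.manRank N.1 a

/-- `M` strictly dominates `N`: moreover some man strictly prefers his partner in `M`. -/
def StrictlyDominates (M N : I.Stable) : Prop :=
  I.Dominates M N ∧ ∃ a, I.manRank M.1 a < I.manRank N.1 a

/-- Two strongly stable matchings are equivalent if every man is indifferent between his
partners in them. -/
instance stableSetoid : Setoid I.Stable where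
  r M N := ∀ a, I.manRank M.1 a = I.manRank N.1 a
  iseqv := ⟨fun _ _ => rfl, fun h a => (h a).symm, fun h k a => (h a).trans (k a)⟩

/-- The set of equivalence classes of strongly stable matchings. -/
def Classes := Quotient I.stableSetoid

/-- The class of a strongly stable matching. -/
def cls (M : I.Stable) : I.Classes := Quotient.mk I.stableSetoid M

/-- The dominance order on classes: `c ≤ d` if `d` dominates `c`, and `c < d` if `d` strictly
dominates `c`. -/
instance classesOrder : PartialOrder I.Classes where
  le := Quotient.lift₂ (fun M N => I.Dominates N M) (by
    intro M N M' N' hM hN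
    simp only [Dominates, eq_iff_iff]
    exact forall_congr' fun a => by rw [hM a, hN a])
  lt := Quotient.lift₂ (fun M N => I.StrictlyDominates N M) (by
    intro M N M' N' hM hN
    simp only [StrictlyDominates, Dominates, eq_iff_iff]
    exact and_congr (forall_congr' fun a => by rw [hM a, hN a])
      (exists_congr fun a => by rw [hM a, hN a]))
  le_refl := by
    rintro ⟨M⟩ a
    exact le_rfl
  le_trans := by
    rintro ⟨M⟩ ⟨N⟩ ⟨K⟩ h k a
    exact (k a).trans (h a)
  le_antisymm := by
    rintro ⟨M⟩ ⟨N⟩ h k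
    exact Quotient.sound fun a => le_antisymm (k a) (h a)
  lt_iff_le_not_ge := by
    rintro ⟨M⟩ ⟨N⟩
    refine and_congr_right fun _ => ?_
    constructor
    · rintro ⟨a, ha⟩ h
      exact absurd (h a) (not_le.mpr ha)
    · intro h
      by_contra hc
      exact h fun a => not_lt.mp fun ha => hc ⟨a, ha⟩

/-- `M` is man-optimal among the strongly stable matchings that contain the pair `(a, b)`. -/
def IsManOptimalWith (a : Fin I.numMen) (b : Fin I.numWomen) (M : I.Stable) : Prop :=
  (a, b) ∈ M.1 ∧ ∀ N : I.Stable, (a, b) ∈ N.1 → I.Dominates M N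

/-- The set of irreducible classes: the classes of the man-optimal strongly stable matchings
that contain `(a, b)`, for all pairs `(a, b)` that lie in some strongly stable matching. -/
def irreducibles : Set I.Classes :=
  {c | ∃ a b, ∃ M : I.Stable, I.IsManOptimalWith a b M ∧ c = I.cls M}

end Inst

/-! ### A random-access machine with unit-cost steps on words of bounded size -/

/-- The binary operations of the machine; comparisons return 0 or 1. -/
inductive BinOp
  | add | sub | mul | div | lt | eq

/-- Subtraction is truncated at 0, division is rounded down (and `x / 0 = 0`). -/
def BinOp.eval : BinOp → ℕ → ℕ → ℕ
  | .add, x, y => x + y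
  | .sub, x, y => x - y
  | .mul, x, y => x * y
  | .div, x, y => x / y
  | .lt, x, y => if x < y then 1 else 0
  | .eq, x, y => if x = y then 1 else 0

/-- Memory: registers, and arrays with random access. -/
structure Mem where
  reg : ℕ → ℕ
  arr : ℕ → ℕ → ℕ

/-- Expressions: constants, registers, the entry of an array at a computed index, operations. -/
inductive Expr
  | lit (k : ℕ)
  | reg (x : ℕ)
  | get (A : ℕ) (i : Expr)
  | bin (o : BinOp) (e f : Expr)

namespace Expr

/-- The value of an expression. -/
def eval (s : Mem) : Expr → ℕ
  | lit k => k
  | reg x => s.reg x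
  | get A i => s.arr A (i.eval s)
  | bin o e f => o.eval (e.eval s) (f.eval s)

/-- The number of elementary operations in an expression. -/
def cost : Expr → ℕ
  | lit _ => 1
  | reg _ => 1
  | get _ i => i.cost + 1
  | bin _ e f => e.cost + f.cost + 1

/-- Every value that occurs in the evaluation is at most `W`. -/
def Fits (W : ℕ) (s : Mem) : Expr → Prop
  | lit k => k ≤ W
  | reg x => s.reg x ≤ W
  | get A i => i.Fits W s ∧ s.arr A (i.eval s) ≤ W
  | bin o e f => e.Fits W s ∧ f.Fits W s ∧ o.eval (e.eval s) (f.eval s) ≤ W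

end Expr

/-- Programs. The names of registers and arrays are constants of the program; a test (in `ite` and `loop`, the while-loop) succeeds if
its value is not 0. -/
inductive Prog
  | skip
  | assign (x : ℕ) (e : Expr)
  | store (A : ℕ) (i e : Expr)
  | seq (c d : Prog)
  | ite (e : Expr) (c d : Prog)
  | loop (e : Expr) (c : Prog)

/-- `Exec W c s t u`: started in memory `s`, the program `c` halts after exactly `t` steps in
memory `u`, and no value that is computed or used as an index exceeds the word bound `W`. -/
inductive Exec (W : ℕ) : Prog → Mem → ℕ → Mem → Prop
  | skip (s : Mem) : Exec W .skip s 1 s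
  | assign (s : Mem) (x : ℕ) (e : Expr) (he : e.Fits W s) :
      Exec W (.assign x e) s (e.cost + 1) { s with reg := Function.update s.reg x (e.eval s) }
  | store (s : Mem) (A : ℕ) (i e : Expr) (hi : i.Fits W s) (he : e.Fits W s) :
      Exec W (.store A i e) s (i.cost + e.cost + 1)
        { s with arr :=
            Function.update s.arr A (Function.update (s.arr A) (i.eval s) (e.eval s)) }
  | seq {c d : Prog} {s u v : Mem} {t r : ℕ} (h : Exec W c s t u) (k : Exec W d u r v) :
      Exec W (.seq c d) s (t + r) v
  | ite_true {e : Expr} {c d : Prog} {s u : Mem} {t : ℕ} (he : e.Fits W s) (h0 : e.eval s ≠ 0)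
      (h : Exec W c s t u) : Exec W (.ite e c d) s (e.cost + 1 + t) u
  | ite_false {e : Expr} {c d : Prog} {s u : Mem} {t : ℕ} (he : e.Fits W s) (h0 : e.eval s = 0)
      (h : Exec W d s t u) : Exec W (.ite e c d) s (e.cost + 1 + t) u
  | loop_true {e : Expr} {c : Prog} {s u v : Mem} {t r : ℕ} (he : e.Fits W s)
      (h0 : e.eval s ≠ 0) (h : Exec W c s t u) (k : Exec W (.loop e c) u r v) :
      Exec W (.loop e c) s (e.cost + 1 + t + r) v
  | loop_false {e : Expr} {c : Prog} {s : Mem} (he : e.Fits W s) (h0 : e.eval s = 0) :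
      Exec W (.loop e c) s (e.cost + 1) s

namespace Inst

variable (I : Inst)

/-- The input. Registers 0, 1, 2 hold the numbers of men, women and edges. Arrays 0, 1, 2 hold
the men's adjacency lists: where the list of man `a` starts, the listed women, and their ranks on
that list; arrays 3, 4, 5 hold the women's lists in the same way. All other memory is 0. -/
def input : Mem where
  reg
    | 0 => I.numMen
    | 1 => I.numWomen
    | 2 => I.numEdges
    | _ => 0
  arr
    | 0 => fun i => I.menPref.offset i
    | 1 => fun i => I.menPref.adjList.getD i 0
    | 2 => fun i => I.menPref.rankList.getD i 0
    | 3 => fun i => I.womenPref.offset i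
    | 4 => fun i => I.womenPref.adjList.getD i 0
    | 5 => fun i => I.womenPref.rankList.getD i 0
    | _ => fun _ => 0

open Classical in
/-- The output. The memory `u` holds the partial order of irreducible classes: register 3 holds
their number `k`; array 6 holds, row by row, strongly stable matchings `N 0, ..., N (k - 1)` which
represent every irreducible class exactly once (row `i` has at place `a` the number `b + 1` if
man `a` is matched to woman `b` in `N i`, and 0 if he is unmatched); and array 7 holds, row by
row, the `k × k` table of the relation `<` on the classes. -/
def IsRepresentation (u : Mem) : Prop :=
  ∃ N : Fin (u.reg 3) → I.Stable,
    Function.Injective (fun i => I.cls (N i)) ∧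
    Set.range (fun i => I.cls (N i)) = I.irreducibles ∧
    (∀ i a b, (a, b) ∈ (N i).1 → u.arr 6 (i.val * I.numMen + a.val) = b.val + 1) ∧
    (∀ i a, (∀ b, (a, b) ∉ (N i).1) → u.arr 6 (i.val * I.numMen + a.val) = 0) ∧
    (∀ i j, u.arr 7 (i.val * u.reg 3 + j.val) = if I.cls (N i) < I.cls (N j) then 1 else 0)

end Inst

end SSM

/-! The proof runs a proposal algorithm governed by thresholds. An edge remains (`Rem`) while its
rank for the woman is at most her threshold, and a man is engaged (`Eng`) to all his best remaining
women. A strongly stable matching `N` obeys the thresholds (`Below`) if every woman whose threshold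
has been lowered has in `N` a partner of rank at most that threshold.

Three kinds of lowering are sound. A woman may go down to the rank of a man engaged to her
(`exists_of_eng`). The women reached by a failed search for an augmenting path form a critical set,
and all of them may go below the rank of their engagements (`exists_lt_of_critical`, applied in
`BInv.exists_lt`). Finally, if only those `N` matter in which man `a` does not get one of his best
remaining women, then all women engaged to him may reject him (`exists_lt_of_eng`).

Suppose every engaged edge has exactly the rank of the woman's threshold (`Tight`) and a matching
`M` of engaged edges covers all men with a remaining edge. Then `M` dominates every obeying `N`
(`dom_of_below`). If moreover all women with lowered thresholds are matched, `M` is strongly stable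
(`stable_of_tight`); if not, counting shows that no obeying `N` exists (`valid_of_below`).

For each man `a` the run starts from the initial thresholds. Whenever it yields a strongly stable
`M` in which `a` is matched by `e`, this `M` is man-optimal for `e`. It is recorded unless a row
with the same ranks is known, and then all women engaged to `a` reject him, so that the next result
is optimal among the matchings that are strictly worse for `a`. One matching per rank of `a` is
enough: by `exists_swap`, another edge of `a` of the same rank that lies in a dominated strongly
stable matching can be exchanged into `M` without changing the rank of any man.

Every round takes time O(n+m) and decreases the potential `Tab.pot`, which starts at O(m). Men
without edges are skipped, so there are at most min(n,m) runs, and their rounds cost O(nm²)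
together. Each record costs O(nm) and is paid for by an edge of `a` that ceases to remain, which
again gives O(nm²); the same count bounds the number of rows by m, so the table of the order costs
O(nm²) as well. The word bound follows from the time bound, because a step increases the largest
number in memory by at most one. -/

namespace SSM

/-! ### Reasoning about programs -/

namespace Mem

/-- Write a register. -/
def setR (s : Mem) (x v : ℕ) : Mem := { s with reg := Function.update s.reg x v }

/-- Write an array entry. -/
def setA (s : Mem) (A i v : ℕ) : Mem :=
  { s with arr := Function.update s.arr A (Function.update (s.arr A) i v) }

@[simp] theorem setR_reg (s : Mem) (x v y : ℕ) :
    (s.setR x v).reg y = if y = x then v else s.reg y := by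
  simp [setR, Function.update_apply]

@[simp] theorem setR_arr (s : Mem) (x v : ℕ) : (s.setR x v).arr = s.arr := rfl

@[simp] theorem setA_reg (s : Mem) (A i v : ℕ) : (s.setA A i v).reg = s.reg := rfl

@[simp] theorem setA_arr (s : Mem) (A i v B : ℕ) :
    (s.setA A i v).arr B = if B = A then Function.update (s.arr A) i v else s.arr B := by
  simp [setA, Function.update_apply]

/-- All values in memory are at most `B`. -/
def Le (s : Mem) (B : ℕ) : Prop := (∀ x, s.reg x ≤ B) ∧ ∀ A i, s.arr A i ≤ B

theorem Le.mono {s : Mem} {B B' : ℕ} (h : s.Le B) (hB : B ≤ B') : s.Le B' :=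
  ⟨fun x => (h.1 x).trans hB, fun A i => (h.2 A i).trans hB⟩

theorem Le.setR {s : Mem} {B x v : ℕ} (h : s.Le B) (hv : v ≤ B) : (s.setR x v).Le B := by
  refine ⟨fun y => ?_, h.2⟩
  rw [setR_reg]
  split_ifs
  exacts [hv, h.1 y]

theorem Le.setA {s : Mem} {B A i v : ℕ} (h : s.Le B) (hv : v ≤ B) : (s.setA A i v).Le B := by
  refine ⟨h.1, fun C j => ?_⟩
  rw [setA_arr]
  split_ifs
  · rw [Function.update_apply]
    split_ifs
    exacts [hv, h.2 A j]
  · exact h.2 C j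

end Mem

/-- Execution without a bound on the words. -/
inductive Steps : Prog → Mem → ℕ → Mem → Prop
  | skip (s : Mem) : Steps .skip s 1 s
  | assign (s : Mem) (x : ℕ) (e : Expr) :
      Steps (.assign x e) s (e.cost + 1) (s.setR x (e.eval s))
  | store (s : Mem) (A : ℕ) (i e : Expr) :
      Steps (.store A i e) s (i.cost + e.cost + 1) (s.setA A (i.eval s) (e.eval s))
  | seq {c d : Prog} {s u v : Mem} {t r : ℕ} (h : Steps c s t u) (k : Steps d u r v) :
      Steps (.seq c d) s (t + r) v
  | ite_true {e : Expr} {c d : Prog} {s u : Mem} {t : ℕ} (h0 : e.eval s ≠ 0)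
      (h : Steps c s t u) : Steps (.ite e c d) s (e.cost + 1 + t) u
  | ite_false {e : Expr} {c d : Prog} {s u : Mem} {t : ℕ} (h0 : e.eval s = 0)
      (h : Steps d s t u) : Steps (.ite e c d) s (e.cost + 1 + t) u
  | loop_true {e : Expr} {c : Prog} {s u v : Mem} {t r : ℕ}
      (h0 : e.eval s ≠ 0) (h : Steps c s t u) (k : Steps (.loop e c) u r v) :
      Steps (.loop e c) s (e.cost + 1 + t + r) v
  | loop_false {e : Expr} {c : Prog} {s : Mem} (h0 : e.eval s = 0) :
      Steps (.loop e c) s (e.cost + 1) s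

/-! ### Syntactic bounds for the values of expressions. -/

namespace Expr

/-- The expression has value 0 or 1 for syntactic reasons. -/
def isUnit : Expr → Bool
  | lit k => decide (k ≤ 1)
  | bin .lt _ _ => true
  | bin .eq _ _ => true
  | _ => false

/-- For syntactic reasons the value is at most the largest number in memory (or 1). -/
def isBase : Expr → Bool
  | lit k => decide (k ≤ 1)
  | reg _ => true
  | get _ _ => true
  | bin .lt _ _ => true
  | bin .eq _ _ => true
  | bin .sub e _ => e.isBase
  | bin .mul e f => e.isUnit && f.isUnit
  | _ => false

/-- For syntactic reasons the value exceeds the largest number in memory by at most one. -/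
def isIncr : Expr → Bool
  | bin .add e f => e.isBase && f.isUnit
  | e => e.isBase

/-- The number of nodes. -/
def size : Expr → ℕ
  | lit _ => 1
  | reg _ => 1
  | get _ i => i.size + 1
  | bin _ e f => e.size + f.size

/-- All constants are 0 or 1. -/
def litsLe : Expr → Bool
  | lit k => decide (k ≤ 1)
  | reg _ => true
  | get _ i => i.litsLe
  | bin _ e f => e.litsLe && f.litsLe

theorem eval_le_one {e : Expr} (h : e.isUnit = true) (s : Mem) : e.eval s ≤ 1 := by
  rcases e with k | x | ⟨A, i⟩ | ⟨o, e, f⟩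
  · simpa [isUnit, eval] using h
  · simp [isUnit] at h
  · simp [isUnit] at h
  · cases o <;> simp [isUnit] at h <;> simp only [eval, BinOp.eval] <;> split_ifs <;> simp

theorem eval_le_of_isBase {s : Mem} {B : ℕ} (hs : s.Le B) (hB : 1 ≤ B) :
    ∀ {e : Expr}, e.isBase = true → e.eval s ≤ B
  | lit k, h => by
      simp only [isBase, decide_eq_true_eq] at h
      exact le_trans h hB
  | reg x, _ => hs.1 x
  | get A i, _ => hs.2 A _
  | bin o e f, h => by
      cases o
      · simp [isBase] at h
      · exact (Nat.sub_le _ _).trans (eval_le_of_isBase hs hB (e := e) (by simpa [isBase] using h))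
      · simp only [isBase, Bool.and_eq_true] at h
        have h1 := eval_le_one h.1 s
        have h2 := eval_le_one h.2 s
        simp only [eval, BinOp.eval]
        nlinarith
      · simp [isBase] at h
      · simp only [eval, BinOp.eval]
        split_ifs <;> omega
      · simp only [eval, BinOp.eval]
        split_ifs <;> omega

theorem eval_le_of_isIncr {s : Mem} {B : ℕ} (hs : s.Le B) (hB : 1 ≤ B) {e : Expr}
    (h : e.isIncr = true) : e.eval s ≤ B + 1 := by
  rcases e with k | x | ⟨A, i⟩ | ⟨o, e, f⟩
  · exact (eval_le_of_isBase hs hB h).trans (Nat.le_succ _)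
  · exact (eval_le_of_isBase hs hB h).trans (Nat.le_succ _)
  · exact (eval_le_of_isBase hs hB h).trans (Nat.le_succ _)
  · cases o
    · simp only [isIncr, Bool.and_eq_true] at h
      exact add_le_add (eval_le_of_isBase hs hB h.1) (eval_le_one h.2 s)
    all_goals exact (eval_le_of_isBase hs hB h).trans (Nat.le_succ _)

theorem one_le_size : ∀ e : Expr, 1 ≤ e.size
  | lit _ => le_rfl
  | reg _ => le_rfl
  | get _ i => by simp [size]
  | bin _ e f => by
      have := one_le_size e
      simp only [size]
      omega

theorem Fits.mono {W W' : ℕ} (hW : W ≤ W') {s : Mem} : ∀ {e : Expr}, e.Fits W s → e.Fits W' s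
  | lit _, h => le_trans h hW
  | reg _, h => le_trans h hW
  | get _ _, h => ⟨h.1.mono hW, h.2.trans hW⟩
  | bin _ _ _, h => ⟨h.1.mono hW, h.2.1.mono hW, h.2.2.trans hW⟩

/-- The bounds of the operands are at least 2, hence their sum is at most their product. So the
exponents simply add up, and `size` need not count the operation of a `bin` node. -/
theorem fits_pow_size {s : Mem} {V : ℕ} (hs : s.Le V) (hV : 2 ≤ V) :
    ∀ {e : Expr}, e.litsLe = true → e.Fits (V ^ e.size) s ∧ e.eval s ≤ V ^ e.size
  | lit k, h => by
      simp only [litsLe, decide_eq_true_eq] at h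
      simp only [Fits, eval, size, pow_one]
      omega
  | reg x, _ => by
      simp only [Fits, eval, size, pow_one]
      exact ⟨hs.1 x, hs.1 x⟩
  | get A i, h => by
      have ih := fits_pow_size hs hV (e := i) h
      have h1 : V ≤ V ^ (i.size + 1) := Nat.le_self_pow (by omega) V
      exact ⟨⟨ih.1.mono (Nat.pow_le_pow_right (by omega) (by simp [size])), (hs.2 A _).trans h1⟩,
        (hs.2 A _).trans h1⟩
  | bin o e f, h => by
      simp only [litsLe, Bool.and_eq_true] at h
      have he := fits_pow_size hs hV h.1
      have hf := fits_pow_size hs hV h.2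
      have key : o.eval (e.eval s) (f.eval s) ≤ V ^ (e.size + f.size) := by
        have h1 := one_le_size e
        have h2 := one_le_size f
        have e1 : V ≤ V ^ e.size := Nat.le_self_pow (by omega) V
        have f1 : V ≤ V ^ f.size := Nat.le_self_pow (by omega) V
        rw [pow_add]
        cases o <;> simp only [BinOp.eval]
        · nlinarith [he.2, hf.2]
        · exact (Nat.sub_le _ _).trans (by nlinarith [he.2])
        · exact Nat.mul_le_mul he.2 hf.2
        · exact (Nat.div_le_self _ _).trans (by nlinarith [he.2])
        · split_ifs <;> nlinarith
        · split_ifs <;> nlinarith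
      exact ⟨⟨he.1.mono (Nat.pow_le_pow_right (by omega) (by simp [size])),
        hf.1.mono (Nat.pow_le_pow_right (by omega) (by simp [size])), key⟩, key⟩

/-- The expression uses constants 0 and 1 only and has size at most `D`. -/
def ok (D : ℕ) (e : Expr) : Bool := e.litsLe && decide (e.size ≤ D)

theorem fits_of_ok {s : Mem} {V W D : ℕ} (hs : s.Le V) (hV : 2 ≤ V) (hW : V ^ D ≤ W) {e : Expr}
    (h : e.ok D = true) : e.Fits W s := by
  simp only [ok, Bool.and_eq_true, decide_eq_true_eq] at h
  exact (fits_pow_size hs hV h.1).1.mono ((Nat.pow_le_pow_right (by omega) h.2).trans hW)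

end Expr

namespace Prog

/-- Every assignment exceeds the largest number in memory by at most one, and all expressions have
size at most `D`. -/
def incr (D : ℕ) : Prog → Bool
  | skip => true
  | assign _ e => e.isIncr && e.ok D
  | store _ i e => i.ok D && (e.isIncr && e.ok D)
  | seq c d => c.incr D && d.incr D
  | ite e c d => e.ok D && (c.incr D && d.incr D)
  | loop e c => e.ok D && c.incr D

/-- The registers that are written. -/
def regs : Prog → List ℕ
  | skip => []
  | assign x _ => [x]
  | store _ _ _ => []
  | seq c d => c.regs ++ d.regs
  | ite _ c d => c.regs ++ d.regs
  | loop _ c => c.regs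

/-- The arrays that are written. -/
def arrs : Prog → List ℕ
  | skip => []
  | assign _ _ => []
  | store A _ _ => [A]
  | seq c d => c.arrs ++ d.arrs
  | ite _ c d => c.arrs ++ d.arrs
  | loop _ c => c.arrs

/-- There is no loop. -/
def loopFree : Prog → Bool
  | seq c d => c.loopFree && d.loopFree
  | ite _ c d => c.loopFree && d.loopFree
  | loop _ _ => false
  | _ => true

/-- The result of a loop-free program. -/
def run : Prog → Mem → Mem
  | skip, s => s
  | assign x e, s => s.setR x (e.eval s)
  | store A i e, s => s.setA A (i.eval s) (e.eval s)
  | seq c d, s => d.run (c.run s)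
  | ite e c d, s => if e.eval s = 0 then d.run s else c.run s
  | loop _ _, s => s

/-- A bound for the number of steps of a loop-free program. -/
def maxCost : Prog → ℕ
  | skip => 1
  | assign _ e => e.cost + 1
  | store _ i e => i.cost + e.cost + 1
  | seq c d => c.maxCost + d.maxCost
  | ite e c d => e.cost + 1 + max c.maxCost d.maxCost
  | loop _ _ => 0

/-- `for x := 0 to e - 1 do c`. -/
def forTo (x : ℕ) (e : Expr) (c : Prog) : Prog :=
  .seq (.assign x (.lit 0))
    (.loop (.bin .lt (.reg x) e) (.seq c (.assign x (.bin .add (.reg x) (.lit 1)))))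

end Prog

/-- Memory contents grow by at most one per step, so they stay below `B + t`; only intermediate
values, such as products in indices, are larger, and `fits_pow_size` bounds these by a power with
exponent `D`. Thus words need no attention in the rest of the proof, which works with `Steps`. -/
theorem Steps.exec {D W B : ℕ} {c : Prog} {s u : Mem} {t : ℕ} (h : Steps c s t u)
    (hc : c.incr D = true) (hs : s.Le B) (hB : 2 ≤ B) (hW : (B + t) ^ D ≤ W) :
    Exec W c s t u ∧ u.Le (B + t) := by
  induction h generalizing B with
  | skip s => exact ⟨.skip s, hs.mono (by omega)⟩
  | assign s x e =>
      simp only [Prog.incr, Bool.and_eq_true] at hc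
      refine ⟨.assign s x e (Expr.fits_of_ok (hs.mono (by omega)) (by omega) hW hc.2), ?_⟩
      exact (hs.mono (by omega)).setR
        ((Expr.eval_le_of_isIncr hs (by omega) hc.1).trans (by omega))
  | store s A i e =>
      simp only [Prog.incr, Bool.and_eq_true] at hc
      have hs' := hs.mono (show B ≤ B + (i.cost + e.cost + 1) by omega)
      refine ⟨.store s A i e (Expr.fits_of_ok hs' (by omega) hW hc.1)
        (Expr.fits_of_ok hs' (by omega) hW hc.2.2), ?_⟩
      exact hs'.setA ((Expr.eval_le_of_isIncr hs (by omega) hc.2.1).trans (by omega))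
  | @seq c d s u v t r h k ih1 ih2 =>
      simp only [Prog.incr, Bool.and_eq_true] at hc
      have h1 := ih1 hc.1 hs hB ((Nat.pow_le_pow_left (by omega) D).trans hW)
      have h2 := ih2 hc.2 h1.2 (by omega) (by rwa [add_assoc])
      exact ⟨.seq h1.1 h2.1, h2.2.mono (by omega)⟩
  | @ite_true e c d s u t h0 h ih =>
      simp only [Prog.incr, Bool.and_eq_true] at hc
      have h1 := ih hc.2.1 hs hB ((Nat.pow_le_pow_left (by omega) D).trans hW)
      exact ⟨.ite_true (Expr.fits_of_ok (hs.mono (by omega)) (by omega) hW hc.1) h0 h1.1,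
        h1.2.mono (by omega)⟩
  | @ite_false e c d s u t h0 h ih =>
      simp only [Prog.incr, Bool.and_eq_true] at hc
      have h1 := ih hc.2.2 hs hB ((Nat.pow_le_pow_left (by omega) D).trans hW)
      exact ⟨.ite_false (Expr.fits_of_ok (hs.mono (by omega)) (by omega) hW hc.1) h0 h1.1,
        h1.2.mono (by omega)⟩
  | @loop_true e c s u v t r h0 h k ih1 ih2 =>
      have hc' := hc
      simp only [Prog.incr, Bool.and_eq_true] at hc
      have h1 := ih1 hc.2 hs hB ((Nat.pow_le_pow_left (by omega) D).trans hW)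
      have h2 := ih2 hc' h1.2 (by omega) ((Nat.pow_le_pow_left (by omega) D).trans hW)
      exact ⟨.loop_true (Expr.fits_of_ok (hs.mono (by omega)) (by omega) hW hc.1) h0 h1.1 h2.1,
        h2.2.mono (by omega)⟩
  | @loop_false e c s h0 =>
      simp only [Prog.incr, Bool.and_eq_true] at hc
      exact ⟨.loop_false (Expr.fits_of_ok (hs.mono (by omega)) (by omega) hW hc.1) h0,
        hs.mono (by omega)⟩

/-- The memories `s` and `u` agree outside what `c` writes. -/
structure Frame (c : Prog) (s u : Mem) : Prop where
  reg : ∀ x, c.regs.contains x = false → u.reg x = s.reg x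
  arr : ∀ A, c.arrs.contains A = false → u.arr A = s.arr A

theorem Frame.rfl {c : Prog} {s : Mem} : Frame c s s := ⟨fun _ _ => Eq.refl _, fun _ _ => Eq.refl _⟩

theorem Frame.trans {c : Prog} {s u v : Mem} (h : Frame c s u) (k : Frame c u v) : Frame c s v :=
  ⟨fun x hx => (k.reg x hx).trans (h.reg x hx), fun A hA => (k.arr A hA).trans (h.arr A hA)⟩

/-- The side conditions of `Frame` are Boolean equations, so that for a concrete program they are
closed by `rfl`. -/
theorem Steps.frame {c : Prog} {s u : Mem} {t : ℕ} (h : Steps c s t u) : Frame c s u := by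
  induction h with
  | skip s => exact .rfl
  | assign s x e => exact ⟨fun y hy => by simp [Prog.regs] at hy; simp [hy], fun _ _ => rfl⟩
  | store s A i e => exact ⟨fun _ _ => rfl, fun B hB => by simp [Prog.arrs] at hB; simp [hB]⟩
  | seq _ _ ih1 ih2 =>
      constructor
      · intro x hx
        simp only [Prog.regs, List.contains_append, Bool.or_eq_false_iff] at hx
        rw [ih2.reg x hx.2, ih1.reg x hx.1]
      · intro x hx
        simp only [Prog.arrs, List.contains_append, Bool.or_eq_false_iff] at hx
        rw [ih2.arr x hx.2, ih1.arr x hx.1]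
  | ite_true _ _ ih =>
      constructor
      · intro x hx
        simp only [Prog.regs, List.contains_append, Bool.or_eq_false_iff] at hx
        rw [ih.reg x hx.1]
      · intro x hx
        simp only [Prog.arrs, List.contains_append, Bool.or_eq_false_iff] at hx
        rw [ih.arr x hx.1]
  | ite_false _ _ ih =>
      constructor
      · intro x hx
        simp only [Prog.regs, List.contains_append, Bool.or_eq_false_iff] at hx
        rw [ih.reg x hx.2]
      · intro x hx
        simp only [Prog.arrs, List.contains_append, Bool.or_eq_false_iff] at hx
        rw [ih.arr x hx.2]
  | loop_true _ _ _ ih1 ih2 => exact ⟨fun x hx => (ih2.reg x hx).trans (ih1.reg x hx),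
      fun x hx => (ih2.arr x hx).trans (ih1.arr x hx)⟩
  | loop_false _ => exact .rfl

/-- Started in `s`, the program `c` halts within `T` steps in a memory with property `Q`. -/
def Halts (c : Prog) (s : Mem) (T : ℕ) (Q : Mem → Prop) : Prop :=
  ∃ t u, Steps c s t u ∧ t ≤ T ∧ Q u

/-! ### Proof rules for total correctness with time bounds. -/

namespace Halts

variable {c d : Prog} {s : Mem} {T T' T'' : ℕ} {Q R : Mem → Prop} {e : Expr}

theorem mono (h : Halts c s T Q) (hT : T ≤ T') (hQ : ∀ u, Frame c s u → Q u → R u) :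
    Halts c s T' R := by
  obtain ⟨t, u, h1, h2, h3⟩ := h
  exact ⟨t, u, h1, h2.trans hT, hQ u h1.frame h3⟩

theorem seq (h : Halts c s T Q) (k : ∀ u, Frame c s u → Q u → Halts d u T' R)
    (hT : T + T' ≤ T'') : Halts (.seq c d) s T'' R := by
  obtain ⟨t, u, h1, h2, h3⟩ := h
  obtain ⟨t', v, k1, k2, k3⟩ := k u h1.frame h3
  exact ⟨t + t', v, h1.seq k1, by omega, k3⟩

theorem ite (h : e.eval s ≠ 0 → Halts c s T Q) (k : e.eval s = 0 → Halts d s T Q)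
    (hT : e.cost + 1 + T ≤ T') : Halts (.ite e c d) s T' Q := by
  by_cases h0 : e.eval s = 0
  · obtain ⟨t, u, h1, h2, h3⟩ := k h0
    exact ⟨_, u, .ite_false h0 h1, by omega, h3⟩
  · obtain ⟨t, u, h1, h2, h3⟩ := h h0
    exact ⟨_, u, .ite_true h0 h1, by omega, h3⟩

/-- Straight-line code is handled by symbolic evaluation of `run`; its cost bound is a closed
numeral that can be decided. -/
theorem of_run (hl : c.loopFree = true) (hT : c.maxCost ≤ T) (hQ : Q (c.run s)) :
    Halts c s T Q := by
  suffices ∃ t, Steps c s t (c.run s) ∧ t ≤ c.maxCost by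
    obtain ⟨t, h1, h2⟩ := this
    exact ⟨t, _, h1, h2.trans hT, hQ⟩
  clear hQ hT
  induction c generalizing s with
  | skip => exact ⟨_, .skip s, le_rfl⟩
  | assign x e => exact ⟨_, .assign s x e, le_rfl⟩
  | store A i e => exact ⟨_, .store s A i e, le_rfl⟩
  | seq c d ih1 ih2 =>
      simp only [Prog.loopFree, Bool.and_eq_true] at hl
      obtain ⟨t, h1, h2⟩ := ih1 (s := s) hl.1
      obtain ⟨r, k1, k2⟩ := ih2 (s := c.run s) hl.2
      exact ⟨_, h1.seq k1, add_le_add h2 k2⟩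
  | ite e c d ih1 ih2 =>
      simp only [Prog.loopFree, Bool.and_eq_true] at hl
      by_cases h0 : e.eval s = 0
      · obtain ⟨t, h1, h2⟩ := ih2 (s := s) hl.2
        refine ⟨_, by simpa only [Prog.run, h0, if_true] using .ite_false h0 h1, ?_⟩
        simp only [Prog.maxCost]
        omega
      · obtain ⟨t, h1, h2⟩ := ih1 (s := s) hl.1
        refine ⟨_, by simpa only [Prog.run, h0, if_false] using .ite_true h0 h1, ?_⟩
        simp only [Prog.maxCost]
        omega
  | loop e c => simp [Prog.loopFree] at hl

/-- A while-loop with invariant `Inv`; `pot` bounds the remaining number of steps. -/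
theorem loop (Inv : Mem → Prop) (pot : Mem → ℕ) (h0 : Inv s)
    (hs : ∀ u, Inv u → Frame (.loop e c) s u → e.eval u ≠ 0 →
      ∃ Tb, Halts c u Tb (fun v => Inv v ∧ Tb + (e.cost + 1) + pot v ≤ pot u))
    (hT : pot s + (e.cost + 1) ≤ T) :
    Halts (.loop e c) s T (fun u => Inv u ∧ e.eval u = 0) := by
  suffices ∀ n u, Inv u → Frame (.loop e c) s u → pot u = n →
      Halts (.loop e c) u (n + (e.cost + 1)) (fun u => Inv u ∧ e.eval u = 0) from
    (this _ s h0 .rfl rfl).mono hT fun _ _ h => h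
  intro n
  induction n using Nat.strong_induction_on with
  | _ n ih =>
    intro u hu hf hn
    by_cases he : e.eval u = 0
    · exact ⟨_, u, .loop_false he, by omega, hu, he⟩
    · obtain ⟨Tb, t, v, h1, h2, h3, h4⟩ := hs u hu hf he
      obtain ⟨r, w, k1, k2, k3⟩ := ih (pot v) (by omega) v h3 (hf.trans ⟨h1.frame.reg, h1.frame.arr⟩) rfl
      exact ⟨_, w, .loop_true he h1 k1, by omega, k3⟩

/-- A for-loop with invariant `Inv` and time bound `Tb k` for round `k`. -/
theorem forTo_sum {x : ℕ} (N : ℕ) (Tb : ℕ → ℕ) (Inv : ℕ → Mem → Prop) (h0 : Inv 0 (s.setR x 0))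
    (he : ∀ u, Frame (Prog.forTo x e c) s u → e.eval u = N)
    (hx : c.regs.contains x = false)
    (hs : ∀ k u, k < N → u.reg x = k → Frame (Prog.forTo x e c) s u → Inv k u →
      Halts c u (Tb k) (fun v => Inv (k + 1) (v.setR x (k + 1))))
    (hT : ∑ k ∈ Finset.range N, (Tb k + e.cost + 7) + (e.cost + 5) ≤ T) :
    Halts (Prog.forTo x e c) s T (Inv N) := by
  have hf : ∀ v, Frame (Prog.forTo x e c) s v → ∀ w, Frame c v w → ∀ y,
      Frame (Prog.forTo x e c) s (w.setR x y) := by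
    intro v hv w hw y
    refine hv.trans ⟨fun z hz => ?_, fun A hA => ?_⟩
    · simp only [Prog.forTo, Prog.regs, List.contains_append, Bool.or_eq_false_iff] at hz
      have hzx : z ≠ x := by simpa using hz.1
      simp [hzx, hw.reg z hz.2.1]
    · simp only [Prog.forTo, Prog.arrs, List.contains_append, Bool.or_eq_false_iff] at hA
      exact hw.arr A hA.2.1
  have hf0 : Frame (Prog.forTo x e c) s (s.setR x 0) := hf s .rfl s .rfl 0
  -- Induction on the number `j` of rounds still to do. Besides its body a round costs `e.cost + 3`
  -- for the test and 4 for the increment; the initialisation costs 2 and the failing test `e.cost +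
  -- 3`.
  suffices H : ∀ j k u, k + j = N → u.reg x = k → Frame (Prog.forTo x e c) s u → Inv k u →
      Halts (.loop (.bin .lt (.reg x) e) (.seq c (.assign x (.bin .add (.reg x) (.lit 1))))) u
        (∑ i ∈ Finset.range j, (Tb (k + i) + e.cost + 7) + (e.cost + 3)) (Inv N) by
    obtain ⟨t, u, h1, h2, h3⟩ := H N 0 (s.setR x 0) (by omega) (by simp) hf0 h0
    simp only [zero_add] at h2
    exact ⟨_, u, .seq (.assign s x (.lit 0)) h1, by simp only [Expr.cost]; omega, h3⟩
  intro j
  induction j with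
  | zero =>
      intro k u hk hxu hu hI
      obtain rfl : k = N := by omega
      refine ⟨_, u, .loop_false ?_, ?_, hI⟩
      · simp [Expr.eval, BinOp.eval, he u hu, hxu]
      · simp only [Expr.cost]
        omega
  | succ j ih =>
      intro k u hk hxu hu hI
      obtain ⟨t, v, h1, h2, h3⟩ := hs k u (by omega) hxu hu hI
      have hvx : v.reg x = k := (h1.frame.reg x hx).trans hxu
      have hstep := Steps.assign v x (.bin .add (.reg x) (.lit 1))
      have heq : (Expr.bin .add (.reg x) (.lit 1)).eval v = k + 1 := by
        simp [Expr.eval, BinOp.eval, hvx]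
      rw [heq] at hstep
      obtain ⟨r, w, k1, k2, k3⟩ := ih (k + 1) (v.setR x (k + 1)) (by omega) (by simp)
        (hf u hu v h1.frame _) h3
      refine ⟨_, w, .loop_true ?_ (.seq h1 hstep) k1, ?_, k3⟩
      · simp only [Expr.eval, BinOp.eval, he u hu, hxu]
        rw [if_pos (by omega)]
        exact one_ne_zero
      · rw [Finset.sum_range_succ']
        simp only [Expr.cost, add_zero]
        have : ∀ i, k + 1 + i = k + (i + 1) := fun i => by omega
        simp only [this] at k2
        omega

/-- A for-loop with invariant `Inv`. -/
theorem forTo {x : ℕ} (N Tb : ℕ) (Inv : ℕ → Mem → Prop) (h0 : Inv 0 (s.setR x 0))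
    (he : ∀ u, Frame (Prog.forTo x e c) s u → e.eval u = N)
    (hx : c.regs.contains x = false)
    (hs : ∀ k u, k < N → u.reg x = k → Frame (Prog.forTo x e c) s u → Inv k u →
      Halts c u Tb (fun v => Inv (k + 1) (v.setR x (k + 1))))
    (hT : N * (Tb + e.cost + 7) + (e.cost + 5) ≤ T) :
    Halts (Prog.forTo x e c) s T (Inv N) :=
  forTo_sum N (fun _ => Tb) Inv h0 he hx hs (by simpa using hT)

end Halts

end SSM

namespace SSM

/-! ### Instances as tables of edges -/

/-- A table of `m` edges between `p` men and `q` women: the endpoints and the ranks of the edges;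
the edges of man `a` have the numbers from `off a` to `off (a + 1) - 1`, and woman `b` has `wd b`
edges. -/
structure Tab where
  p : ℕ
  q : ℕ
  m : ℕ
  em : ℕ → ℕ
  ew : ℕ → ℕ
  rm : ℕ → ℕ
  rw : ℕ → ℕ
  off : ℕ → ℕ
  wd : ℕ → ℕ
  em_lt : ∀ {e}, e < m → em e < p
  ew_lt : ∀ {e}, e < m → ew e < q
  inj : ∀ {e f}, e < m → f < m → em e = em f → ew e = ew f → e = f
  rm_pos : ∀ {e}, e < m → 1 ≤ rm e
  rm_le : ∀ {e}, e < m → rm e ≤ m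
  rw_pos : ∀ {e}, e < m → 1 ≤ rw e
  rw_le : ∀ {e}, e < m → rw e ≤ wd (ew e)
  off_le : ∀ a, off a ≤ m
  lt_off : ∀ {e}, e < m → ∀ a, em e < a ↔ e < off a
  sum_wd : ∑ b ∈ Finset.range q, wd b = m

namespace Tab

variable (T : Tab)

/-- Strongly stable matchings as sets of edge numbers. -/
structure Stable (N : Finset ℕ) : Prop where
  lt : ∀ e ∈ N, e < T.m
  man : ∀ e ∈ N, ∀ f ∈ N, T.em e = T.em f → e = f
  woman : ∀ e ∈ N, ∀ f ∈ N, T.ew e = T.ew f → e = f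
  stab : ∀ e < T.m, (∃ f ∈ N, T.em f = T.em e ∧ T.rm f < T.rm e) ∨
    (∃ f ∈ N, T.ew f = T.ew e ∧ T.rw f < T.rw e) ∨
    ((∃ f ∈ N, T.em f = T.em e ∧ T.rm f ≤ T.rm e) ∧ ∃ f ∈ N, T.ew f = T.ew e ∧ T.rw f ≤ T.rw e)

/-- `M` dominates `N`. -/
def Dom (M N : Finset ℕ) : Prop := ∀ f ∈ N, ∃ e ∈ M, T.em e = T.em f ∧ T.rm e ≤ T.rm f

/-- The initial threshold of woman `b`; it exceeds the ranks of all her edges. -/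
def wi (b : ℕ) : ℕ := T.wd b + if 0 < T.wd b then 1 else 0

/-- All women with a threshold `t b` below the initial one have in `N` a partner of rank at
most `t b`. -/
def Below (t : ℕ → ℕ) (N : Finset ℕ) : Prop :=
  ∀ b < T.q, t b < T.wi b → ∃ e ∈ N, T.ew e = b ∧ T.rw e ≤ t b

/-- The edge `e` remains for the thresholds `t`. -/
def Rem (t : ℕ → ℕ) (e : ℕ) : Prop := e < T.m ∧ T.rw e ≤ t (T.ew e)

/-- The edge `e` is one of the best remaining edges of its man. -/
def Eng (t : ℕ → ℕ) (e : ℕ) : Prop :=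
  T.Rem t e ∧ ∀ f, T.Rem t f → T.em f = T.em e → T.rm e ≤ T.rm f

/-- No woman is engaged to a man whom she prefers strictly to her threshold. -/
def Tight (t : ℕ → ℕ) : Prop := ∀ e, T.Eng t e → T.rw e = t (T.ew e)

/-! ### Thresholds, engagements and the matchings that obey the thresholds. -/

variable {T} {t t' : ℕ → ℕ} {M N P : Finset ℕ} {e f : ℕ}

theorem rw_lt_wi (he : e < T.m) : T.rw e < T.wi (T.ew e) := by
  have h1 := T.rw_le he
  have h2 := T.rw_pos he
  rw [wi, if_pos (by omega)]
  omega

theorem Rem.mono (h : T.Rem t' e) (ht : t' (T.ew e) ≤ t (T.ew e)) : T.Rem t e :=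
  ⟨h.1, h.2.trans ht⟩

theorem Eng.of_rm_le (h : T.Eng t e) (hf : T.Rem t f) (hm : T.em f = T.em e)
    (hr : T.rm f ≤ T.rm e) : T.Eng t f :=
  ⟨hf, fun g hg hgm => hr.trans (h.2 g hg (hgm.trans hm))⟩

/-- At a lowered threshold, `Below` speaks of the only edge of `N` at this woman, which is `e`; a
threshold that was not lowered exceeds all ranks. -/
theorem Stable.rem (hN : T.Stable N) (hb : T.Below t N) (he : e ∈ N) : T.Rem t e := by
  have hm := hN.lt e he
  refine ⟨hm, ?_⟩
  by_cases h : t (T.ew e) < T.wi (T.ew e)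
  · obtain ⟨f, hf, hw, hr⟩ := hb _ (T.ew_lt hm) h
    rwa [hN.woman f hf e he hw] at hr
  · have := rw_lt_wi hm
    omega

/-- An engaged man's woman may lower her threshold to his rank. -/
theorem Stable.exists_of_eng (hN : T.Stable N) (hb : T.Below t N) (he : T.Eng t e) :
    ∃ f ∈ N, T.ew f = T.ew e ∧ T.rw f ≤ T.rw e := by
  rcases hN.stab e he.1.1 with ⟨f, hf, hm, hr⟩ | ⟨f, hf, hw, hr⟩ | ⟨-, h⟩
  · exact absurd (he.2 f (hN.rem hb hf) hm) (not_le.mpr hr)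
  · exact ⟨f, hf, hw, hr.le⟩
  · exact h

/-- A man who does not get one of his best remaining women is rejected by all of them. -/
theorem Stable.exists_lt_of_eng (hN : T.Stable N) (hb : T.Below t N) (he : T.Eng t e)
    (h : ∀ f ∈ N, T.em f = T.em e → ¬ T.Eng t f) :
    ∃ f ∈ N, T.ew f = T.ew e ∧ T.rw f < T.rw e := by
  rcases hN.stab e he.1.1 with ⟨f, hf, hm, hr⟩ | h' | ⟨⟨f, hf, hm, hr⟩, -⟩
  · exact absurd (he.2 f (hN.rem hb hf) hm) (not_le.mpr hr)
  · exact h'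
  · exact absurd (he.of_rm_le (hN.rem hb hf) hm hr) (h f hf hm)

/-- The women of a critical set may lower their thresholds below the rank of their engagements. -/
theorem Stable.exists_lt_of_critical (hN : T.Stable N) (hb : T.Below t N) (ht : T.Tight t)
    {Z V : Finset ℕ} {g : ℕ → ℕ}
    (hg : ∀ b ∈ V, T.Eng t (g b) ∧ T.ew (g b) = b ∧ T.em (g b) ∈ Z)
    (hinj : ∀ b ∈ V, ∀ c ∈ V, T.em (g b) = T.em (g c) → b = c)
    (hcl : ∀ e, T.Eng t e → T.em e ∈ Z → T.ew e ∈ V)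
    (hreach : ∀ B ⊆ V, B.Nonempty →
      ∃ e, T.Eng t e ∧ T.em e ∈ Z ∧ T.ew e ∈ B ∧ ∀ b ∈ B, T.em (g b) ≠ T.em e) :
    ∀ b ∈ V, ∃ e ∈ N, T.ew e = b ∧ T.rw e < t b := by
  classical
  set B := V.filter (fun b => ¬ ∃ e ∈ N, T.ew e = b ∧ T.rw e < t b) with hB
  suffices hemp : B = ∅ by
    intro b hb'
    by_contra hc
    have : b ∈ B := Finset.mem_filter.mpr ⟨hb', hc⟩
    rw [hemp] at this
    exact Finset.notMem_empty b this
  by_contra hne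
  obtain ⟨e0, he0, hZ0, hB0, hne0⟩ :=
    hreach B (Finset.filter_subset _ _) (Finset.nonempty_iff_ne_empty.mpr hne)
  -- A man of `Z` engaged to a woman who does not improve must have his `N`-partner among such
  -- women: if he got no engaged edge, this woman would improve by `exists_lt_of_eng`, and if he got
  -- one, it has by tightness exactly the rank of the threshold, so its woman does not improve
  -- either.
  have key : ∀ h, T.Eng t h → T.em h ∈ Z → T.ew h ∈ B →
      ∃ f ∈ N, T.em f = T.em h ∧ T.ew f ∈ B := by
    intro h hh hZ hhB
    obtain ⟨hhV, hhn⟩ := Finset.mem_filter.mp hhB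
    by_contra hc
    refine hhn ?_
    have hno : ∀ f ∈ N, T.em f = T.em h → ¬ T.Eng t f := by
      intro f hf hm hE
      refine hc ⟨f, hf, hm, Finset.mem_filter.mpr ⟨hcl f hE (hm ▸ hZ), ?_⟩⟩
      rintro ⟨f', hf', hw, hr⟩
      rw [hN.woman f' hf' f hf hw, ht f hE] at hr
      exact lt_irrefl _ hr
    obtain ⟨f, hf, hw, hr⟩ := hN.exists_lt_of_eng hb hh hno
    exact ⟨f, hf, hw, by rwa [← ht h hh]⟩
  have hA : ∀ a ∈ insert (T.em e0) (B.image fun b => T.em (g b)),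
      ∃ f ∈ N, T.em f = a ∧ T.ew f ∈ B := by
    intro a ha
    rcases Finset.mem_insert.mp ha with rfl | ha
    · exact key e0 he0 hZ0 hB0
    · obtain ⟨b, hbB, rfl⟩ := Finset.mem_image.mp ha
      obtain ⟨h1, h2, h3⟩ := hg b (Finset.mem_filter.mp hbB).1
      exact key (g b) h1 h3 (h2.symm ▸ hbB)
  choose! F hFN hFm hFw using hA
  -- Pigeonhole: the partners under `g` of the women in `B`, together with the additional man of
  -- `e0`, are matched injectively by `N` into `B`.
  have hle : (insert (T.em e0) (B.image fun b => T.em (g b))).card ≤ B.card :=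
    Finset.card_le_card_of_injOn (fun a => T.ew (F a)) (fun a ha => hFw a ha) (by
      intro a ha a' ha' h
      have := hN.woman _ (hFN a ha) _ (hFN a' ha') h
      rw [← hFm a ha, ← hFm a' ha', this])
  rw [Finset.card_insert_of_notMem, Finset.card_image_of_injOn] at hle
  · omega
  · intro b hb' c hc' h
    exact hinj b (Finset.mem_filter.mp hb').1 c (Finset.mem_filter.mp hc').1 h
  · intro h
    obtain ⟨b, hbB, h⟩ := Finset.mem_image.mp h
    exact hne0 b hbB h

/-- The result of a terminated run. -/
theorem stable_of_tight (ht : T.Tight t) (hE : ∀ e ∈ M, T.Eng t e)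
    (man : ∀ e ∈ M, ∀ f ∈ M, T.em e = T.em f → e = f)
    (woman : ∀ e ∈ M, ∀ f ∈ M, T.ew e = T.ew f → e = f)
    (hsat : ∀ e, T.Rem t e → ∃ f ∈ M, T.em f = T.em e)
    (hval : ∀ b < T.q, t b < T.wi b → ∃ e ∈ M, T.ew e = b) : T.Stable M := by
  refine ⟨fun e he => (hE e he).1.1, man, woman, fun e he => ?_⟩
  by_cases hr : T.Rem t e
  · obtain ⟨f, hf, hm⟩ := hsat e hr
    rcases ((hE f hf).2 e hr hm.symm).lt_or_eq with h | h
    · exact .inl ⟨f, hf, hm, h⟩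
    · have hEe : T.Eng t e := (hE f hf).of_rm_le hr hm.symm h.ge
      have h1 := ht e hEe
      obtain ⟨g, hg, hw⟩ := hval _ (T.ew_lt he) (by rw [← h1]; exact rw_lt_wi he)
      refine .inr (.inr ⟨⟨f, hf, hm, h.le⟩, g, hg, hw, ?_⟩)
      rw [ht g (hE g hg), hw, h1]
  -- A rejected edge: the threshold of its woman has been lowered, so she is matched, and by
  -- tightness her partner has the rank of the threshold, which is better than `e`.
  · have h1 : t (T.ew e) < T.rw e := by
      by_contra h
      exact hr ⟨he, not_lt.mp h⟩
    obtain ⟨g, hg, hw⟩ := hval _ (T.ew_lt he) (h1.trans (rw_lt_wi he))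
    exact .inr (.inl ⟨g, hg, hw, by rwa [ht g (hE g hg), hw]⟩)

theorem Stable.dom_of_below (hN : T.Stable N) (hb : T.Below t N) (hE : ∀ e ∈ M, T.Eng t e)
    (hsat : ∀ e, T.Rem t e → ∃ f ∈ M, T.em f = T.em e) : T.Dom M N := by
  intro f hf
  obtain ⟨e, he, hm⟩ := hsat f (hN.rem hb hf)
  exact ⟨e, he, hm, (hE e he).2 f (hN.rem hb hf) hm.symm⟩

/-- Counting: `N` matches all women with lowered thresholds, and `M` covers all men of `N`, so `M`
has at least as many edges as there are such women. On the other hand `M` uses only such women,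
since by tightness its edges have the rank of the threshold, which is below the initial one. Hence
`M` misses none of them. -/
theorem Stable.valid_of_below (hN : T.Stable N) (hb : T.Below t N) (ht : T.Tight t)
    (hE : ∀ e ∈ M, T.Eng t e)
    (woman : ∀ e ∈ M, ∀ f ∈ M, T.ew e = T.ew f → e = f)
    (hsat : ∀ e, T.Rem t e → ∃ f ∈ M, T.em f = T.em e) :
    ∀ b < T.q, t b < T.wi b → ∃ e ∈ M, T.ew e = b := by
  classical
  intro b hbq htb
  by_contra hc
  set B := (Finset.range T.q).filter (fun b => t b < T.wi b) with hB
  have hbB : b ∈ B := by simp [hB, hbq, htb]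
  have h1 : B.card ≤ N.card := by
    refine Finset.card_le_card_of_surjOn T.ew ?_
    intro c hc
    have hc : c ∈ B := hc
    simp only [hB, Finset.mem_filter, Finset.mem_range] at hc
    obtain ⟨e, he, hw, -⟩ := hb c hc.1 hc.2
    exact ⟨e, he, hw⟩
  have h2 : N.card ≤ M.card := by
    rw [← Finset.card_image_of_injOn (f := T.em) (s := N) (fun e he f hf h => hN.man e he f hf h)]
    refine Finset.card_le_card_of_surjOn T.em ?_
    intro a ha
    obtain ⟨e, he, rfl⟩ := Finset.mem_image.mp ha
    obtain ⟨f, hf, hm⟩ := hsat e (hN.rem hb he)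
    exact ⟨f, hf, hm⟩
  have h3 : M.card ≤ (B.erase b).card := by
    refine Finset.card_le_card_of_injOn T.ew ?_ (fun e he f hf h => woman e he f hf h)
    intro e he
    have hem := (hE e he).1.1
    refine Finset.mem_erase.mpr ⟨fun h => hc ⟨e, he, h⟩, ?_⟩
    simp only [hB, Finset.mem_filter, Finset.mem_range]
    exact ⟨T.ew_lt hem, by rw [← ht e (hE e he)]; exact rw_lt_wi hem⟩
  rw [Finset.card_erase_of_mem hbB] at h3
  have := Finset.card_pos.mpr ⟨b, hbB⟩
  omega

/-- If `P` dominates `M` and a man has the same rank in both, then he can be given his partner in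
`M` in a strongly stable matching that all men rank like `P`. -/
theorem Stable.exists_swap (hP : T.Stable P) (hM : T.Stable M) (hd : T.Dom P M) (he : e ∈ M)
    (hf : f ∈ P) (hm : T.em e = T.em f) (hr : T.rm e = T.rm f) :
    ∃ P', T.Stable P' ∧ e ∈ P' ∧ T.Dom P P' ∧ T.Dom P' P := by
  classical
  -- the edges of `M` and of `P` at the men with equal rank
  set X := M.filter (fun x => ∃ y ∈ P, T.em y = T.em x ∧ T.rm y = T.rm x) with hX
  set Y := P.filter (fun y => ∃ x ∈ M, T.em x = T.em y ∧ T.rm x = T.rm y) with hY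
  have hPlt : ∀ y ∈ P, y ∉ Y → ∀ x ∈ M, T.em x = T.em y → T.rm y < T.rm x := by
    intro y hy hyY x hx hxy
    obtain ⟨z, hz, hzm, hzr⟩ := hd x hx
    obtain rfl := hP.man z hz y hy (hzm.trans hxy)
    refine lt_of_le_of_ne hzr fun h => hyY ?_
    exact Finset.mem_filter.mpr ⟨hy, x, hx, hxy, h.symm⟩
  -- women of the other edges of `P` improve in `M`
  have hA : ∀ y ∈ P, y ∉ Y → ∃ x ∈ M, T.ew x = T.ew y ∧ T.rw x < T.rw y := by
    intro y hy hyY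
    rcases hM.stab y (hP.lt y hy) with ⟨x, hx, hxm, hxr⟩ | h | ⟨⟨x, hx, hxm, hxr⟩, -⟩
    · exact absurd (hPlt y hy hyY x hx hxm) (by omega)
    · exact h
    · exact absurd (hPlt y hy hyY x hx hxm) (by omega)
  -- A woman of `X` is indifferent: stability of `P` at `x`, whose man is indifferent, makes her
  -- partner in `P` no worse; stability of `M` at `y`, whose man cannot improve in `M` because `P`
  -- dominates `M`, makes her partner in `M` no worse.
  have hB : ∀ x ∈ X, ∀ y ∈ P, T.ew y = T.ew x → T.rw y = T.rw x := by
    intro x hx y hy hyx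
    obtain ⟨hxM, z, hz, hzm, hzr⟩ := Finset.mem_filter.mp hx
    apply le_antisymm
    · rcases hP.stab x (hM.lt x hxM) with ⟨y', hy', h1, h2⟩ | ⟨y', hy', h1, h2⟩ |
        ⟨-, y', hy', h1, h2⟩
      · rw [hP.man y' hy' z hz (h1.trans hzm.symm)] at h2
        omega
      · rw [hP.woman y hy y' hy' (hyx.trans h1.symm)]
        exact h2.le
      · rw [hP.woman y hy y' hy' (hyx.trans h1.symm)]
        exact h2
    · rcases hM.stab y (hP.lt y hy) with ⟨x', hx', h1, h2⟩ | ⟨x', hx', h1, h2⟩ |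
        ⟨-, x', hx', h1, h2⟩
      · obtain ⟨y', hy', h3, h4⟩ := hd x' hx'
        rw [hP.man y' hy' y hy (h3.trans h1)] at h4
        omega
      · rw [hM.woman x hxM x' hx' (hyx.symm.trans h1.symm)]
        exact h2.le
      · rw [hM.woman x hxM x' hx' (hyx.symm.trans h1.symm)]
        exact h2
  have hXP : ∀ x ∈ X, ∃ y ∈ P, T.ew y = T.ew x := by
    intro x hx
    obtain ⟨hxM, z, hz, hzm, hzr⟩ := Finset.mem_filter.mp hx
    rcases hP.stab x (hM.lt x hxM) with ⟨y', hy', h1, h2⟩ | ⟨y', hy', h1, h2⟩ |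
      ⟨-, y', hy', h1, h2⟩
    · rw [hP.man y' hy' z hz (h1.trans hzm.symm)] at h2
      omega
    · exact ⟨y', hy', h1⟩
    · exact ⟨y', hy', h1⟩
  -- If her edge in `P` were outside `Y`, the woman would improve strictly in `M` by `hA`, contrary
  -- to her indifference.
  have hXY : ∀ x ∈ X, ∃ y ∈ Y, T.ew y = T.ew x := by
    intro x hx
    obtain ⟨y, hy, hyx⟩ := hXP x hx
    refine ⟨y, ?_, hyx⟩
    by_contra hyY
    obtain ⟨x', hx', h1, h2⟩ := hA y hy hyY
    have h3 := hB x hx y hy hyx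
    rw [hM.woman x' hx' x (Finset.mem_filter.mp hx).1 (h1.trans hyx)] at h2
    omega
  have hcard : Y.card ≤ X.card := by
    rw [← Finset.card_image_of_injOn (f := T.em) (s := Y) (fun a ha b hb h =>
      hP.man a (Finset.mem_filter.mp ha).1 b (Finset.mem_filter.mp hb).1 h)]
    refine Finset.card_le_card_of_surjOn T.em ?_
    intro a ha
    obtain ⟨y, hy, rfl⟩ := Finset.mem_image.mp ha
    obtain ⟨hyP, x, hx, h1, h2⟩ := Finset.mem_filter.mp hy
    exact ⟨x, Finset.mem_filter.mpr ⟨hx, y, hyP, h1.symm, h2.symm⟩, h1⟩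
  -- The women of `X` are among those of `Y`, and there are at least as many of them because `X` and
  -- `Y` have the same men. Since the women agree too, replacing `Y` by `X` in `P` gives a matching.
  have himg : X.image T.ew = Y.image T.ew := by
    refine Finset.eq_of_subset_of_card_le ?_ ?_
    · intro b hb
      obtain ⟨x, hx, rfl⟩ := Finset.mem_image.mp hb
      obtain ⟨y, hy, h⟩ := hXY x hx
      exact Finset.mem_image.mpr ⟨y, hy, h⟩
    · rw [Finset.card_image_of_injOn (f := T.ew) (s := X) (fun a ha b hb h =>
        hM.woman a (Finset.mem_filter.mp ha).1 b (Finset.mem_filter.mp hb).1 h)]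
      exact Finset.card_image_le.trans hcard
  have hYX : ∀ y ∈ Y, ∃ x ∈ X, T.ew x = T.ew y := by
    intro y hy
    have : T.ew y ∈ X.image T.ew := himg ▸ Finset.mem_image_of_mem _ hy
    obtain ⟨x, hx, h⟩ := Finset.mem_image.mp this
    exact ⟨x, hx, h⟩
  set P' := X ∪ P.filter (fun y => y ∉ Y) with hP'
  have hmem : ∀ x, x ∈ P' ↔ x ∈ X ∨ (x ∈ P ∧ x ∉ Y) := by
    intro x
    simp [hP']
  have hXM : ∀ x ∈ X, x ∈ M := fun x hx => (Finset.mem_filter.mp hx).1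
  -- men and women rank `P'` at least as good as `P`
  have hman : ∀ y ∈ P, ∃ x ∈ P', T.em x = T.em y ∧ T.rm x = T.rm y := by
    intro y hy
    by_cases hyY : y ∈ Y
    · obtain ⟨-, x, hx, h1, h2⟩ := Finset.mem_filter.mp hyY
      exact ⟨x, (hmem x).2 (.inl (Finset.mem_filter.mpr ⟨hx, y, hy, h1.symm, h2.symm⟩)), h1, h2⟩
    · exact ⟨y, (hmem y).2 (.inr ⟨hy, hyY⟩), rfl, rfl⟩
  have hwoman : ∀ y ∈ P, ∃ x ∈ P', T.ew x = T.ew y ∧ T.rw x = T.rw y := by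
    intro y hy
    by_cases hyY : y ∈ Y
    · obtain ⟨x, hx, h⟩ := hYX y hyY
      exact ⟨x, (hmem x).2 (.inl hx), h, (hB x hx y hy h.symm).symm⟩
    · exact ⟨y, (hmem y).2 (.inr ⟨hy, hyY⟩), rfl, rfl⟩
  refine ⟨P', ⟨?_, ?_, ?_, ?_⟩, ?_, ?_, ?_⟩
  · intro x hx
    rcases (hmem x).1 hx with h | h
    · exact hM.lt x (hXM x h)
    · exact hP.lt x h.1
  · have mixed : ∀ x ∈ X, ∀ y ∈ P, y ∉ Y → T.em x ≠ T.em y := by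
      intro x hx y hy hyY h
      obtain ⟨hxM, z, hz, hzm, hzr⟩ := Finset.mem_filter.mp hx
      obtain rfl := hP.man z hz y hy (hzm.trans h)
      exact hyY (Finset.mem_filter.mpr ⟨hy, x, hxM, h, hzr.symm⟩)
    intro x hx y hy hxy
    rcases (hmem x).1 hx with h | h <;> rcases (hmem y).1 hy with k | k
    · exact hM.man x (hXM x h) y (hXM y k) hxy
    · exact absurd hxy (mixed x h y k.1 k.2)
    · exact absurd hxy.symm (mixed y k x h.1 h.2)
    · exact hP.man x h.1 y k.1 hxy
  · have mixed : ∀ x ∈ X, ∀ y ∈ P, y ∉ Y → T.ew x ≠ T.ew y := by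
      intro x hx y hy hyY h
      obtain ⟨z, hz, hzx⟩ := hXY x hx
      have := hP.woman z (Finset.mem_filter.mp hz).1 y hy (hzx.trans h)
      exact hyY (this ▸ hz)
    intro x hx y hy hxy
    rcases (hmem x).1 hx with h | h <;> rcases (hmem y).1 hy with k | k
    · exact hM.woman x (hXM x h) y (hXM y k) hxy
    · exact absurd hxy (mixed x h y k.1 k.2)
    · exact absurd hxy.symm (mixed y k x h.1 h.2)
    · exact hP.woman x h.1 y k.1 hxy
  · intro x hx
    rcases hP.stab x hx with ⟨y, hy, h1, h2⟩ | ⟨y, hy, h1, h2⟩ |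
      ⟨⟨y, hy, h1, h2⟩, y', hy', h1', h2'⟩
    · obtain ⟨z, hz, h3, h4⟩ := hman y hy
      exact .inl ⟨z, hz, h3.trans h1, h4 ▸ h2⟩
    · obtain ⟨z, hz, h3, h4⟩ := hwoman y hy
      exact .inr (.inl ⟨z, hz, h3.trans h1, h4 ▸ h2⟩)
    · obtain ⟨z, hz, h3, h4⟩ := hman y hy
      obtain ⟨z', hz', h3', h4'⟩ := hwoman y' hy'
      exact .inr (.inr ⟨⟨z, hz, h3.trans h1, h4 ▸ h2⟩, z', hz', h3'.trans h1', h4' ▸ h2'⟩)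
  · exact (hmem e).2 (.inl (Finset.mem_filter.mpr ⟨he, f, hf, hm.symm, hr.symm⟩))
  · intro x hx
    rcases (hmem x).1 hx with h | h
    · obtain ⟨-, y, hy, h1, h2⟩ := Finset.mem_filter.mp h
      exact ⟨y, hy, h1, h2.le⟩
    · exact ⟨x, h.1, rfl, le_rfl⟩
  · intro y hy
    obtain ⟨x, hx, h1, h2⟩ := hman y hy
    exact ⟨x, hx, h1, h2.le⟩

end Tab
end SSM

namespace SSM

/-! ### The table of an instance -/

/-- In a sorted list the entries below `i` form an initial segment, and its length is their number.
Applied to the owners of the list entries, this identifies `offset` as the boundary between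
consecutive vertices. -/
theorem _root_.List.getElem_lt_iff_lt_countP {l : List ℕ} (hl : l.Pairwise (· ≤ ·)) {i : ℕ} :
    ∀ {e : ℕ} (he : e < l.length), l[e] < i ↔ e < l.countP (fun x => decide (x < i)) := by
  induction l with
  | nil => intro e he; simp at he
  | cons x l ih =>
      rw [List.pairwise_cons] at hl
      intro e he
      by_cases hx : x < i
      · rcases e with _ | e
        · simp [hx]
        · rw [List.getElem_cons_succ, ih hl.2 (by simpa using he), List.countP_cons]
          simp [hx]
      · have h0 : l.countP (fun x => decide (x < i)) = 0 := by
          rw [List.countP_eq_zero]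
          intro y hy
          have := hl.1 y hy
          simp
          omega
        have h1 : x ≤ (x :: l)[e] := by
          rcases e with _ | e
          · simp
          · exact hl.1 _ (List.getElem_mem _)
        rw [List.countP_cons, h0]
        simp [hx]
        omega

namespace PrefLists

variable {p q : ℕ} (L : PrefLists p q)

/-- The vertices with their neighbours, in the order of the input. -/
def pairs : List (Fin p × Fin q) :=
  (List.finRange p).flatMap (fun v => (L.nbrs v).map (fun w => (v, w)))

theorem adjList_eq : L.adjList = L.pairs.map (fun x => x.2.val) := by
  simp [adjList, pairs, List.map_flatMap, Function.comp_def]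

theorem rankList_eq : L.rankList = L.pairs.map (fun x => L.rank x.1 x.2) := by
  simp [rankList, pairs, List.map_flatMap, Function.comp_def]

theorem mem_pairs {x : Fin p × Fin q} : x ∈ L.pairs ↔ x.2 ∈ L.nbrs x.1 := by
  obtain ⟨v, w⟩ := x
  simp only [pairs, List.mem_flatMap, List.mem_finRange, true_and, List.mem_map, Prod.mk.injEq]
  constructor
  · rintro ⟨v', w', h, rfl, rfl⟩
    exact h
  · exact fun h => ⟨v, w, h, rfl, rfl⟩

theorem nodup_pairs (h : ∀ v, (L.nbrs v).Nodup) : L.pairs.Nodup := by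
  rw [pairs, List.nodup_flatMap]
  constructor
  · intro v _
    exact (h v).map fun w w' hw => (Prod.mk.inj hw).2
  · refine (List.nodup_finRange p).imp ?_
    intro v v' hv x hx hx'
    obtain ⟨w, -, rfl⟩ := List.mem_map.mp hx
    obtain ⟨w', -, h⟩ := List.mem_map.mp hx'
    exact hv (Prod.mk.inj h).1.symm

theorem pairwise_pairs : (L.pairs.map (fun x => x.1.val)).Pairwise (· ≤ ·) := by
  rw [List.pairwise_map, pairs, List.pairwise_flatMap]
  constructor
  · intro v _
    rw [List.pairwise_map]
    exact List.pairwise_of_forall fun _ _ => le_rfl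
  · refine (List.pairwise_lt_finRange p).imp ?_
    intro v v' hv x hx y hy
    obtain ⟨w, -, rfl⟩ := List.mem_map.mp hx
    obtain ⟨w', -, rfl⟩ := List.mem_map.mp hy
    exact hv.le

theorem offset_eq_countP (i : ℕ) :
    L.offset i = (L.pairs.map (fun x => x.1.val)).countP (fun x => decide (x < i)) := by
  rw [List.countP_map, pairs, List.countP_flatMap, offset, Finset.sum_filter,
    ← Fin.sum_ofFn, List.ofFn_eq_map]
  congr 1
  refine List.map_congr_left fun v _ => ?_
  simp only [Function.comp_apply, List.countP_map]
  by_cases h : v.val < i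
  · simp [h, Function.comp_def]
  · simp [h, Function.comp_def]

theorem length_pairs : L.pairs.length = L.offset p := by
  rw [offset_eq_countP, List.countP_eq_length.mpr]
  · simp
  · intro x hx
    obtain ⟨y, -, rfl⟩ := List.mem_map.mp hx
    simp

theorem offset_le (i : ℕ) : L.offset i ≤ L.pairs.length := by
  rw [offset_eq_countP]
  exact List.countP_le_length.trans (by simp)

theorem offset_zero : L.offset 0 = 0 := by simp [offset]

theorem offset_succ (v : Fin p) : L.offset (v.val + 1) = L.offset v.val + (L.nbrs v).length := by
  rw [offset, offset, Finset.sum_filter, Finset.sum_filter,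
    ← Finset.add_sum_erase _ _ (Finset.mem_univ v), if_pos (Nat.lt_succ_self _), add_comm]
  congr 1
  rw [← Finset.add_sum_erase _ _ (Finset.mem_univ v), if_neg (lt_irrefl _), zero_add]
  refine Finset.sum_congr rfl fun w hw => ?_
  have hne : w.val ≠ v.val := fun h => Finset.ne_of_mem_erase hw (Fin.ext h)
  have : w.val < v.val + 1 ↔ w.val < v.val := by omega
  simp only [this]

theorem sum_offset : ∑ b ∈ Finset.range p, (L.offset (b + 1) - L.offset b) = L.pairs.length := by
  suffices ∀ k ≤ p, ∑ b ∈ Finset.range k, (L.offset (b + 1) - L.offset b) = L.offset k by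
    rw [this p le_rfl, length_pairs]
  intro k
  induction k with
  | zero => simp [offset_zero]
  | succ k ih =>
      intro hk
      have := L.offset_succ ⟨k, hk⟩
      rw [Finset.sum_range_succ, ih (by omega)]
      simp only at this
      omega

theorem rank_pos (v : Fin p) (w : Fin q) : 1 ≤ L.rank v w := Nat.succ_le_succ (Nat.zero_le _)

/-- Ties are non-empty, so a vertex has at most as many ties as neighbours. This keeps the initial
thresholds, and with them the potential, linear in the number of edges. -/
theorem rank_le (h : ∀ v, ∀ t ∈ L v, t ≠ []) {v : Fin p} {w : Fin q} (hw : w ∈ L.nbrs v) :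
    L.rank v w ≤ (L.nbrs v).length := by
  have h1 : (L v).length ≤ (L.nbrs v).length := by
    have hv := h v
    rw [nbrs]
    generalize L v = l at hv
    induction l with
    | nil => simp
    | cons t l ih =>
        have h1 := ih fun t ht => hv t (List.mem_cons_of_mem _ ht)
        have h2 := List.length_pos_of_ne_nil (hv t List.mem_cons_self)
        simp only [List.length_cons, List.flatten_cons, List.length_append]
        omega
  refine le_trans ?_ h1
  obtain ⟨t, ht, hwt⟩ := List.mem_flatten.mp hw
  rw [rank]
  exact List.findIdx_lt_length_of_exists ⟨t, ht, by simpa using hwt⟩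

end PrefLists

namespace Inst

variable (I : Inst)

theorem length_menPairs : I.menPref.pairs.length = I.numEdges := by
  rw [numEdges, ← List.toFinset_card_of_nodup (I.menPref.nodup_pairs I.men_nodup)]
  congr 1
  ext x
  simp [PrefLists.mem_pairs, edges]

theorem length_womenPairs : I.womenPref.pairs.length = I.numEdges := by
  rw [numEdges, ← List.toFinset_card_of_nodup (I.womenPref.nodup_pairs I.women_nodup)]
  refine Finset.card_bij (fun x _ => x.swap) ?_ (fun x _ y _ h => Prod.swap_injective h) ?_
  · intro x hx
    simpa [PrefLists.mem_pairs, edges, I.mem_nbrs_iff] using hx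
  · intro x hx
    exact ⟨x.swap, by simpa [PrefLists.mem_pairs, edges, I.mem_nbrs_iff] using hx, rfl⟩

theorem exists_pair {e : ℕ} (he : e < I.numEdges) : ∃ a b, (a, b) ∈ I.edges ∧
    (I.menPref.pairs.map (fun x => x.1.val)).getD e 0 = a ∧ I.menPref.adjList.getD e 0 = b ∧
    I.menPref.rankList.getD e 0 = I.menPref.rank a b ∧
    (I.menPref.pairs.map (fun x => I.womenPref.rank x.2 x.1)).getD e 0 = I.womenPref.rank b a ∧
    I.menPref.pairs[e]? = some (a, b) := by
  rw [← length_menPairs] at he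
  refine ⟨I.menPref.pairs[e].1, I.menPref.pairs[e].2, ?_, ?_, ?_, ?_, ?_, ?_⟩
  · have := (PrefLists.mem_pairs I.menPref).mp (List.getElem_mem he)
    simpa [edges] using this
  all_goals simp [PrefLists.adjList_eq, PrefLists.rankList_eq, List.getD, he]

/-- The table of edges of an instance. -/
def tab : Tab where
  p := I.numMen
  q := I.numWomen
  m := I.numEdges
  em := fun e => (I.menPref.pairs.map (fun x => x.1.val)).getD e 0
  ew := fun e => I.menPref.adjList.getD e 0
  rm := fun e => I.menPref.rankList.getD e 0
  rw := fun e => (I.menPref.pairs.map (fun x => I.womenPref.rank x.2 x.1)).getD e 0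
  off := fun a => I.menPref.offset a
  wd := fun b => I.womenPref.offset (b + 1) - I.womenPref.offset b
  em_lt := by
    intro e he
    obtain ⟨a, b, -, h, -⟩ := I.exists_pair he
    rw [h]
    exact a.2
  ew_lt := by
    intro e he
    obtain ⟨a, b, -, -, h, -⟩ := I.exists_pair he
    rw [h]
    exact b.2
  inj := by
    intro e f he hf h k
    obtain ⟨a, b, -, h1, h2, -, -, h3⟩ := I.exists_pair he
    obtain ⟨a', b', -, k1, k2, -, -, k3⟩ := I.exists_pair hf
    rw [h1, k1] at h
    rw [h2, k2] at k
    rw [← Fin.ext h, ← Fin.ext k, ← h3] at k3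
    rw [← length_menPairs] at he
    exact ((List.getElem?_inj he (I.menPref.nodup_pairs I.men_nodup)).mp k3.symm)
  rm_pos := by
    intro e he
    obtain ⟨a, b, -, -, -, h, -⟩ := I.exists_pair he
    rw [h]
    exact PrefLists.rank_pos _ _ _
  rm_le := by
    intro e he
    obtain ⟨a, b, hab, -, -, h, -⟩ := I.exists_pair he
    rw [h]
    refine (I.menPref.rank_le I.men_ties_nonempty (by simpa [edges] using hab)).trans ?_
    have h1 := I.menPref.offset_succ a
    have h2 := I.menPref.offset_le (a + 1)
    rw [length_menPairs] at h2
    omega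
  rw_pos := by
    intro e he
    obtain ⟨a, b, -, -, -, -, h, -⟩ := I.exists_pair he
    rw [h]
    exact PrefLists.rank_pos _ _ _
  rw_le := by
    intro e he
    obtain ⟨a, b, hab, -, h2, -, h, -⟩ := I.exists_pair he
    rw [h, h2, I.womenPref.offset_succ]
    simp only [edges, Finset.mem_filter, I.mem_nbrs_iff] at hab
    have := I.womenPref.rank_le I.women_ties_nonempty hab.2
    omega
  off_le := by
    intro a
    rw [← length_menPairs]
    exact I.menPref.offset_le a
  lt_off := by
    intro e he a
    rw [← length_menPairs] at he
    rw [PrefLists.offset_eq_countP, ← List.getElem_lt_iff_lt_countP I.menPref.pairwise_pairs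
      (by simpa using he), List.getD_eq_getElem _ _ (by simpa using he)]
  sum_wd := by rw [PrefLists.sum_offset, length_womenPairs]

theorem tab_exists_pair {e : ℕ} (he : e < I.tab.m) : ∃ a b, (a, b) ∈ I.edges ∧
    I.tab.em e = a ∧ I.tab.ew e = b ∧ I.tab.rm e = I.menPref.rank a b ∧
    I.tab.rw e = I.womenPref.rank b a := by
  obtain ⟨a, b, h, h1, h2, h3, h4, -⟩ := I.exists_pair he
  exact ⟨a, b, h, h1, h2, h3, h4⟩

theorem tab_exists_edge {a : Fin I.numMen} {b : Fin I.numWomen} (h : (a, b) ∈ I.edges) :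
    ∃ e < I.tab.m, I.tab.em e = a ∧ I.tab.ew e = b ∧ I.tab.rm e = I.menPref.rank a b ∧
    I.tab.rw e = I.womenPref.rank b a := by
  have h1 : (a, b) ∈ I.menPref.pairs := by simpa [PrefLists.mem_pairs, edges] using h
  obtain ⟨e, he, h2⟩ := List.getElem_of_mem h1
  have he' := he
  rw [length_menPairs] at he'
  obtain ⟨a', b', -, k1, k2, k3, k4, k5⟩ := I.exists_pair he'
  rw [List.getElem?_eq_getElem he, h2] at k5
  obtain ⟨rfl, rfl⟩ := Prod.mk.inj (Option.some.inj k5)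
  exact ⟨e, he', k1, k2, k3, k4⟩

/-! ### Translation between sets of pairs and sets of edge numbers. -/

theorem manRank_lt_iff {M : I.PairSet} {a : Fin I.numMen} {x : ℕ∞} :
    I.manRank M a < x ↔ ∃ b, (a, b) ∈ M ∧ (I.menPref.rank a b : ℕ∞) < x := by
  simp only [manRank, iInf_lt_iff, exists_prop]

theorem womanRank_lt_iff {M : I.PairSet} {b : Fin I.numWomen} {x : ℕ∞} :
    I.womanRank M b < x ↔ ∃ a, (a, b) ∈ M ∧ (I.womenPref.rank b a : ℕ∞) < x := by
  simp only [womanRank, iInf_lt_iff, exists_prop]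

/-- It is `<`, not `≤`, that an infimum satisfies exactly when one of its members does, so the bound
is passed through `r < r + 1`. -/
theorem manRank_le_iff {M : I.PairSet} {a : Fin I.numMen} {r : ℕ} :
    I.manRank M a ≤ r ↔ ∃ b, (a, b) ∈ M ∧ I.menPref.rank a b ≤ r := by
  rw [← ENat.lt_add_one_iff (ENat.natCast_ne_top r), manRank_lt_iff]
  simp only [ENat.lt_add_one_iff (ENat.natCast_ne_top r), Nat.cast_le]

theorem womanRank_le_iff {M : I.PairSet} {b : Fin I.numWomen} {r : ℕ} :
    I.womanRank M b ≤ r ↔ ∃ a, (a, b) ∈ M ∧ I.womenPref.rank b a ≤ r := by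
  rw [← ENat.lt_add_one_iff (ENat.natCast_ne_top r), womanRank_lt_iff]
  simp only [ENat.lt_add_one_iff (ENat.natCast_ne_top r), Nat.cast_le]

/-- The edge numbers `S` are those of the pairs in `M`. -/
structure Codes (S : Finset ℕ) (M : I.PairSet) : Prop where
  lt : ∀ e ∈ S, e < I.tab.m
  edge : ∀ x ∈ M, x ∈ I.edges
  mem : ∀ e ∈ S, ∀ a b, I.tab.em e = Fin.val a → I.tab.ew e = Fin.val b → (a, b) ∈ M
  exists_mem : ∀ a b, (a, b) ∈ M → ∃ e ∈ S, I.tab.em e = a ∧ I.tab.ew e = b ∧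
    I.tab.rm e = I.menPref.rank a b ∧ I.tab.rw e = I.womenPref.rank b a

variable {I} {S S' : Finset ℕ} {M M' : I.PairSet}

theorem Codes.exists_pair (h : I.Codes S M) {e : ℕ} (he : e ∈ S) : ∃ a b, (a, b) ∈ M ∧
    I.tab.em e = a ∧ I.tab.ew e = b ∧ I.tab.rm e = I.menPref.rank a b ∧
    I.tab.rw e = I.womenPref.rank b a := by
  obtain ⟨a, b, -, h1, h2, h3⟩ := I.tab_exists_pair (h.lt e he)
  exact ⟨a, b, h.mem e he a b h1 h2, h1, h2, h3⟩

theorem exists_codes_of_pairs (hM : M ⊆ I.edges) : ∃ S, I.Codes S M := by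
  classical
  refine ⟨(Finset.range I.tab.m).filter
    (fun e => ∃ x ∈ M, I.tab.em e = Fin.val x.1 ∧ I.tab.ew e = Fin.val x.2), ?_, ?_, ?_, ?_⟩
  · intro e he
    exact Finset.mem_range.mp (Finset.mem_filter.mp he).1
  · exact fun x hx => hM hx
  · intro e he a b ha hb
    obtain ⟨x, hx, h1, h2⟩ := (Finset.mem_filter.mp he).2
    have : x = (a, b) := Prod.ext (Fin.ext (h1.symm.trans ha)) (Fin.ext (h2.symm.trans hb))
    exact this ▸ hx
  · intro a b hab
    obtain ⟨e, he, h1, h2, h3, h4⟩ := I.tab_exists_edge (hM hab)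
    exact ⟨e, Finset.mem_filter.mpr ⟨Finset.mem_range.mpr he, _, hab, h1, h2⟩, h1, h2, h3, h4⟩

theorem exists_codes_of_edges (hS : ∀ e ∈ S, e < I.tab.m) : ∃ M, I.Codes S M := by
  classical
  refine ⟨Finset.univ.filter
    (fun x => ∃ e ∈ S, I.tab.em e = Fin.val x.1 ∧ I.tab.ew e = Fin.val x.2), hS, ?_, ?_, ?_⟩
  · intro x hx
    obtain ⟨e, he, h1, h2⟩ := (Finset.mem_filter.mp hx).2
    obtain ⟨a, b, hab, k1, k2, -⟩ := I.tab_exists_pair (hS e he)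
    have : x = (a, b) := Prod.ext (Fin.ext (h1.symm.trans k1)) (Fin.ext (h2.symm.trans k2))
    exact this ▸ hab
  · intro e he a b ha hb
    exact Finset.mem_filter.mpr ⟨Finset.mem_univ _, e, he, ha, hb⟩
  · intro a b hab
    obtain ⟨e, he, h1, h2⟩ := (Finset.mem_filter.mp hab).2
    obtain ⟨a', b', -, k1, k2, k3⟩ := I.tab_exists_pair (hS e he)
    obtain rfl : a' = a := Fin.ext (k1.symm.trans h1)
    obtain rfl : b' = b := Fin.ext (k2.symm.trans h2)
    exact ⟨e, he, h1, h2, k3⟩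

theorem Codes.manRank_le_iff (h : I.Codes S M) {a : Fin I.numMen} {r : ℕ} :
    I.manRank M a ≤ r ↔ ∃ e ∈ S, I.tab.em e = a ∧ I.tab.rm e ≤ r := by
  rw [Inst.manRank_le_iff]
  constructor
  · rintro ⟨b, hb, hr⟩
    obtain ⟨e, he, h1, h2, h3, h4⟩ := h.exists_mem a b hb
    exact ⟨e, he, h1, h3 ▸ hr⟩
  · rintro ⟨e, he, hm, hr⟩
    obtain ⟨a', b, hb, h1, h2, h3, h4⟩ := h.exists_pair he
    obtain rfl : a' = a := Fin.ext (h1.symm.trans hm)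
    exact ⟨b, hb, h3 ▸ hr⟩

theorem Codes.womanRank_le_iff (h : I.Codes S M) {b : Fin I.numWomen} {r : ℕ} :
    I.womanRank M b ≤ r ↔ ∃ e ∈ S, I.tab.ew e = b ∧ I.tab.rw e ≤ r := by
  rw [Inst.womanRank_le_iff]
  constructor
  · rintro ⟨a, ha, hr⟩
    obtain ⟨e, he, h1, h2, h3, h4⟩ := h.exists_mem a b ha
    exact ⟨e, he, h2, h4 ▸ hr⟩
  · rintro ⟨e, he, hm, hr⟩
    obtain ⟨a, b', hb, h1, h2, h3, h4⟩ := h.exists_pair he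
    obtain rfl : b' = b := Fin.ext (h2.symm.trans hm)
    exact ⟨a, hb, h4 ▸ hr⟩

theorem Codes.manRank_lt_iff (h : I.Codes S M) {a : Fin I.numMen} {r : ℕ} :
    I.manRank M a < r ↔ ∃ e ∈ S, I.tab.em e = a ∧ I.tab.rm e < r := by
  rcases r with _ | r
  · simp
  · simp only [Nat.cast_add, Nat.cast_one, ENat.lt_add_one_iff (ENat.natCast_ne_top r),
      h.manRank_le_iff, Nat.lt_succ_iff]

theorem Codes.womanRank_lt_iff (h : I.Codes S M) {b : Fin I.numWomen} {r : ℕ} :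
    I.womanRank M b < r ↔ ∃ e ∈ S, I.tab.ew e = b ∧ I.tab.rw e < r := by
  rcases r with _ | r
  · simp
  · simp only [Nat.cast_add, Nat.cast_one, ENat.lt_add_one_iff (ENat.natCast_ne_top r),
      h.womanRank_le_iff, Nat.lt_succ_iff]

/-- For an edge outside the matching, the three alternatives of `stab` are the negation of blocking,
by linearity of the ranks. An edge of the matching satisfies the third alternative trivially, which
is why `stab` can range over all edges. -/
theorem Codes.isStronglyStable_iff (h : I.Codes S M) :
    I.IsStronglyStable M ↔ I.tab.Stable S := by
  constructor
  · rintro ⟨hM, hb⟩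
    refine ⟨h.lt, ?_, ?_, ?_⟩
    · intro e he f hf hef
      obtain ⟨a, b, hab, h1, h2, -⟩ := h.exists_pair he
      obtain ⟨a', b', hab', k1, k2, -⟩ := h.exists_pair hf
      obtain rfl : a = a' := Fin.ext (h1.symm.trans (hef.trans k1))
      have := hM.eq_of_man _ hab _ hab' rfl
      exact I.tab.inj (h.lt e he) (h.lt f hf) hef (by rw [h2, k2, (Prod.mk.inj this).2])
    · intro e he f hf hef
      obtain ⟨a, b, hab, h1, h2, -⟩ := h.exists_pair he
      obtain ⟨a', b', hab', k1, k2, -⟩ := h.exists_pair hf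
      obtain rfl : b = b' := Fin.ext (h2.symm.trans (hef.trans k2))
      have := hM.eq_of_woman _ hab _ hab' rfl
      exact I.tab.inj (h.lt e he) (h.lt f hf) (by rw [h1, k1, (Prod.mk.inj this).1]) hef
    · intro e he
      obtain ⟨a, b, hab, h1, h2, h3, h4⟩ := I.tab_exists_pair he
      simp only [h1, h2, h3, h4]
      rw [← h.manRank_lt_iff, ← h.womanRank_lt_iff, ← h.manRank_le_iff, ← h.womanRank_le_iff]
      by_cases hin : (a, b) ∈ M
      · exact .inr (.inr ⟨I.manRank_le_iff.mpr ⟨b, hin, le_rfl⟩,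
          I.womanRank_le_iff.mpr ⟨a, hin, le_rfl⟩⟩)
      · have hnb := hb a b
        simp only [Blocks, hab, hin, not_false_eq_true, true_and, not_or, not_and, not_le,
          not_lt] at hnb
        by_contra hc
        simp only [not_or, not_and, not_le, not_lt] at hc
        obtain ⟨c1, c2, c3⟩ := hc
        exact absurd (hnb.2 c1) (by
          rw [not_le]
          refine lt_of_le_of_ne c2 fun heq => ?_
          rcases c1.lt_or_eq with h' | h'
          · exact absurd (hnb.1 h') (not_lt.mpr c2)
          · exact absurd (c3 h'.ge) (by rw [heq]; exact lt_irrefl _))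
  · intro hS
    refine ⟨⟨h.edge, ?_, ?_⟩, ?_⟩
    · rintro ⟨a, b⟩ hab ⟨a', b'⟩ hab' heq
      obtain ⟨e, he, h1, h2, -⟩ := h.exists_mem a b hab
      obtain ⟨f, hf, k1, k2, -⟩ := h.exists_mem a' b' hab'
      simp only at heq
      subst heq
      have := hS.man e he f hf (h1.trans k1.symm)
      subst this
      rw [Fin.ext (h2.symm.trans k2)]
    · rintro ⟨a, b⟩ hab ⟨a', b'⟩ hab' heq
      obtain ⟨e, he, h1, h2, -⟩ := h.exists_mem a b hab
      obtain ⟨f, hf, k1, k2, -⟩ := h.exists_mem a' b' hab'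
      simp only at heq
      subst heq
      have := hS.woman e he f hf (h2.trans k2.symm)
      subst this
      rw [Fin.ext (h1.symm.trans k1)]
    · rintro a b ⟨hab, -, hb⟩
      obtain ⟨e, he, h1, h2, h3, h4⟩ := I.tab_exists_edge hab
      have := hS.stab e he
      simp only [h1, h2, h3, h4] at this
      rw [← h.manRank_lt_iff, ← h.womanRank_lt_iff, ← h.manRank_le_iff, ← h.womanRank_le_iff]
        at this
      rcases hb with ⟨b1, b2⟩ | ⟨b1, b2⟩ <;> rcases this with c | c | ⟨c1, c2⟩
      · exact lt_asymm b1 c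
      · exact not_lt.mpr b2 c
      · exact not_lt.mpr c1 b1
      · exact not_lt.mpr b1 c
      · exact lt_asymm b2 c
      · exact not_lt.mpr c2 b2

/-- A man unmatched in `M'` has rank `⊤` there and imposes no condition, so it suffices to look at
the edges of the dominated matching. -/
theorem Codes.dominates_iff (h : I.Codes S M) (h' : I.Codes S' M') :
    (∀ a, I.manRank M a ≤ I.manRank M' a) ↔ I.tab.Dom S S' := by
  constructor
  · intro hd f hf
    obtain ⟨a, b, -, h1, -⟩ := h'.exists_pair hf
    rw [h1, ← h.manRank_le_iff]
    exact (hd a).trans (h'.manRank_le_iff.mpr ⟨f, hf, h1, le_rfl⟩)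
  · intro hd a
    by_contra hc
    rw [not_le, Inst.manRank_lt_iff] at hc
    obtain ⟨b, hb, hr⟩ := hc
    obtain ⟨f, hf, h1, -, h3, -⟩ := h'.exists_mem a b hb
    obtain ⟨e, he, k1, k2⟩ := hd f hf
    exact absurd hr (not_lt.mpr (h.manRank_le_iff.mpr ⟨e, he, k1.trans h1, h3 ▸ k2⟩))

end Inst

open Classical in
/-- The memory `u` holds the representation of the irreducible classes. -/
structure Tab.Output (T : Tab) (u : Mem) (S : ℕ → Finset ℕ) : Prop where
  stable : ∀ i < u.reg 3, T.Stable (S i)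
  irr : ∀ i < u.reg 3, ∃ e ∈ S i, ∀ N, T.Stable N → e ∈ N → T.Dom (S i) N
  ne : ∀ i < u.reg 3, ∀ j < u.reg 3, T.Dom (S i) (S j) → T.Dom (S j) (S i) → i = j
  cov : ∀ N, T.Stable N → ∀ e ∈ N, ∃ i < u.reg 3, T.Dom (S i) N ∧
    ∃ f ∈ S i, T.em f = T.em e ∧ T.rm f = T.rm e
  row : ∀ i < u.reg 3, ∀ e ∈ S i, u.arr 6 (i * T.p + T.em e) = T.ew e + 1
  row_zero : ∀ i < u.reg 3, ∀ a < T.p, (∀ e ∈ S i, T.em e ≠ a) → u.arr 6 (i * T.p + a) = 0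
  table : ∀ i < u.reg 3, ∀ j < u.reg 3, u.arr 7 (i * u.reg 3 + j) =
    if T.Dom (S j) (S i) ∧ ¬ T.Dom (S i) (S j) then 1 else 0

/-- The point is that no irreducible class is missed. If `M` is man-optimal for `(a, b)`, then `cov`
yields a row that dominates `M` and gives `a` a partner of the same rank, possibly another woman. By
`exists_swap` the class of the row has a member containing `(a, b)`; this one is dominated by `M`,
so the two classes coincide. -/
theorem Tab.Output.isRepresentation {I : Inst} {u : Mem} {S : ℕ → Finset ℕ}
    (h : I.tab.Output u S) : I.IsRepresentation u := by
  classical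
  have hex : ∀ i : Fin (u.reg 3), ∃ N : I.Stable, I.Codes (S i) N.1 := by
    intro i
    obtain ⟨M, hM⟩ := Inst.exists_codes_of_edges (I := I) (h.stable i i.2).lt
    exact ⟨⟨M, hM.isStronglyStable_iff.mpr (h.stable i i.2)⟩, hM⟩
  choose N hN using hex
  have hdom : ∀ i j, I.Dominates (N i) (N j) ↔ I.tab.Dom (S i) (S j) :=
    fun i j => (hN i).dominates_iff (hN j)
  refine ⟨N, ?_, ?_, ?_, ?_, ?_⟩
  · intro i j hij
    have hq : ∀ a, I.manRank (N i).1 a = I.manRank (N j).1 a := Quotient.exact hij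
    exact Fin.ext (h.ne i i.2 j j.2 ((hdom i j).mp fun a => (hq a).le)
      ((hdom j i).mp fun a => (hq a).ge))
  · ext c
    constructor
    · rintro ⟨i, rfl⟩
      obtain ⟨e, he, hd⟩ := h.irr i i.2
      obtain ⟨a, b, hab, h1, h2, -⟩ := (hN i).exists_pair he
      refine ⟨a, b, N i, ⟨hab, fun K hK => ?_⟩, rfl⟩
      obtain ⟨R, hR⟩ := Inst.exists_codes_of_pairs K.2.1.subset_edges
      obtain ⟨f, hf, k1, k2, -⟩ := hR.exists_mem a b hK
      obtain rfl := I.tab.inj (hR.lt f hf) ((hN i).lt e he) (k1.trans h1.symm) (k2.trans h2.symm)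
      exact ((hN i).dominates_iff hR).mpr (hd R (hR.isStronglyStable_iff.mp K.2) hf)
    · rintro ⟨a, b, M, ⟨hab, hopt⟩, rfl⟩
      obtain ⟨R, hR⟩ := Inst.exists_codes_of_pairs M.2.1.subset_edges
      have hRS := hR.isStronglyStable_iff.mp M.2
      obtain ⟨e, he, h1, h2, -⟩ := hR.exists_mem a b hab
      obtain ⟨i, hi, hd, f, hf, hfm, hfr⟩ := h.cov R hRS e he
      obtain ⟨P, hP, heP, hd1, hd2⟩ :=
        (h.stable i hi).exists_swap hRS hd he hf hfm.symm hfr.symm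
      obtain ⟨K, hK⟩ := Inst.exists_codes_of_edges (I := I) hP.lt
      have hMK := hopt ⟨K, hK.isStronglyStable_iff.mpr hP⟩ (hK.mem e heP a b h1 h2)
      have hKN := (hK.dominates_iff (hN ⟨i, hi⟩)).mpr hd2
      have hNM := ((hN ⟨i, hi⟩).dominates_iff hR).mpr hd
      exact ⟨⟨i, hi⟩, Quotient.sound fun a => le_antisymm (hNM a) ((hMK a).trans (hKN a))⟩
  · intro i a b hab
    obtain ⟨e, he, h1, h2, -⟩ := (hN i).exists_mem a b hab
    have := h.row i i.2 e he
    rwa [h1, h2] at this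
  · intro i a ha
    refine h.row_zero i i.2 a a.2 fun e he hea => ?_
    obtain ⟨a', b, hab, h1, -⟩ := (hN i).exists_pair he
    obtain rfl : a' = a := Fin.ext (h1.symm.trans hea)
    exact ha b hab
  · intro i j
    rw [h.table i i.2 j j.2, lt_iff_le_not_ge]
    have h1 : I.cls (N i) ≤ I.cls (N j) ↔ I.tab.Dom (S j) (S i) := hdom j i
    have h2 : I.cls (N j) ≤ I.cls (N i) ↔ I.tab.Dom (S i) (S j) := hdom i j
    rw [h1, h2]
    congr

end SSM

namespace SSM

/-! ### The program -/

namespace Algo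

open Prog SSM.Expr

/-- Lower the threshold of the woman in register 18 and free her. -/
def lower (v : Expr) : Prog :=
  seq (store 11 (reg 18) v)
    (ite (get 13 (reg 18))
      (seq (store 12 (get 8 (bin .sub (get 13 (reg 18)) (lit 1))) (lit 0))
        (store 13 (reg 18) (lit 0)))
      skip)

/-- Array 14: the best rank of a remaining edge of each man. -/
def bestRanks : Prog :=
  seq (forTo 6 (reg 0) (store 14 (reg 6) (bin .add (reg 2) (lit 1))))
    (forTo 6 (reg 2)
      (ite (bin .lt (get 10 (reg 6)) (bin .add (get 11 (get 1 (reg 6))) (lit 1)))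
        (ite (bin .lt (get 2 (reg 6)) (get 14 (get 8 (reg 6))))
          (store 14 (get 8 (reg 6)) (get 2 (reg 6)))
          skip)
        skip))

/-- Engaged women lower their thresholds to the best engagement; register 8 tells whether
something has changed. -/
def tighten : Prog :=
  seq (assign 8 (lit 0))
    (forTo 6 (reg 2)
      (seq (assign 18 (get 1 (reg 6)))
        (ite (bin .mul (bin .lt (get 10 (reg 6)) (get 11 (reg 18)))
            (bin .eq (get 2 (reg 6)) (get 14 (get 8 (reg 6)))))
          (seq (lower (get 10 (reg 6))) (assign 8 (lit 1)))
          skip)))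

/-- Register 9: a free man with a remaining edge, plus 1. -/
def findRoot : Prog :=
  seq (assign 9 (lit 0))
    (forTo 6 (reg 0)
      (ite (bin .mul (bin .eq (get 12 (reg 6)) (lit 0))
          (bin .lt (get 14 (reg 6)) (bin .add (reg 2) (lit 1))))
        (assign 9 (bin .add (reg 6) (lit 1)))
        skip))

/-- Scan the edge in register 14 of the man in register 13. -/
def scan : Prog :=
  seq (assign 18 (get 1 (reg 14)))
    (seq
      (ite (bin .mul
          (bin .mul (bin .lt (get 10 (reg 14)) (bin .add (get 11 (reg 18)) (lit 1)))
            (bin .eq (get 2 (reg 14)) (get 14 (reg 13))))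
          (bin .eq (get 15 (reg 18)) (lit 0)))
        (seq (store 15 (reg 18) (bin .add (reg 14) (lit 1)))
          (ite (get 13 (reg 18))
            (seq (store 16 (reg 11) (get 8 (bin .sub (get 13 (reg 18)) (lit 1))))
              (assign 11 (bin .add (reg 11) (lit 1))))
            (assign 12 (bin .add (reg 14) (lit 1)))))
        skip)
      (assign 14 (bin .add (reg 14) (lit 1))))

/-- Breadth-first search along alternating paths. -/
def search : Prog :=
  seq (forTo 6 (reg 1) (store 15 (reg 6) (lit 0)))
    (seq
      (seq (store 16 (lit 0) (bin .sub (reg 9) (lit 1)))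
        (seq (assign 10 (lit 0)) (seq (assign 11 (lit 1)) (assign 12 (lit 0)))))
      (loop (bin .lt (reg 10) (reg 11))
        (seq (seq (assign 13 (get 16 (reg 10))) (assign 14 (get 0 (reg 13))))
          (seq
            (forTo 21 (bin .sub (get 0 (bin .add (reg 13) (lit 1))) (get 0 (reg 13))) scan)
            (assign 10 (bin .add (reg 10) (lit 1)))))))

/-- Augment the matching along the path that ends with the edge in register 12. -/
def augment : Prog :=
  loop (reg 12)
    (seq (assign 19 (bin .sub (reg 12) (lit 1)))
      (seq (assign 13 (get 8 (reg 19)))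
        (seq (assign 20 (get 12 (reg 13)))
          (seq (store 12 (reg 13) (reg 12))
            (seq (store 13 (get 1 (reg 19)) (reg 12))
              (ite (reg 20)
                (seq (assign 18 (get 1 (bin .sub (reg 20) (lit 1))))
                  (seq (store 13 (reg 18) (lit 0)) (assign 12 (get 15 (reg 18)))))
                (assign 12 (lit 0))))))))

/-- All visited women reject their engagements. -/
def reject : Prog :=
  forTo 6 (reg 1)
    (ite (get 15 (reg 6))
      (seq (assign 18 (reg 6)) (lower (bin .sub (get 11 (reg 18)) (lit 1))))
      skip)

/-- The initial threshold of the woman in register 6. -/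
def initial : Expr :=
  bin .add (bin .sub (get 3 (bin .add (reg 6) (lit 1))) (get 3 (reg 6)))
    (bin .lt (lit 0) (bin .sub (get 3 (bin .add (reg 6) (lit 1))) (get 3 (reg 6))))

/-- Register 17: are all women with a lowered threshold matched? -/
def validate : Prog :=
  seq (assign 17 (lit 1))
    (forTo 6 (reg 1)
      (ite (bin .mul (bin .lt (get 11 (reg 6)) initial) (bin .eq (get 13 (reg 6)) (lit 0)))
        (assign 17 (lit 0))
        skip))

/-- Write the matching and the ranks of the men into row `k`. -/
def writeRow : Prog :=
  forTo 6 (reg 0)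
    (seq
      (ite (get 12 (reg 6))
        (store 6 (bin .add (bin .mul (reg 3) (reg 0)) (reg 6))
          (bin .add (get 1 (bin .sub (get 12 (reg 6)) (lit 1))) (lit 1)))
        (store 6 (bin .add (bin .mul (reg 3) (reg 0)) (reg 6)) (lit 0)))
      (store 17 (bin .add (bin .mul (reg 3) (reg 0)) (reg 6)) (get 14 (reg 6))))

/-- Register 15: do the ranks in row `k` agree with those of an earlier row? -/
def findRow : Prog :=
  seq (assign 15 (lit 0))
    (forTo 7 (reg 3)
      (seq
        (seq (assign 16 (lit 1))
          (forTo 6 (reg 0)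
            (ite (bin .eq (get 17 (bin .add (bin .mul (reg 7) (reg 0)) (reg 6))) (get 14 (reg 6)))
              skip
              (assign 16 (lit 0)))))
        (ite (reg 16) (assign 15 (lit 1)) skip)))

/-- Record the matching unless its class is known. -/
def record : Prog :=
  seq writeRow (seq findRow (ite (reg 15) skip (assign 3 (bin .add (reg 3) (lit 1)))))

/-- All women who are engaged to the man in register 4 reject him. -/
def force : Prog :=
  forTo 6 (reg 2)
    (seq (assign 18 (get 1 (reg 6)))
      (ite (bin .mul
          (bin .mul (bin .eq (get 8 (reg 6)) (reg 4))
            (bin .eq (get 2 (reg 6)) (get 14 (reg 4))))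
          (bin .lt (get 10 (reg 6)) (bin .add (get 11 (reg 18)) (lit 1))))
        (lower (bin .sub (get 10 (reg 6)) (lit 1)))
        skip))

/-- The empty matching and the initial thresholds. -/
def reset : Prog :=
  seq (forTo 6 (reg 0) (store 12 (reg 6) (lit 0)))
    (forTo 6 (reg 1) (seq (store 13 (reg 6) (lit 0)) (store 11 (reg 6) initial)))

/-- One round for the man in register 4; register 5 is set to 0 when he is done. -/
def round : Prog :=
  seq (seq bestRanks tighten)
    (ite (reg 8) skip
      (seq findRoot
        (ite (reg 9)
          (seq search (ite (reg 12) augment reject))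
          (seq validate
            (ite (bin .mul (reg 17) (get 12 (reg 4)))
              (seq record force)
              (assign 5 (lit 0)))))))

/-- All man-optimal matchings for the ranks of the man in register 4. -/
def manRun : Prog :=
  ite (bin .lt (get 0 (reg 4)) (get 0 (bin .add (reg 4) (lit 1))))
    (seq reset (seq (assign 5 (lit 1)) (loop (reg 5) round)))
    skip

/-- Array `B`: the owners of the entries of the concatenated lists with offsets in array `A`. -/
def owners (n : Expr) (A B : ℕ) : Prog :=
  forTo 6 n (forTo 7 (reg 2)
    (ite (bin .lt (get A (reg 6)) (bin .add (reg 7) (lit 1))) (store B (reg 7) (reg 6)) skip))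

/-- Array 10: the ranks of the edges for the women. -/
def womenRanks : Prog :=
  forTo 6 (reg 2) (forTo 7 (reg 2)
    (ite (bin .mul (bin .eq (get 9 (reg 7)) (get 1 (reg 6)))
        (bin .eq (get 4 (reg 7)) (get 8 (reg 6))))
      (store 10 (reg 6) (get 5 (reg 7)))
      skip))

/-- The men (array 8) and the ranks for the women (array 10) of all edges. -/
def setup : Prog :=
  seq (owners (reg 0) 0 8) (seq (owners (reg 1) 3 9) womenRanks)

/-- The table of the order. -/
def order : Prog :=
  forTo 6 (reg 3) (forTo 7 (reg 3)
    (seq (seq (assign 15 (lit 1)) (assign 16 (lit 0)))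
      (seq
        (forTo 13 (reg 0)
          (seq
            (ite (bin .lt (get 17 (bin .add (bin .mul (reg 6) (reg 0)) (reg 13)))
                (get 17 (bin .add (bin .mul (reg 7) (reg 0)) (reg 13))))
              (assign 15 (lit 0)) skip)
            (ite (bin .lt (get 17 (bin .add (bin .mul (reg 7) (reg 0)) (reg 13)))
                (get 17 (bin .add (bin .mul (reg 6) (reg 0)) (reg 13))))
              (assign 16 (lit 1)) skip)))
        (ite (reg 15)
          (store 7 (bin .add (bin .mul (reg 6) (reg 3)) (reg 7)) (reg 16))
          (store 7 (bin .add (bin .mul (reg 6) (reg 3)) (reg 7)) (lit 0))))))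

/-- The whole program. -/
def main : Prog :=
  ite (reg 2) (seq setup (seq (forTo 4 (reg 0) manRun) order)) skip

/-- No expression of the program has size above 20; products and larger sums occur only in tests and
indices, never as written values. -/
theorem main_incr : main.incr 20 = true := by decide

end Algo
end SSM

namespace SSM

/-! ### States of the program -/

/-- The registers and arrays that hold the table. -/
structure Ctx (T : Tab) (u : Mem) : Prop where
  p : u.reg 0 = T.p
  q : u.reg 1 = T.q
  m : u.reg 2 = T.m
  off : u.arr 0 = T.off
  ew : u.arr 1 = T.ew
  rm : u.arr 2 = T.rm
  wd : ∀ b, u.arr 3 (b + 1) - u.arr 3 b = T.wd b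
  em : u.arr 8 = T.em
  rw : u.arr 10 = T.rw

/-- The program does not change the table. -/
def Prog.keeps (c : Prog) : Bool :=
  [0, 1, 2].all (fun x => c.regs.contains x == false) &&
    [0, 1, 2, 3, 8, 10].all (fun A => c.arrs.contains A == false)

theorem Ctx.of_frame {T : Tab} {c : Prog} {s u : Mem} (h : Ctx T s) (hf : Frame c s u)
    (hc : c.keeps = true) : Ctx T u := by
  simp only [Prog.keeps, List.all_cons, List.all_nil, Bool.and_true, Bool.and_eq_true,
    beq_iff_eq] at hc
  obtain ⟨⟨h0, h1, h2⟩, a0, a1, a2, a3, a8, a10⟩ := hc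
  exact ⟨(hf.reg 0 h0).trans h.p, (hf.reg 1 h1).trans h.q, (hf.reg 2 h2).trans h.m,
    (hf.arr 0 a0).trans h.off, (hf.arr 1 a1).trans h.ew, (hf.arr 2 a2).trans h.rm,
    by rw [hf.arr 3 a3]; exact h.wd, (hf.arr 8 a8).trans h.em, (hf.arr 10 a10).trans h.rw⟩

/-- The arrays `mM` and `mW` hold a matching of engaged edges (as edge numbers plus 1). -/
structure MatchOK (T : Tab) (t mM mW : ℕ → ℕ) : Prop where
  man : ∀ a < T.p, ∀ e, mM a = e + 1 → T.em e = a ∧ T.Eng t e ∧ T.rw e = t (T.ew e) ∧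
    mW (T.ew e) = e + 1
  woman : ∀ b < T.q, ∀ e, mW b = e + 1 → e < T.m ∧ T.ew e = b ∧ mM (T.em e) = e + 1

/-- The potential that decreases with every round. -/
def Tab.pot (T : Tab) (t mM : ℕ → ℕ) : ℕ :=
  2 * ∑ b ∈ Finset.range T.q, t b +
    (((Finset.range T.m).image T.em).filter (fun a => mM a = 0)).card

/-- The array `cur` holds the best ranks of remaining edges. -/
structure CurOK (T : Tab) (t cur : ℕ → ℕ) : Prop where
  le : ∀ e, T.Rem t e → cur (T.em e) ≤ T.rm e
  att : ∀ a < T.p, cur a = T.m + 1 ∨ ∃ e, T.Rem t e ∧ T.em e = a ∧ T.rm e = cur a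

section

variable {T : Tab} {t mM mW cur : ℕ → ℕ} {w v e : ℕ}

/-- The value `m + 1` marks a man without remaining edges. It exceeds every rank, so at the man of a
remaining edge the stored value is attained. -/
theorem CurOK.eng_iff (h : CurOK T t cur) (he : T.Rem t e) :
    T.Eng t e ↔ T.rm e = cur (T.em e) := by
  constructor
  · intro hE
    refine le_antisymm ?_ (h.le e he)
    rcases h.att _ (T.em_lt he.1) with h' | ⟨f, hf, hm, hr⟩
    · have := T.rm_le he.1
      omega
    · rw [← hr]
      exact hE.2 f hf hm
  · intro hr
    refine ⟨he, fun f hf hm => ?_⟩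
    rw [hr, ← hm]
    exact h.le f hf

/-- Lowering the threshold of another woman only removes competitors of `e`. -/
theorem Tab.Eng.update (h : T.Eng t e) (hw : T.ew e ≠ w) (hv : v ≤ t w) :
    T.Eng (Function.update t w v) e := by
  have hle : ∀ b, Function.update t w v b ≤ t b := by
    intro b
    rw [Function.update_apply]
    split_ifs with hb
    · exact hb ▸ hv
    · exact le_rfl
  refine ⟨⟨h.1.1, ?_⟩, fun f hf => h.2 f (hf.mono (hle _))⟩
  rw [Function.update_of_ne hw]
  exact h.1.2

theorem MatchOK.eng (h : MatchOK T t mM mW) {a : ℕ} (ha : a < T.p) (he : mM a = e + 1) :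
    T.Eng t e := (h.man a ha e he).2.1

theorem MatchOK.lower_free (h : MatchOK T t mM mW) (hw : mW w = 0) (hv : v < t w) :
    MatchOK T (Function.update t w v) mM mW := by
  refine ⟨fun a ha e he => ?_, h.woman⟩
  obtain ⟨h1, h2, h3, h4⟩ := h.man a ha e he
  have hne : T.ew e ≠ w := by
    rintro rfl
    omega
  exact ⟨h1, h2.update hne hv.le, by rwa [Function.update_of_ne hne], h4⟩

theorem MatchOK.lower_matched (h : MatchOK T t mM mW) (hwq : w < T.q) (hw : mW w = e + 1)
    (hv : v < t w) : MatchOK T (Function.update t w v) (Function.update mM (T.em e) 0)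
      (Function.update mW w 0) := by
  obtain ⟨g1, g2, g3⟩ := h.woman w hwq e hw
  constructor
  · intro a ha f hf
    rw [Function.update_apply] at hf
    split_ifs at hf with hae
    obtain ⟨h1, h2, h3, h4⟩ := h.man a ha f hf
    have hne : T.ew f ≠ w := by
      rintro rfl
      have : f = e := by omega
      exact hae (this ▸ h1.symm)
    rw [Function.update_of_ne hne, Function.update_of_ne hne]
    exact ⟨h1, h2.update hne hv.le, h3, h4⟩
  · intro b hb f hf
    rw [Function.update_apply] at hf
    split_ifs at hf with hbw
    obtain ⟨h1, h2, h3⟩ := h.woman b hb f hf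
    refine ⟨h1, h2, ?_⟩
    rw [Function.update_of_ne, h3]
    intro hef
    rw [hef, g3] at h3
    have : e = f := by omega
    exact hbw (by rw [← h2, ← this, g2])

theorem sum_update_lt (hw : w < T.q) (hv : v < t w) :
    ∑ b ∈ Finset.range T.q, Function.update t w v b < ∑ b ∈ Finset.range T.q, t b := by
  refine Finset.sum_lt_sum (fun b _ => ?_) ⟨w, Finset.mem_range.mpr hw, by simpa using hv⟩
  rw [Function.update_apply]
  split_ifs with hb
  · exact hb ▸ hv.le
  · exact le_rfl

theorem pot_lower_free (hw : w < T.q) (hv : v < t w) :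
    T.pot (Function.update t w v) mM < T.pot t mM := by
  have := sum_update_lt hw hv
  simp only [Tab.pot]
  omega

/-- The factor 2 in `Tab.pot` is needed here: a lowered threshold gains at least 2, while the man
who becomes free costs at most 1. -/
theorem pot_lower_matched (hw : w < T.q) (hv : v < t w) (a : ℕ) :
    T.pot (Function.update t w v) (Function.update mM a 0) < T.pot t mM := by
  have h1 := sum_update_lt hw hv
  have h2 : (((Finset.range T.m).image T.em).filter (fun b => Function.update mM a 0 b = 0)).card
      ≤ (((Finset.range T.m).image T.em).filter (fun b => mM b = 0)).card + 1 := by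
    refine le_trans (Finset.card_le_card (t := insert a _) ?_) (Finset.card_insert_le a _)
    intro b hb
    obtain ⟨hb1, hb2⟩ := Finset.mem_filter.mp hb
    rw [Function.update_apply] at hb2
    by_cases hba : b = a
    · exact Finset.mem_insert.mpr (.inl hba)
    · rw [if_neg hba] at hb2
      exact Finset.mem_insert_of_mem (Finset.mem_filter.mpr ⟨hb1, hb2⟩)
  simp only [Tab.pot]
  omega

end

/-- The matching of the memory `u` is valid for the thresholds in `u`. -/
abbrev MOK (T : Tab) (u : Mem) : Prop := MatchOK T (u.arr 11) (u.arr 12) (u.arr 13)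

/-- The potential of the memory `u`. -/
abbrev mpot (T : Tab) (u : Mem) : ℕ := T.pot (u.arr 11) (u.arr 12)

/-! ### Specifications of the steps that lower thresholds and inspect the matching. -/

namespace Algo

open Prog SSM.Expr

variable {T : Tab} {s : Mem}

theorem lower_spec {v : Expr} {val : ℕ} {R : ℕ} (hc : Ctx T s) (hM : MOK T s)
    (hw : s.reg 18 < T.q) (hval : v.eval s = val) (hv : val < s.arr 11 (s.reg 18))
    (hR : v.cost + 20 ≤ R) :
    Halts (lower v) s R (fun u => MOK T u ∧ mpot T u < mpot T s ∧
      u.arr 11 = Function.update (s.arr 11) (s.reg 18) val) := by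
  refine Halts.of_run rfl (by simp only [lower, maxCost, Expr.cost]; omega) ?_
  simp only [lower, run, Expr.eval, BinOp.eval, Mem.setA_reg, Mem.setA_arr]
  norm_num
  rw [hval]
  split_ifs with h0
  · refine ⟨?_, ?_, ?_⟩
    · simpa [MOK] using hM.lower_free h0 hv
    · simpa [mpot] using pot_lower_free hw hv
    · simp
  · obtain ⟨e, he⟩ := Nat.exists_eq_succ_of_ne_zero h0
    refine ⟨?_, ?_, ?_⟩
    · simpa [MOK, he, hc.em] using hM.lower_matched hw he hv
    · simpa [mpot, he, hc.em] using pot_lower_matched hw hv _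
    · simp

theorem bestRanks_spec {R : ℕ} (hc : Ctx T s) (hR : 40 * (T.p + T.m + 1) ≤ R) :
    Halts bestRanks s R (fun u => CurOK T (s.arr 11) (u.arr 14)) := by
  refine Halts.seq (Halts.forTo T.p 10 (fun k u => ∀ a < k, u.arr 14 a = T.m + 1) (by simp)
    (fun u hf => (hf.reg 0 rfl).trans hc.p) rfl ?_ le_rfl) ?_ ?_
    (T' := 34 * T.m + 10)
  · intro k u hk hx hf hI
    refine Halts.of_run rfl (by decide) ?_
    have hc' := hc.of_frame hf rfl
    intro a ha
    simp only [run, Expr.eval, BinOp.eval, Mem.setA_arr, Mem.setR_arr, if_true,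
      Function.update_apply, hx, hc'.m]
    split_ifs with h
    · rfl
    · exact hI a (by omega)
  · intro u hf hI
    have hc1 := hc.of_frame hf rfl
    have h11 : u.arr 11 = s.arr 11 := hf.arr 11 rfl
    refine Halts.mono (Halts.forTo T.m 24 (fun k u => (∀ e < k, T.Rem (s.arr 11) e →
      u.arr 14 (T.em e) ≤ T.rm e) ∧ (∀ a < T.p, u.arr 14 a = T.m + 1 ∨
      ∃ e, T.Rem (s.arr 11) e ∧ T.em e = a ∧ T.rm e = u.arr 14 a)) ?_
      (fun u hf => (hf.reg 2 rfl).trans hc1.m) rfl ?_ le_rfl) ?_ ?_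
    · exact ⟨by simp, fun a ha => .inl (hI a ha)⟩
    · intro k v hk hx hfv hv
      refine Halts.of_run rfl (by decide) ?_
      have hc2 := hc1.of_frame hfv rfl
      have k11 : v.arr 11 = s.arr 11 := (hfv.arr 11 rfl).trans h11
      simp only [run, Expr.eval, BinOp.eval, hx, hc2.ew, hc2.rm, hc2.rw, hc2.em, k11]
      by_cases h1 : T.rw k < s.arr 11 (T.ew k) + 1
      · have hrem : T.Rem (s.arr 11) k := ⟨hk, by omega⟩
        by_cases h2 : T.rm k < v.arr 14 (T.em k)
        · simp only [h1, h2, if_true, one_ne_zero, if_false, Mem.setR_arr, Mem.setA_arr]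
          constructor
          · intro e he hr
            rw [Function.update_apply]
            split_ifs with hem
            · rcases Nat.lt_succ_iff_lt_or_eq.mp he with h | rfl
              · have := hv.1 e h hr
                rw [hem] at this
                omega
              · exact le_rfl
            · exact hv.1 e (lt_of_le_of_ne (by omega) (fun h => hem (by rw [h]))) hr
          · intro a ha
            rw [Function.update_apply]
            split_ifs with hem
            · exact .inr ⟨k, hrem, hem.symm, rfl⟩
            · exact hv.2 a ha
        · simp only [h1, h2, if_true, if_false, one_ne_zero, Mem.setR_arr]
          refine ⟨fun e he hr => ?_, hv.2⟩
          rcases Nat.lt_succ_iff_lt_or_eq.mp he with h | rfl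
          · exact hv.1 e h hr
          · omega
      · simp only [h1, if_true, if_false, Mem.setR_arr]
        refine ⟨fun e he hr => ?_, hv.2⟩
        rcases Nat.lt_succ_iff_lt_or_eq.mp he with h | rfl
        · exact hv.1 e h hr
        · exact absurd hr.2 (by omega)
    · simp only [Expr.cost]
      omega
    · intro v hfv hv
      exact ⟨fun e he => hv.1 e he.1 he, hv.2⟩
  · simp only [Expr.cost]
    omega

/-- Every strongly stable matching that obeys the thresholds `t` obeys the thresholds `t'`. -/
def Keeps (T : Tab) (t t' : ℕ → ℕ) : Prop := ∀ N, T.Stable N → T.Below t N → T.Below t' N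

/-- The best ranks were computed for the thresholds at the start and are not updated during the
scan. This is harmless: an edge that was engaged at the start and still remains is engaged now,
since its man has only lost alternatives. If no threshold changes, the stored ranks are still exact,
and the failed tests say that the thresholds are tight. -/
theorem tighten_spec {R : ℕ} (hc : Ctx T s) (hM : MOK T s) (hcur : CurOK T (s.arr 11) (s.arr 14))
    (hR : 80 * (T.m + 1) ≤ R) :
    Halts tighten s R (fun u => MOK T u ∧ Keeps T (s.arr 11) (u.arr 11) ∧
      (∀ b, u.arr 11 b ≤ s.arr 11 b) ∧
      (u.reg 8 = 0 → (u.arr 11 = s.arr 11 ∧ u.arr 12 = s.arr 12 ∧ u.arr 13 = s.arr 13) ∧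
        T.Tight (u.arr 11)) ∧
      (u.reg 8 ≠ 0 → mpot T u < mpot T s)) := by
  refine Halts.seq (Halts.of_run (T := 2) (Q := fun u => u.reg 8 = 0 ∧ u.arr = s.arr) rfl
    (by decide) ⟨by simp [run, Expr.eval], rfl⟩) (fun s' hf' ⟨h80, harr⟩ => ?_) ?_
    (T' := 77 * T.m + 10)
  · have hc1 := hc.of_frame hf' rfl
    have hM1 : MOK T s' := by rw [MOK, harr]; exact hM
    refine Halts.mono (Halts.forTo T.m 60 (fun k u => MOK T u ∧ Keeps T (s.arr 11) (u.arr 11) ∧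
      (∀ b, u.arr 11 b ≤ s.arr 11 b) ∧
      (u.reg 8 = 0 → (u.arr 11 = s.arr 11 ∧ u.arr 12 = s.arr 12 ∧ u.arr 13 = s.arr 13) ∧
        ∀ e < k, T.Eng (s.arr 11) e → ¬ T.rw e < s.arr 11 (T.ew e)) ∧
      (u.reg 8 ≠ 0 → mpot T u < mpot T s)) ?_
      (fun u hf => (hf.reg 2 rfl).trans hc1.m) rfl ?_ le_rfl) ?_ ?_
    · simp only [MOK, mpot, Mem.setR_arr, harr, Mem.setR_reg]
      refine ⟨hM, fun N _ h => h, fun _ => le_rfl, fun _ => by simp, ?_⟩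
      simp [h80]
    · rintro k u hk hx hfu ⟨i1, i2, i3, i4, i5⟩
      have hc2 := hc1.of_frame hfu rfl
      have h14 : u.arr 14 = s.arr 14 := by rw [hfu.arr 14 rfl, harr]
      refine Halts.seq (Halts.of_run (T := 3)
        (Q := fun v => v.reg 18 = T.ew k ∧ v.reg 6 = k ∧ v.reg 8 = u.reg 8 ∧ v.arr = u.arr) rfl
        (by decide) ⟨by simp [run, Expr.eval, hx, hc2.ew], by simp [run, hx], by simp [run], rfl⟩)
        (fun v hfv ⟨v18, v6, v8, varr⟩ => ?_) (T' := 57) (by omega)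
      have hc3 := hc2.of_frame hfv rfl
      have hev : ∀ c, (bin .mul (bin .lt (get 10 (reg 6)) (get 11 (reg 18)))
            (bin .eq (get 2 (reg 6)) (get 14 (get 8 (reg 6))))).eval v = c ↔
          (if T.rw k < u.arr 11 (T.ew k) ∧ T.rm k = s.arr 14 (T.em k) then 1 else 0) = c := by
        intro c
        simp only [Expr.eval, BinOp.eval, v18, v6, varr, hc2.rw, hc2.rm, hc2.em, h14]
        by_cases h1 : T.rw k < u.arr 11 (T.ew k) <;>
          by_cases h2 : T.rm k = s.arr 14 (T.em k) <;> simp [h1, h2]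
      refine Halts.ite (fun h => ?_) (fun h => ?_) (T := 40) (by decide)
      · have hcond : T.rw k < u.arr 11 (T.ew k) ∧ T.rm k = s.arr 14 (T.em k) := by
          by_contra hn
          exact h ((hev 0).mpr (by rw [if_neg hn]))
        have hrem : T.Rem (s.arr 11) k := ⟨hk, hcond.1.le.trans (i3 _)⟩
        have hE : T.Eng (u.arr 11) k := by
          refine ⟨⟨hk, hcond.1.le⟩, fun f hf hm => ?_⟩
          exact ((hcur.eng_iff hrem).mpr hcond.2).2 f (hf.mono (i3 _)) hm
        refine Halts.seq (lower_spec (val := T.rw k) hc3 (by rw [MOK, varr]; exact i1)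
          (by rw [v18]; exact T.ew_lt hk) (by simp [Expr.eval, v6, varr, hc2.rw])
          (by rw [v18, varr]; exact hcond.1) (R := 30) (by decide)) ?_ (T' := 10) (by omega)
        rintro w hfw ⟨w1, w2, w3⟩
        rw [varr, v18] at w3
        refine Halts.of_run rfl (by decide) ?_
        simp only [run, Expr.eval, MOK, mpot, Mem.setR_arr, Mem.setR_reg]
        refine ⟨w1, ?_, ?_, by simp, ?_⟩
        · rw [w3]
          intro N hN hb b hbq hbt
          have hb' := i2 N hN hb
          rw [Function.update_apply] at hbt ⊢
          split_ifs at hbt ⊢ with hbk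
          · obtain ⟨f, hf, h1, h2⟩ := hN.exists_of_eng hb' hE
            exact ⟨f, hf, h1.trans hbk.symm, h2⟩
          · exact hb' b hbq hbt
        · intro b
          rw [w3, Function.update_apply]
          split_ifs with hbk
          · rw [hbk]
            exact hrem.2
          · exact i3 b
        · intro _
          refine lt_of_lt_of_le w2 ?_
          simp only [mpot, varr]
          by_cases h8 : u.reg 8 = 0
          · rw [(i4 h8).1.1, (i4 h8).1.2.1]
          · exact (i5 h8).le
      · have hcond : ¬ (T.rw k < u.arr 11 (T.ew k) ∧ T.rm k = s.arr 14 (T.em k)) := by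
          intro hn
          have := (hev 0).mp h
          simp [hn] at this
        refine Halts.of_run rfl (by decide) ?_
        simp only [run, MOK, mpot, Mem.setR_arr, Mem.setR_reg, varr]
        simp only [show ¬ (8 : ℕ) = 6 by decide, if_false]
        rw [v8]
        refine ⟨i1, i2, i3, fun h8 => ⟨(i4 h8).1, fun e he hE => ?_⟩, i5⟩
        rcases Nat.lt_succ_iff_lt_or_eq.mp he with h' | rfl
        · exact (i4 h8).2 e h' hE
        · intro hlt
          refine hcond ⟨by rw [(i4 h8).1.1]; exact hlt, ?_⟩
          exact (hcur.eng_iff hE.1).mp hE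
    · simp only [Expr.cost]
      omega
    · rintro u hfu ⟨i1, i2, i3, i4, i5⟩
      refine ⟨i1, i2, i3, fun h8 => ⟨(i4 h8).1, fun e hE => ?_⟩, i5⟩
      rw [(i4 h8).1.1] at hE ⊢
      have := (i4 h8).2 e hE.1.1 hE
      have h2 := hE.1.2
      omega
  · omega

theorem findRoot_spec {R : ℕ} (hc : Ctx T s) (hR : 40 * (T.p + 1) ≤ R) :
    Halts findRoot s R (fun u =>
      (u.reg 9 = 0 → ∀ a < T.p, s.arr 12 a = 0 → T.m + 1 ≤ s.arr 14 a) ∧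
      (∀ a, u.reg 9 = a + 1 → a < T.p ∧ s.arr 12 a = 0 ∧ s.arr 14 a < T.m + 1)) := by
  refine Halts.seq (Halts.of_run (T := 2) (Q := fun u => u.reg 9 = 0 ∧ u.arr = s.arr) rfl
    (by decide) ⟨by simp [run, Expr.eval], rfl⟩) (fun s' hf' ⟨h80, harr⟩ => ?_) ?_
    (T' := 38 * T.p + 10)
  · have hc1 := hc.of_frame hf' rfl
    refine Halts.mono (Halts.forTo T.p 30 (fun k u =>
      (u.reg 9 = 0 → ∀ a < k, s.arr 12 a = 0 → T.m + 1 ≤ s.arr 14 a) ∧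
      (∀ a, u.reg 9 = a + 1 → a < T.p ∧ s.arr 12 a = 0 ∧ s.arr 14 a < T.m + 1)) ?_
      (fun u hf => (hf.reg 0 rfl).trans hc1.p) rfl ?_ le_rfl) ?_ (fun _ _ h => h)
    · simp [h80]
    · rintro k u hk hx hfu ⟨i1, i2⟩
      have hc2 := hc1.of_frame hfu rfl
      have h14 : u.arr 14 = s.arr 14 := by rw [hfu.arr 14 rfl, harr]
      have h12 : u.arr 12 = s.arr 12 := by rw [hfu.arr 12 rfl, harr]
      refine Halts.of_run rfl (by decide) ?_
      simp only [run, Expr.eval, BinOp.eval, hx, hc2.m, h14, h12]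
      by_cases h1 : s.arr 12 k = 0 ∧ s.arr 14 k < T.m + 1
      · simp only [h1.1, h1.2, if_true]
        simp only [show ¬ (9 : ℕ) = 6 by decide, if_false, mul_one, one_ne_zero, Mem.setR_reg, if_true,
          Nat.succ_ne_zero, false_implies, true_and, Nat.add_right_cancel_iff]
        rintro a rfl
        exact ⟨hk, h1.1, h1.2⟩
      · have : (if s.arr 12 k = 0 then 1 else 0) * (if s.arr 14 k < T.m + 1 then 1 else 0) = 0 := by
          by_cases h2 : s.arr 12 k = 0 <;> by_cases h3 : s.arr 14 k < T.m + 1 <;> simp_all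
        simp only [this, if_true, Mem.setR_reg, show ¬ (9 : ℕ) = 6 by decide, if_false]
        refine ⟨fun h9 a ha h0 => ?_, i2⟩
        rcases Nat.lt_succ_iff_lt_or_eq.mp ha with h' | rfl
        · exact i1 h9 a h' h0
        · by_contra hlt
          exact h1 ⟨h0, by omega⟩
    · simp only [Expr.cost]
      omega
  · omega

theorem initial_eval {u : Mem} (hc : Ctx T u) : initial.eval u = T.wi (u.reg 6) := by
  simp only [initial, Expr.eval, BinOp.eval, hc.wd, Tab.wi]

theorem validate_spec {R : ℕ} (hc : Ctx T s) (hR : 50 * (T.q + 1) ≤ R) :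
    Halts validate s R (fun u => u.reg 17 ≠ 0 ↔
      ∀ b < T.q, s.arr 11 b < T.wi b → s.arr 13 b ≠ 0) := by
  refine Halts.seq (Halts.of_run (T := 2) (Q := fun u => u.reg 17 = 1 ∧ u.arr = s.arr) rfl
    (by decide) ⟨by simp [run, Expr.eval], rfl⟩) (fun s' hf' ⟨h17, harr⟩ => ?_) ?_
    (T' := 48 * T.q + 10)
  · have hc1 := hc.of_frame hf' rfl
    refine Halts.mono (Halts.forTo T.q 40 (fun k u => u.reg 17 ≠ 0 ↔
      ∀ b < k, s.arr 11 b < T.wi b → s.arr 13 b ≠ 0) ?_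
      (fun u hf => (hf.reg 1 rfl).trans hc1.q) rfl ?_ le_rfl) ?_ (fun _ _ h => h)
    · simp [h17]
    · rintro k u hk hx hfu hI
      have hc2 := hc1.of_frame hfu rfl
      have h11 : u.arr 11 = s.arr 11 := by rw [hfu.arr 11 rfl, harr]
      have h13 : u.arr 13 = s.arr 13 := by rw [hfu.arr 13 rfl, harr]
      refine Halts.of_run rfl (by decide) ?_
      have hsplit : (∀ b < k + 1, s.arr 11 b < T.wi b → s.arr 13 b ≠ 0) ↔
          (∀ b < k, s.arr 11 b < T.wi b → s.arr 13 b ≠ 0) ∧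
            (s.arr 11 k < T.wi k → s.arr 13 k ≠ 0) := by
        constructor
        · exact fun h => ⟨fun b hb => h b (by omega), h k (by omega)⟩
        · rintro ⟨h1, h2⟩ b hb
          rcases Nat.lt_succ_iff_lt_or_eq.mp hb with h' | rfl
          · exact h1 b h'
          · exact h2
      rw [hsplit, ← hI]
      simp only [run, Expr.eval, BinOp.eval, initial_eval hc2, hx, h11, h13]
      by_cases h1 : s.arr 11 k < T.wi k <;> by_cases h2 : s.arr 13 k = 0 <;> simp [h1, h2]
    · simp only [Expr.cost]
      omega
  · omega

end Algo
end SSM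

namespace SSM

/-! ### Alternating search -/

theorem Tab.off_mono (T : Tab) {a b : ℕ} (h : a ≤ b) : T.off a ≤ T.off b := by
  by_contra hc
  have h1 : T.off b < T.m := lt_of_lt_of_le (not_le.mp hc) (T.off_le a)
  have h2 := (T.lt_off h1 a).mpr (not_le.mp hc)
  exact lt_irrefl _ ((T.lt_off h1 b).mp (by omega))

theorem Tab.sum_off_le (T : Tab) (k : ℕ) :
    ∑ a ∈ Finset.range k, (T.off (a + 1) - T.off a) ≤ T.m := by
  suffices ∑ a ∈ Finset.range k, (T.off (a + 1) - T.off a) + T.off 0 = T.off k by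
    have := T.off_le k
    omega
  induction k with
  | zero => simp
  | succ k ih =>
      have := T.off_mono (show k ≤ k + 1 by omega)
      rw [Finset.sum_range_succ]
      omega

theorem Tab.em_eq_iff (T : Tab) {e : ℕ} (he : e < T.m) (a : ℕ) :
    T.em e = a ↔ T.off a ≤ e ∧ e < T.off (a + 1) := by
  have h1 := T.lt_off he a
  have h2 := T.lt_off he (a + 1)
  omega

/-- State of the search: `par` holds the edges (plus 1) through which women were reached, the
entries of `Q` below `tail` are the men that were reached, `fr` is 0 or the edge (plus 1) to a free
woman. -/
structure BInv (T : Tab) (t mM mW par Q : ℕ → ℕ) (root tail fr : ℕ) : Prop where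
  q_zero : Q 0 = root
  tail_pos : 0 < tail
  q_lt : ∀ i < tail, Q i < T.p
  q_inj : ∀ i < tail, ∀ j < tail, Q i = Q j → i = j
  par_ok : ∀ b < T.q, ∀ e, par b = e + 1 → T.Eng t e ∧ T.ew e = b ∧ ∃ i < tail, Q i = T.em e
  q_mate : ∀ i < tail, 0 < i → ∃ f e j, mM (Q i) = f + 1 ∧ par (T.ew f) = e + 1 ∧ j < i ∧
    Q j = T.em e
  vis : ∀ b < T.q, par b ≠ 0 → ∀ f, mW b = f + 1 → ∃ i < tail, Q i = T.em f
  fr_zero : fr = 0 → ∀ b < T.q, par b ≠ 0 → mW b ≠ 0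
  fr_succ : ∀ e, fr = e + 1 → e < T.m ∧ par (T.ew e) = e + 1 ∧ mW (T.ew e) = 0

section

variable {T : Tab} {t mM mW par Q : ℕ → ℕ} {root tail fr e f h : ℕ}

theorem BInv.push_free (hB : BInv T t mM mW par Q root tail fr)
    (he : T.Eng t e) (hh : h < tail) (hem : T.em e = Q h) (hp : par (T.ew e) = 0)
    (hw : mW (T.ew e) = 0) :
    BInv T t mM mW (Function.update par (T.ew e) (e + 1)) Q root tail (e + 1) := by
  have hne : ∀ b, par b ≠ 0 → b ≠ T.ew e := by
    rintro b hb rfl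
    exact hb hp
  refine ⟨hB.q_zero, hB.tail_pos, hB.q_lt, hB.q_inj, ?_, ?_, ?_, by simp, ?_⟩
  · intro b hb e' he'
    rw [Function.update_apply] at he'
    split_ifs at he' with hbe
    · obtain rfl : e = e' := by omega
      exact ⟨he, hbe.symm, h, hh, hem.symm⟩
    · exact hB.par_ok b hb e' he'
  · intro i hi hi0
    obtain ⟨f, e', j, h1, h2, h3, h4⟩ := hB.q_mate i hi hi0
    refine ⟨f, e', j, h1, ?_, h3, h4⟩
    rw [Function.update_of_ne (hne _ (by omega)), h2]
  · intro b hb hb0 f hf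
    rw [Function.update_apply] at hb0
    split_ifs at hb0 with hbe
    · rw [hbe] at hf
      omega
    · exact hB.vis b hb hb0 f hf
  · intro e' he'
    obtain rfl : e = e' := by omega
    exact ⟨he.1.1, by simp, hw⟩

/-- The man who enters the queue is new: the root is unmatched, and any other man in the queue was
reached through his partner, who has a parent edge already, whereas the woman of `e` has none. -/
theorem BInv.push_mate (hB : BInv T t mM mW par Q root tail fr) (hM : MatchOK T t mM mW)
    (hroot : mM root = 0)
    (he : T.Eng t e) (hh : h < tail) (hem : T.em e = Q h) (hp : par (T.ew e) = 0)
    (hw : mW (T.ew e) = f + 1) :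
    BInv T t mM mW (Function.update par (T.ew e) (e + 1)) (Function.update Q tail (T.em f)) root
      (tail + 1) fr := by
  have hne : ∀ b, par b ≠ 0 → b ≠ T.ew e := by
    rintro b hb rfl
    exact hb hp
  obtain ⟨f1, f2, f3⟩ := hM.woman _ (T.ew_lt he.1.1) f hw
  have hQ : ∀ i < tail, Function.update Q tail (T.em f) i = Q i := fun i hi =>
    Function.update_of_ne (by omega) _ _
  have hnew : ∀ i < tail, Q i ≠ T.em f := by
    intro i hi hif
    rcases Nat.eq_zero_or_pos i with rfl | hi0
    · rw [hB.q_zero] at hif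
      rw [← hif, hroot] at f3
      omega
    · obtain ⟨f', e', j, h1, h2, h3, h4⟩ := hB.q_mate i hi hi0
      rw [hif, f3] at h1
      obtain rfl : f = f' := by omega
      rw [f2, hp] at h2
      omega
  refine ⟨?_, by omega, ?_, ?_, ?_, ?_, ?_, ?_, ?_⟩
  · rw [hQ 0 hB.tail_pos, hB.q_zero]
  · intro i hi
    rcases Nat.lt_succ_iff_lt_or_eq.mp hi with hi | rfl
    · rw [hQ i hi]
      exact hB.q_lt i hi
    · rw [Function.update_self]
      exact T.em_lt f1
  · intro i hi j hj hij
    rcases Nat.lt_succ_iff_lt_or_eq.mp hi with hi | rfl <;>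
      rcases Nat.lt_succ_iff_lt_or_eq.mp hj with hj | rfl
    · rw [hQ i hi, hQ j hj] at hij
      exact hB.q_inj i hi j hj hij
    · rw [hQ i hi, Function.update_self] at hij
      exact absurd hij (hnew i hi)
    · rw [hQ j hj, Function.update_self] at hij
      exact absurd hij.symm (hnew j hj)
    · rfl
  · intro b hb e' he'
    rw [Function.update_apply] at he'
    split_ifs at he' with hbe
    · obtain rfl : e = e' := by omega
      exact ⟨he, hbe.symm, h, by omega, by rw [hQ h hh, hem]⟩
    · obtain ⟨h1, h2, i, hi, h3⟩ := hB.par_ok b hb e' he'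
      exact ⟨h1, h2, i, by omega, by rw [hQ i hi, h3]⟩
  · intro i hi hi0
    rcases Nat.lt_succ_iff_lt_or_eq.mp hi with hi | rfl
    · obtain ⟨f', e', j, h1, h2, h3, h4⟩ := hB.q_mate i hi hi0
      refine ⟨f', e', j, by rw [hQ i hi, h1], ?_, h3, by rw [hQ j (by omega), h4]⟩
      rw [Function.update_of_ne (hne _ (by omega)), h2]
    · exact ⟨f, e, h, by rw [Function.update_self, f3], by rw [f2, Function.update_self], hh,
        by rw [hQ h hh, hem]⟩
  · intro b hb hb0 f' hf'
    rw [Function.update_apply] at hb0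
    split_ifs at hb0 with hbe
    · rw [hbe, hw] at hf'
      obtain rfl : f = f' := by omega
      exact ⟨tail, by omega, by rw [Function.update_self]⟩
    · obtain ⟨i, hi, h1⟩ := hB.vis b hb hb0 f' hf'
      exact ⟨i, by omega, by rw [hQ i hi, h1]⟩
  · intro h0 b hb hb0
    rw [Function.update_apply] at hb0
    split_ifs at hb0 with hbe
    · rw [hbe]
      omega
    · exact hB.fr_zero h0 b hb hb0
  · intro e' he'
    obtain ⟨h1, h2, h3⟩ := hB.fr_succ e' he'
    exact ⟨h1, by rw [Function.update_of_ne (hne _ (by omega)), h2], h3⟩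

/-- If the search finds no free woman, all visited women may reject their engagements. -/
theorem BInv.exists_lt (hB : BInv T t mM mW par Q root tail 0) (hM : MatchOK T t mM mW)
    (hroot : mM root = 0) (ht : T.Tight t)
    (hcl : ∀ i < tail, ∀ e, T.Eng t e → T.em e = Q i → par (T.ew e) ≠ 0)
    {N : Finset ℕ} (hN : T.Stable N) (hb : T.Below t N) :
    ∀ b < T.q, par b ≠ 0 → ∃ e ∈ N, T.ew e = b ∧ T.rw e < t b := by
  classical
  have hg : ∀ b < T.q, par b ≠ 0 → ∃ f, mW b = f + 1 ∧ T.Eng t f ∧ T.ew f = b ∧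
      mM (T.em f) = f + 1 := by
    intro b hbq hb0
    obtain ⟨f, hf⟩ := Nat.exists_eq_succ_of_ne_zero (hB.fr_zero rfl b hbq hb0)
    obtain ⟨h1, h2, h3⟩ := hM.woman b hbq f hf
    exact ⟨f, hf, hM.eng (T.em_lt h1) h3, h2, h3⟩
  choose! g g1 g2 g3 g4 using hg
  set V := (Finset.range T.q).filter (fun b => par b ≠ 0) with hV
  have hVm : ∀ b, b ∈ V ↔ b < T.q ∧ par b ≠ 0 := by
    intro b
    simp [hV]
  intro b hbq hb0
  -- The critical set consists of the men in the queue and the visited women, who are all matched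
  -- because no free woman was found; `g` is the matching edge.
  refine hN.exists_lt_of_critical hb ht (Z := (Finset.range tail).image Q) (V := V) (g := g)
    ?_ ?_ ?_ ?_ b ((hVm b).mpr ⟨hbq, hb0⟩)
  · intro b hb
    obtain ⟨hbq, hb0⟩ := (hVm b).mp hb
    obtain ⟨i, hi, h1⟩ := hB.vis b hbq hb0 _ (g1 b hbq hb0)
    exact ⟨g2 b hbq hb0, g3 b hbq hb0,
      Finset.mem_image.mpr ⟨i, Finset.mem_range.mpr hi, h1⟩⟩
  · intro b hb c hc h
    obtain ⟨hbq, hb0⟩ := (hVm b).mp hb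
    obtain ⟨hcq, hc0⟩ := (hVm c).mp hc
    have h1 := g4 b hbq hb0
    rw [h, g4 c hcq hc0] at h1
    rw [← g3 b hbq hb0, ← g3 c hcq hc0, show g c = g b by omega]
  · intro e he hZ
    obtain ⟨i, hi, h⟩ := Finset.mem_image.mp hZ
    exact (hVm _).mpr ⟨T.ew_lt he.1.1, hcl i (Finset.mem_range.mp hi) e he h.symm⟩
  · intro B hBV hBne
    -- For the reachability condition, take the earliest man in the queue whose search edge leads
    -- into `B`. He is not the partner of a woman in `B`: he would have entered the queue through
    -- her, from an even earlier man whose search edge leads into `B`.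
    have hex : ∃ i, i < tail ∧ ∃ b ∈ B, ∃ e, par b = e + 1 ∧ Q i = T.em e := by
      obtain ⟨b, hb⟩ := hBne
      obtain ⟨hbq, hb0⟩ := (hVm b).mp (hBV hb)
      obtain ⟨e, he⟩ := Nat.exists_eq_succ_of_ne_zero hb0
      obtain ⟨-, -, i, hi, h⟩ := hB.par_ok b hbq e he
      exact ⟨i, hi, b, hb, e, he, h⟩
    obtain ⟨hi, b, hb, e, he, hQe⟩ := Nat.find_spec hex
    have hmin := fun j => Nat.find_min hex (m := j)
    set i := Nat.find hex
    obtain ⟨hbq, hb0⟩ := (hVm b).mp (hBV hb)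
    obtain ⟨h1, h2, -⟩ := hB.par_ok b hbq e he
    refine ⟨e, h1, Finset.mem_image.mpr ⟨i, Finset.mem_range.mpr hi, hQe⟩, h2 ▸ hb, ?_⟩
    intro c hc heq
    obtain ⟨hcq, hc0⟩ := (hVm c).mp (hBV hc)
    have h4 := g4 c hcq hc0
    rw [heq, ← hQe] at h4
    rcases Nat.eq_zero_or_pos i with h0 | h0
    · rw [h0, hB.q_zero, hroot] at h4
      omega
    · obtain ⟨f, e', j, k1, k2, k3, k4⟩ := hB.q_mate i hi h0
      rw [h4] at k1
      obtain rfl : g c = f := by omega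
      rw [g3 c hcq hc0] at k2
      exact hmin j k3 ⟨by omega, c, hc, e', k2, k4⟩

theorem MatchOK.augment_free (hM : MatchOK T t mM mW) (he : T.Eng t e)
    (hr : T.rw e = t (T.ew e)) (hw : mW (T.ew e) = 0) (hm : mM (T.em e) = 0) :
    MatchOK T t (Function.update mM (T.em e) (e + 1)) (Function.update mW (T.ew e) (e + 1)) := by
  constructor
  · intro a ha f hf
    rw [Function.update_apply] at hf
    split_ifs at hf with hae
    · obtain rfl : e = f := by omega
      exact ⟨hae.symm, he, hr, by rw [Function.update_self]⟩
    · obtain ⟨h1, h2, h3, h4⟩ := hM.man a ha f hf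
      refine ⟨h1, h2, h3, ?_⟩
      rw [Function.update_of_ne, h4]
      intro h
      rw [h, hw] at h4
      omega
  · intro b hb f hf
    rw [Function.update_apply] at hf
    split_ifs at hf with hbe
    · obtain rfl : e = f := by omega
      exact ⟨he.1.1, hbe.symm, by rw [Function.update_self]⟩
    · obtain ⟨h1, h2, h3⟩ := hM.woman b hb f hf
      refine ⟨h1, h2, ?_⟩
      rw [Function.update_of_ne, h3]
      intro h
      rw [h, hm] at h3
      omega

theorem MatchOK.unmatch (hM : MatchOK T t mM mW) (hm : mM (T.em f) = f + 1) (hf : f < T.m) :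
    MatchOK T t (Function.update mM (T.em f) 0) (Function.update mW (T.ew f) 0) := by
  have hw := (hM.man _ (T.em_lt hf) f hm).2.2.2
  constructor
  · intro a ha e he
    rw [Function.update_apply] at he
    split_ifs at he with hae
    obtain ⟨h1, h2, h3, h4⟩ := hM.man a ha e he
    refine ⟨h1, h2, h3, ?_⟩
    rw [Function.update_of_ne, h4]
    intro h
    rw [h, hw] at h4
    obtain rfl : f = e := by omega
    exact hae h1.symm
  · intro b hb e he
    rw [Function.update_apply] at he
    split_ifs at he with hbe
    obtain ⟨h1, h2, h3⟩ := hM.woman b hb e he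
    refine ⟨h1, h2, ?_⟩
    rw [Function.update_of_ne, h3]
    intro h
    rw [h, hm] at h3
    obtain rfl : f = e := by omega
    exact hbe h2.symm

/-- Removing the old edge of the man first reduces this to the case of a free man; the two updates
of the women's array concern different women and commute. -/
theorem MatchOK.augment_matched (hM : MatchOK T t mM mW) (he : T.Eng t e)
    (hr : T.rw e = t (T.ew e)) (hw : mW (T.ew e) = 0) (hm : mM (T.em e) = f + 1) :
    MatchOK T t (Function.update mM (T.em e) (e + 1))
      (Function.update (Function.update mW (T.ew e) (e + 1)) (T.ew f) 0) := by
  obtain ⟨h1, h2, h3, h4⟩ := hM.man _ (T.em_lt he.1.1) f hm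
  have hne : T.ew f ≠ T.ew e := by
    intro h
    rw [h, hw] at h4
    omega
  have := (hM.unmatch (h1 ▸ hm) h2.1.1).augment_free he hr
    (by rw [Function.update_of_ne hne.symm, hw]) (by rw [h1, Function.update_self])
  rwa [h1, Function.update_idem, Function.update_comm hne] at this

theorem pot_augment_free (he : e < T.m) (hm : mM (T.em e) = 0) :
    T.pot t (Function.update mM (T.em e) (e + 1)) < T.pot t mM := by
  refine Nat.add_lt_add_left (Finset.card_lt_card ?_) _
  rw [Finset.ssubset_iff_of_subset]
  · refine ⟨T.em e, Finset.mem_filter.mpr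
      ⟨Finset.mem_image_of_mem _ (Finset.mem_range.mpr he), hm⟩, ?_⟩
    simp
  · intro b hb
    obtain ⟨h1, h2⟩ := Finset.mem_filter.mp hb
    rw [Function.update_apply] at h2
    split_ifs at h2
    exact Finset.mem_filter.mpr ⟨h1, h2⟩

/-- Inside an augmenting path no man becomes free or ceases to be free; the gain comes at the root,
in `pot_augment_free`. -/
theorem pot_augment_matched (hm : mM (T.em e) ≠ 0) :
    T.pot t (Function.update mM (T.em e) (e + 1)) = T.pot t mM := by
  rw [Tab.pot, Tab.pot]
  congr 2
  refine Finset.filter_congr fun b _ => ?_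
  rw [Function.update_apply]
  split_ifs with h
  · simp [h, hm]
  · rfl

end

/-! ### Specifications of the search, the augmentation and the rejection. -/

namespace Algo

open Prog SSM.Expr

variable {T : Tab} {s : Mem}

/-- The search invariant in the memory `u`; the matching is that of `s`. -/
abbrev MBInv (T : Tab) (s u : Mem) (root : ℕ) : Prop :=
  BInv T (s.arr 11) (s.arr 12) (s.arr 13) (u.arr 15) (u.arr 16) root (u.reg 11) (u.reg 12)

theorem ind_mul (P Q : Prop) [Decidable P] [Decidable Q] :
    ((if P then 1 else 0) * (if Q then 1 else 0) : ℕ) = if P ∧ Q then 1 else 0 := by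
  by_cases hP : P <;> by_cases hQ : Q <;> simp [hP, hQ]

/-- Here `s` holds the fixed thresholds, matching and best ranks, and `u` the growing search tree.
The last conclusion is what makes the visited set closed: after the scan of an engaged edge its
woman has been visited, now or before. -/
theorem scan_spec {s u : Mem} {root e h a : ℕ} (hc : Ctx T u) (hM : MOK T s)
    (hcur : CurOK T (s.arr 11) (s.arr 14)) (h11 : u.arr 11 = s.arr 11) (h13 : u.arr 13 = s.arr 13)
    (h14 : u.arr 14 = s.arr 14) (hroot : s.arr 12 root = 0) (hB : MBInv T s u root)
    (he : e < T.m) (hu14 : u.reg 14 = e) (hu13 : u.reg 13 = a) (ha : T.em e = a)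
    (hh : h < u.reg 11) (hQ : u.arr 16 h = a) :
    Halts scan u 60 (fun v => MBInv T s v root ∧ v.reg 14 = e + 1 ∧ u.reg 11 ≤ v.reg 11 ∧
      (∀ i < u.reg 11, v.arr 16 i = u.arr 16 i) ∧ (∀ b, u.arr 15 b ≠ 0 → v.arr 15 b ≠ 0) ∧
      (T.Eng (s.arr 11) e → v.arr 15 (T.ew e) ≠ 0)) := by
  classical
  have hE : T.Eng (s.arr 11) e ↔ T.rw e < s.arr 11 (T.ew e) + 1 ∧ T.rm e = s.arr 14 a := by
    constructor
    · intro hE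
      exact ⟨Nat.lt_succ_of_le hE.1.2, by rw [(hcur.eng_iff hE.1).mp hE, ha]⟩
    · rintro ⟨h1, h2⟩
      exact (hcur.eng_iff ⟨he, Nat.le_of_lt_succ h1⟩).mpr (by rw [ha, h2])
  refine Halts.seq (Halts.of_run (T := 3) (Q := fun v => v.reg 18 = T.ew e ∧ v.reg 14 = e ∧
    v.reg 13 = a ∧ v.reg 11 = u.reg 11 ∧ v.reg 12 = u.reg 12 ∧ v.arr = u.arr) rfl (by decide)
    (by simp [run, Expr.eval, hc.ew, hu14, hu13])) ?_ (T' := 57) (by omega)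
  rintro v hfv ⟨v18, v14, v13, v11, v12, varr⟩
  have hcv := hc.of_frame hfv rfl
  have hev : (bin .mul
      (bin .mul (bin .lt (get 10 (reg 14)) (bin .add (get 11 (reg 18)) (lit 1)))
        (bin .eq (get 2 (reg 14)) (get 14 (reg 13))))
      (bin .eq (get 15 (reg 18)) (lit 0))).eval v =
      if T.Eng (s.arr 11) e ∧ u.arr 15 (T.ew e) = 0 then 1 else 0 := by
    simp only [Expr.eval, BinOp.eval, v18, v14, v13, varr, hc.rw, hc.rm, h11, h14, hE, ind_mul]
  refine Halts.seq (Q := fun w => w.reg 14 = e ∧ MBInv T s w root ∧ u.reg 11 ≤ w.reg 11 ∧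
      (∀ i < u.reg 11, w.arr 16 i = u.arr 16 i) ∧ (∀ b, u.arr 15 b ≠ 0 → w.arr 15 b ≠ 0) ∧
      (T.Eng (s.arr 11) e → w.arr 15 (T.ew e) ≠ 0)) (T := 50) (T' := 5)
    (Halts.ite (T := 27) (fun h => ?_) (fun h => ?_) (by decide)) ?_ (by omega)
  · rw [hev] at h
    obtain ⟨hEe, h3⟩ : T.Eng (s.arr 11) e ∧ u.arr 15 (T.ew e) = 0 := by
      by_contra hn
      exact h (if_neg hn)
    refine Halts.of_run rfl (by decide) ?_
    have hvis : ∀ b, u.arr 15 b ≠ 0 → Function.update (u.arr 15) (T.ew e) (e + 1) b ≠ 0 := by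
      intro b hb
      rw [Function.update_apply]
      split_ifs
      · omega
      · exact hb
    by_cases h4 : s.arr 13 (T.ew e) = 0
    · simp only [run, Expr.eval, BinOp.eval, Mem.setA_arr, Mem.setA_reg, MBInv, v18, v14, v11,
        varr, h13]
      norm_num
      simp only [h4, if_true, Mem.setR_reg, Mem.setR_arr, Mem.setA_reg, Mem.setA_arr, v14, v11,
        varr]
      norm_num
      exact ⟨hB.push_free hEe hh (ha.trans hQ.symm) h3 h4, fun b hb => hvis b hb⟩
    · obtain ⟨f, hf⟩ := Nat.exists_eq_succ_of_ne_zero h4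
      simp only [run, Expr.eval, BinOp.eval, Mem.setA_arr, Mem.setA_reg, MBInv, v18, v14, v11,
        varr, h13, hc.em]
      norm_num
      simp only [hf]
      norm_num
      simp only [v14, v12, varr, true_and]
      refine ⟨hB.push_mate hM hroot hEe hh (ha.trans hQ.symm) h3 hf, ?_, fun b hb => hvis b hb⟩
      intro i hi
      exact Function.update_of_ne (by omega) _ _
  · rw [hev] at h
    refine Halts.of_run rfl (by decide) ?_
    simp only [run, MBInv, v11, v12, varr]
    refine ⟨v14, hB, le_rfl, fun _ _ => trivial, fun _ h => h, fun hEe h0 => ?_⟩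
    rw [if_pos ⟨hEe, h0⟩] at h
    exact one_ne_zero h
  · rintro w hfw ⟨w14, hw⟩
    refine Halts.of_run rfl (by decide) ?_
    simp only [run, Expr.eval, BinOp.eval, MBInv, Mem.setR_reg, Mem.setR_arr, w14]
    norm_num
    exact hw

theorem search_spec {R root : ℕ} (hc : Ctx T s) (hM : MOK T s)
    (hcur : CurOK T (s.arr 11) (s.arr 14)) (hroot : s.arr 12 root = 0) (hrp : root < T.p)
    (h9 : s.reg 9 = root + 1) (hR : 100 * (T.p + T.q + T.m + 1) ≤ R) :
    Halts search s R (fun u => MBInv T s u root ∧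
      ∀ i < u.reg 11, ∀ e, T.Eng (s.arr 11) e → T.em e = u.arr 16 i → u.arr 15 (T.ew e) ≠ 0) := by
  refine Halts.seq (Halts.forTo T.q 5 (fun k u => ∀ b < k, u.arr 15 b = 0) (by simp)
    (fun u hf => (hf.reg 1 rfl).trans hc.q) rfl ?_ le_rfl) ?_ ?_
    (T' := 74 * T.m + 50 * T.p + 30)
  · intro k u hk hx hf hI
    refine Halts.of_run rfl (by decide) ?_
    intro a ha
    simp only [run, Expr.eval, Mem.setA_arr, Mem.setR_arr, if_true, Function.update_apply, hx]
    split_ifs with h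
    · rfl
    · exact hI a (by omega)
  intro s1 hf1 hI1
  have hc1 := hc.of_frame hf1 rfl
  refine Halts.seq (Halts.of_run (T := 13) (Q := fun u => MBInv T s u root ∧ u.reg 10 = 0 ∧
    u.reg 11 = 1) rfl (by decide) ?_) ?_ (T' := 74 * T.m + 50 * T.p + 17) (by omega)
  · simp only [run, Expr.eval, BinOp.eval, MBInv, Mem.setR_reg, Mem.setR_arr, Mem.setA_arr,
      Mem.setA_reg, hf1.reg 9 rfl, h9]
    norm_num
    refine ⟨by simp, by omega, ?_, ?_, ?_, ?_, ?_, ?_, ?_⟩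
    · intro i hi
      obtain rfl : i = 0 := by omega
      simpa using hrp
    · intro i hi j hj _
      omega
    · intro b hb e he
      rw [hI1 b hb] at he
      omega
    · intro i hi hi0
      omega
    · intro b hb h
      exact absurd (hI1 b hb) h
    · intro _ b hb h
      exact absurd (hI1 b hb) h
    · intro e he
      omega
  rintro s2 hf2 ⟨hB2, h10, h11⟩
  have hc2 := hc1.of_frame hf2 rfl
  have hsame : ∀ A, A = 11 ∨ A = 12 ∨ A = 13 ∨ A = 14 → s2.arr A = s.arr A := by
    rintro A (rfl | rfl | rfl | rfl)
    all_goals rw [hf2.arr _ rfl, hf1.arr _ rfl]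
  -- By `q_inj` a man leaves the queue only once, so the potential sums over the men not yet
  -- processed: 74 per edge, namely 60 for the scan and 14 for the overhead of the for-loop, and 50
  -- per man.
  refine Halts.mono (Halts.loop
    (fun u => MBInv T s u root ∧ u.reg 10 ≤ u.reg 11 ∧ ∀ i < u.reg 10, ∀ e, T.Eng (s.arr 11) e →
      T.em e = u.arr 16 i → u.arr 15 (T.ew e) ≠ 0)
    (fun u => ∑ a ∈ Finset.range T.p \ (Finset.range (u.reg 10)).image (u.arr 16),
      (74 * (T.off (a + 1) - T.off a) + 50)) ?_ ?_ le_rfl) ?_ ?_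
  · exact ⟨hB2, by omega, by simp [h10]⟩
  · rintro u ⟨hB, hle, hcl⟩ hfu hlt
    have hlt : u.reg 10 < u.reg 11 := by
      simp only [Expr.eval, BinOp.eval] at hlt
      by_contra h
      simp [h] at hlt
    set h := u.reg 10 with hh
    set a := u.arr 16 h with ha
    have hcu := hc2.of_frame hfu rfl
    have hap : a < T.p := hB.q_lt h hlt
    set d := T.off (a + 1) - T.off a with hd
    refine ⟨74 * d + 40, Halts.seq (Halts.of_run (T := 6) (Q := fun v => v.reg 13 = a ∧
      v.reg 14 = T.off a ∧ v.reg 10 = h ∧ v.reg 11 = u.reg 11 ∧ v.reg 12 = u.reg 12 ∧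
      v.arr = u.arr) rfl (by decide) ?_) (T' := 74 * d + 34) ?_ (by omega)⟩
    · simp [run, Expr.eval, hcu.off, ← hh, ← ha]
    rintro v hfv ⟨v13, v14, v10, v11, v12, varr⟩
    have hcv := hcu.of_frame hfv rfl
    refine Halts.seq (T := 74 * d + 12) (T' := 5) (Halts.forTo d 60 (fun k w => MBInv T s w root ∧
      u.reg 11 ≤ w.reg 11 ∧ w.reg 14 = T.off a + k ∧
      (∀ i < u.reg 11, w.arr 16 i = u.arr 16 i) ∧ (∀ b, u.arr 15 b ≠ 0 → w.arr 15 b ≠ 0) ∧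
      (∀ e < T.off a + k, T.Eng (s.arr 11) e → T.em e = a → w.arr 15 (T.ew e) ≠ 0))
      ?_ ?_ rfl ?_ ?_) ?_ (by omega)
    · simp only [MBInv, Mem.setR_arr, Mem.setR_reg, varr, v11, v12, v14]
      norm_num
      refine ⟨hB, fun e he hE hem => ?_⟩
      have := (T.em_eq_iff hE.1.1 a).mp hem
      omega
    · intro w hw
      have hcw := hcv.of_frame hw rfl
      simp only [Expr.eval, BinOp.eval, hcw.off, hw.reg 13 rfl, v13, hd]
    · rintro k w hk hx hfw ⟨i1, i2, i3, i4, i5, i6⟩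
      have hcw := hcv.of_frame hfw rfl
      have hoff := T.off_le (a + 1)
      have hkm : T.off a + k < T.m := by omega
      have hema : T.em (T.off a + k) = a := (T.em_eq_iff hkm a).mpr ⟨by omega, by omega⟩
      have hwA : ∀ A, A = 11 ∨ A = 12 ∨ A = 13 ∨ A = 14 → w.arr A = s.arr A := by
        intro A hA
        rw [← hsame A hA]
        rcases hA with rfl | rfl | rfl | rfl
        all_goals rw [hfw.arr _ rfl, varr, hfu.arr _ rfl]
      refine Halts.mono (scan_spec (h := h) hcw hM hcur (hwA 11 (by simp)) (hwA 13 (by simp))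
        (hwA 14 (by simp)) hroot i1 hkm i3 ((hfw.reg 13 rfl).trans v13) hema (by omega)
        (i4 h hlt)) le_rfl ?_
      rintro x hfx ⟨j1, j2, j3, j4, j5, j6⟩
      simp only [MBInv, Mem.setR_arr, Mem.setR_reg]
      norm_num
      refine ⟨j1, by omega, by omega, fun i hi => (j4 i (by omega)).trans (i4 i hi),
        fun b hb => j5 b (i5 b hb), fun e he hE hem => ?_⟩
      rcases Nat.lt_or_ge e (T.off a + k) with h' | h'
      · exact j5 _ (i6 e h' hE hem)
      · obtain rfl : e = T.off a + k := by omega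
        exact j6 hE
    · simp only [Expr.cost]
      omega
    rintro w hfw ⟨i1, i2, i3, i4, i5, i6⟩
    refine Halts.of_run rfl (by decide) ?_
    have w10 : w.reg 10 = h := (hfw.reg 10 rfl).trans v10
    simp only [run, Expr.eval, BinOp.eval, MBInv, Mem.setR_arr, Mem.setR_reg, w10]
    norm_num
    refine ⟨⟨i1, by omega, ?_⟩, ?_⟩
    · intro i hi e hE hem
      rw [i4 i (by omega)] at hem
      rcases Nat.lt_or_ge i h with h' | h'
      · exact i5 _ (hcl i h' e hE hem)
      · obtain rfl : i = h := by omega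
        exact i6 e (by have := (T.em_eq_iff hE.1.1 a).mp hem; omega) hE hem
    · have himg : (Finset.range (h + 1)).image (w.arr 16) =
          insert a ((Finset.range h).image (u.arr 16)) := by
        rw [Finset.range_add_one, Finset.image_insert, i4 h hlt]
        congr 1
        refine Finset.image_congr fun i hi => i4 i ?_
        have := Finset.mem_range.mp hi
        omega
      have hnot : a ∉ (Finset.range h).image (u.arr 16) := by
        intro hmem
        obtain ⟨i, hi, hia⟩ := Finset.mem_image.mp hmem
        have hi := Finset.mem_range.mp hi
        have := hB.q_inj i (by omega) h hlt hia
        omega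
      have hmem : a ∈ Finset.range T.p \ (Finset.range h).image (u.arr 16) :=
        Finset.mem_sdiff.mpr ⟨Finset.mem_range.mpr hap, hnot⟩
      rw [himg, Finset.sdiff_insert, ← Finset.add_sum_erase _ _ hmem]
      simp only [Expr.cost]
      omega
  · have h1 := T.sum_off_le T.p
    have h2 : ∑ a ∈ Finset.range T.p \ (Finset.range (s2.reg 10)).image (s2.arr 16),
        (74 * (T.off (a + 1) - T.off a) + 50) ≤
        ∑ a ∈ Finset.range T.p, (74 * (T.off (a + 1) - T.off a) + 50) :=
      Finset.sum_le_sum_of_subset Finset.sdiff_subset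
    have h3 : ∑ a ∈ Finset.range T.p, (74 * (T.off (a + 1) - T.off a) + 50) =
        74 * ∑ a ∈ Finset.range T.p, (T.off (a + 1) - T.off a) + T.p * 50 := by
      rw [Finset.sum_add_distrib, ← Finset.mul_sum]
      simp
    simp only [Expr.cost]
    omega
  · rintro u hfu ⟨⟨h1, h2, h3⟩, h4⟩
    refine ⟨h1, fun i hi => h3 i ?_⟩
    simp only [Expr.eval, BinOp.eval] at h4
    by_contra h
    have hlt : u.reg 10 < u.reg 11 := by omega
    simp [hlt] at h4
  · simp only [Expr.cost]
    omega

theorem augment_spec {R root e0 : ℕ} (hc : Ctx T s) (hM : MOK T s)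
    (ht : T.Tight (s.arr 11)) (hB : MBInv T s s root) (hroot : s.arr 12 root = 0)
    (h12 : s.reg 12 = e0 + 1) (hR : 60 * (T.p + 1) ≤ R) :
    Halts augment s R (fun u => MOK T u ∧ mpot T u < mpot T s) := by
  -- Register 12 holds the next edge to be inserted. Its woman is free in the current matching, and
  -- the men up to the queue position `i` of its man still have their original partners. Each
  -- insertion changes the partner of such a man, so the number of unchanged men bounds the
  -- remaining insertions.
  refine Halts.mono (Halts.loop
    (fun u => MOK T u ∧ (u.reg 12 = 0 → mpot T u < mpot T s) ∧ ∀ e, u.reg 12 = e + 1 →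
      e < T.m ∧ s.arr 15 (T.ew e) = e + 1 ∧ u.arr 13 (T.ew e) = 0 ∧
      (∃ i < s.reg 11, s.arr 16 i = T.em e ∧
        ∀ j ≤ i, u.arr 12 (s.arr 16 j) = s.arr 12 (s.arr 16 j)) ∧ mpot T u = mpot T s)
    (fun u => 50 * ((Finset.range T.p).filter (fun a => u.arr 12 a = s.arr 12 a)).card)
    ?_ ?_ le_rfl) ?_ ?_
  · refine ⟨hM, by omega, fun e he => ?_⟩
    obtain ⟨h1, h2, h3⟩ := hB.fr_succ e he
    obtain ⟨-, -, i, hi, h4⟩ := hB.par_ok _ (T.ew_lt h1) e h2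
    exact ⟨h1, h2, h3, ⟨i, hi, h4, fun _ _ => rfl⟩, rfl⟩
  · rintro u ⟨hMu, -, hI⟩ hfu hne
    obtain ⟨e, he⟩ := Nat.exists_eq_succ_of_ne_zero hne
    have he : u.reg 12 = e + 1 := he
    obtain ⟨hem, hpar, hw, ⟨i, hi, hQi, hpre⟩, hpot⟩ := hI e he
    have hcu := hc.of_frame hfu rfl
    have u11 : u.arr 11 = s.arr 11 := hfu.arr 11 rfl
    have u15 : u.arr 15 = s.arr 15 := hfu.arr 15 rfl
    rw [MOK, u11] at hMu
    obtain ⟨hE, -, -⟩ := hB.par_ok _ (T.ew_lt hem) e hpar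
    have hr := ht e hE
    have hold : u.arr 12 (T.em e) = s.arr 12 (T.em e) := by rw [← hQi, hpre i le_rfl]
    -- the man of `e` gets a new edge
    have hcount : s.arr 12 (T.em e) ≠ e + 1 → 48 +
        50 * ((Finset.range T.p).filter (fun a => Function.update (u.arr 12) (T.em e) (e + 1) a =
          s.arr 12 a)).card ≤
        50 * ((Finset.range T.p).filter (fun a => u.arr 12 a = s.arr 12 a)).card := by
      intro hne'
      have : ((Finset.range T.p).filter (fun a => Function.update (u.arr 12) (T.em e) (e + 1) a =
          s.arr 12 a)).card <
          ((Finset.range T.p).filter (fun a => u.arr 12 a = s.arr 12 a)).card := by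
        refine Finset.card_lt_card ?_
        rw [Finset.ssubset_iff_of_subset]
        · refine ⟨T.em e, Finset.mem_filter.mpr ⟨Finset.mem_range.mpr (T.em_lt hem), hold⟩, ?_⟩
          simp only [Finset.mem_filter, Function.update_self, not_and]
          exact fun _ h => hne' h.symm
        · intro a ha
          obtain ⟨h1, h2⟩ := Finset.mem_filter.mp ha
          rw [Function.update_apply] at h2
          split_ifs at h2 with hae
          · exact absurd (hae ▸ h2.symm) hne'
          · exact Finset.mem_filter.mpr ⟨h1, h2⟩
      omega
    refine ⟨46, Halts.of_run rfl (by decide) ?_⟩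
    -- Position 0 is the root: he was free, so the path ends and the potential drops. At any other
    -- position the old partner of the man becomes free, and her parent edge is inserted next.
    rcases Nat.eq_zero_or_pos i with rfl | hi0
    · have hm0 : s.arr 12 (T.em e) = 0 := by rw [← hQi, hB.q_zero, hroot]
      have hmu : u.arr 12 (T.em e) = 0 := hold.trans hm0
      simp only [run, Expr.eval, BinOp.eval, Mem.setR_reg, Mem.setR_arr, Mem.setA_arr,
        Mem.setA_reg, MOK, mpot, he, hcu.em, hcu.ew]
      norm_num
      simp only [hmu, if_true]
      norm_num
      refine ⟨⟨?_, ?_⟩, ?_⟩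
      · rw [u11]
        exact hMu.augment_free hE hr hw hmu
      · rw [← mpot, ← hpot]
        exact pot_augment_free hem hmu
      · have := hcount (by omega)
        simp only [Expr.cost]
        omega
    · obtain ⟨f, e', j, k1, k2, k3, k4⟩ := hB.q_mate i hi hi0
      rw [hQi] at k1
      have hmu : u.arr 12 (T.em e) = f + 1 := hold.trans k1
      obtain ⟨m1, m2, m3, m4⟩ := hMu.man _ (T.em_lt hem) f hmu
      have hfq := T.ew_lt m2.1.1
      obtain ⟨p1, p2, -⟩ := hB.par_ok _ hfq e' k2
      have hne' : T.ew f ≠ T.ew e := by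
        intro h
        rw [h, hw] at m4
        omega
      simp only [run, Expr.eval, BinOp.eval, Mem.setR_reg, Mem.setR_arr, Mem.setA_arr,
        Mem.setA_reg, MOK, mpot, he, hcu.em, hcu.ew]
      norm_num
      simp only [hmu]
      norm_num
      simp only [u15, k2]
      norm_num
      refine ⟨⟨?_, ?_⟩, ?_⟩
      · rw [u11]
        exact hMu.augment_matched hE hr hw hmu
      · refine ⟨p1.1.1, by rw [p2, k2], by rw [p2, Function.update_self], ⟨j, by omega, k4, ?_⟩, ?_⟩
        · intro j' hj'
          rw [Function.update_of_ne, hpre j' (by omega)]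
          intro h
          have := hB.q_inj j' (by omega) i hi (h.trans hQi.symm)
          omega
        · rw [pot_augment_matched (by omega)]
          exact hpot
      · have := hcount (by
          intro h
          rw [k1] at h
          obtain rfl : f = e := by omega
          exact hne' rfl)
        simp only [Expr.cost]
        omega
  · simp [Expr.cost]
    omega
  · rintro u hfu ⟨⟨h1, h2, -⟩, h3⟩
    exact ⟨h1, h2 h3⟩

/-- The hypothesis `hpos` turns the truncated subtraction into a true decrease, so a single visited
woman is enough for progress. -/
theorem reject_spec {R : ℕ} (hc : Ctx T s) (hM : MOK T s)
    (hpos : ∀ b < T.q, s.arr 15 b ≠ 0 → 0 < s.arr 11 b) (hR : 60 * (T.q + 1) ≤ R) :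
    Halts reject s R (fun u => MOK T u ∧
      (∀ b < T.q, u.arr 11 b = if s.arr 15 b ≠ 0 then s.arr 11 b - 1 else s.arr 11 b) ∧
      ((∃ b < T.q, s.arr 15 b ≠ 0) → mpot T u < mpot T s)) := by
  refine Halts.mono (Halts.forTo T.q 45 (fun k u => MOK T u ∧
      (∀ b, u.arr 11 b = if b < k ∧ s.arr 15 b ≠ 0 then s.arr 11 b - 1 else s.arr 11 b) ∧
      mpot T u ≤ mpot T s ∧ ((∃ b < k, s.arr 15 b ≠ 0) → mpot T u < mpot T s)) ?_
    (fun u hf => (hf.reg 1 rfl).trans hc.q) rfl ?_ le_rfl) ?_ ?_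
  · exact ⟨hM, by simp, le_rfl, by simp⟩
  · rintro k u hk hx hfu ⟨i1, i2, i3, i4⟩
    have hcu := hc.of_frame hfu rfl
    have u15 : u.arr 15 = s.arr 15 := hfu.arr 15 rfl
    refine Halts.ite (fun h => ?_) (fun h => ?_) (T := 40) (by decide)
    · simp only [Expr.eval, hx, u15] at h
      refine Halts.seq (Halts.of_run (T := 3)
        (Q := fun v => v.reg 18 = k ∧ v.arr = u.arr) rfl
        (by decide) ⟨by simp [run, Expr.eval, hx], rfl⟩)
        (fun v hfv ⟨v18, varr⟩ => ?_) (T' := 30) (by omega)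
      have huk : u.arr 11 k = s.arr 11 k := by rw [i2, if_neg (by omega)]
      have := hpos k hk h
      refine Halts.mono (lower_spec (val := s.arr 11 k - 1) (R := 30) (hcu.of_frame hfv rfl)
        (by rw [MOK, varr]; exact i1) (by rw [v18]; exact hk)
        (by simp [Expr.eval, BinOp.eval, v18, varr, huk])
        (by rw [v18, varr, huk]; omega) (by decide)) le_rfl ?_
      rintro w hfw ⟨w1, w2, w3⟩
      rw [varr, v18] at w3
      simp only [mpot, varr] at w2
      simp only [MOK, mpot, Mem.setR_arr]
      refine ⟨w1, fun b => ?_, (w2.trans_le i3).le, fun _ => w2.trans_le i3⟩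
      rw [w3, Function.update_apply]
      by_cases hb : b = k
      · subst hb
        simp [h]
      · rw [if_neg hb, i2]
        have : b < k + 1 ↔ b < k := by omega
        simp only [this]
    · simp only [Expr.eval, hx, u15] at h
      refine Halts.of_run rfl (by decide) ?_
      simp only [run, MOK, mpot, Mem.setR_arr]
      have hiff : ∀ b, (b < k + 1 ∧ s.arr 15 b ≠ 0) ↔ (b < k ∧ s.arr 15 b ≠ 0) := by
        intro b
        constructor
        · rintro ⟨h1, h2⟩
          refine ⟨lt_of_le_of_ne (by omega) ?_, h2⟩
          rintro rfl
          exact h2 h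
        · exact fun h => ⟨by omega, h.2⟩
      simp only [hiff]
      exact ⟨i1, i2, i3, i4⟩
  · simp only [Expr.cost]
    omega
  · rintro u hfu ⟨i1, i2, i3, i4⟩
    refine ⟨i1, fun b hb => ?_, i4⟩
    rw [i2 b]
    simp [hb]

end Algo
end SSM

namespace SSM

/-! ### Recording matchings -/

namespace Halts

variable {c d : Prog} {s : Mem} {T B B' : ℕ} {Q R : Mem → Prop} {e : Expr} {pot : Mem → ℕ}

/-- Started in `s`, the program `c` halts in a memory `u` with property `Q`, and the number of
steps plus `pot u` is at most `B`. -/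
def Within (c : Prog) (s : Mem) (B : ℕ) (pot : Mem → ℕ) (Q : Mem → Prop) : Prop :=
  ∃ t u, Steps c s t u ∧ t + pot u ≤ B ∧ Q u

theorem within (h : Halts c s T (fun u => Q u ∧ T + pot u ≤ B)) : Within c s B pot Q := by
  obtain ⟨t, u, h1, h2, h3, h4⟩ := h
  exact ⟨t, u, h1, by omega, h3⟩

theorem seq_within (h : Halts c s T Q) (k : ∀ u, Frame c s u → Q u → Within d u B' pot R)
    (hB : T + B' ≤ B) : Within (.seq c d) s B pot R := by
  obtain ⟨t, u, h1, h2, h3⟩ := h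
  obtain ⟨r, v, k1, k2, k3⟩ := k u h1.frame h3
  exact ⟨_, v, h1.seq k1, by omega, k3⟩

theorem ite_within (h : e.eval s ≠ 0 → Within c s B' pot Q)
    (k : e.eval s = 0 → Within d s B' pot Q) (hB : e.cost + 1 + B' ≤ B) :
    Within (.ite e c d) s B pot Q := by
  by_cases h0 : e.eval s = 0
  · obtain ⟨t, u, h1, h2, h3⟩ := k h0
    exact ⟨_, u, .ite_false h0 h1, by omega, h3⟩
  · obtain ⟨t, u, h1, h2, h3⟩ := h h0
    exact ⟨_, u, .ite_true h0 h1, by omega, h3⟩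

/-- A while-loop with amortized time bounds. -/
theorem loop_within (Inv : Mem → Prop) (pot : Mem → ℕ) (h0 : Inv s)
    (hs : ∀ u, Inv u → Frame (.loop e c) s u → e.eval u ≠ 0 →
      ∃ B, B + (e.cost + 1) ≤ pot u ∧ Within c u B pot Inv)
    (hT : pot s + (e.cost + 1) ≤ T) :
    Halts (.loop e c) s T (fun u => Inv u ∧ e.eval u = 0) := by
  refine Halts.loop Inv pot h0 (fun u hu hf he => ?_) hT
  obtain ⟨B, hB, t, v, h1, h2, h3⟩ := hs u hu hf he
  exact ⟨t, t, v, h1, le_rfl, h3, by omega⟩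

end Halts

/-- The first `k` rows of the arrays `out` and `rk` hold the partners and the ranks of the men in
the matchings `S i`, which represent different irreducible classes. -/
structure RecOK (T : Tab) (k : ℕ) (out rk : ℕ → ℕ) (S : ℕ → Finset ℕ) : Prop where
  stable : ∀ i < k, T.Stable (S i)
  irr : ∀ i < k, ∃ e ∈ S i, ∀ N, T.Stable N → e ∈ N → T.Dom (S i) N
  ne : ∀ i < k, ∀ j < k, (∀ a < T.p, rk (i * T.p + a) = rk (j * T.p + a)) → i = j
  row : ∀ i < k, ∀ e ∈ S i, out (i * T.p + T.em e) = T.ew e + 1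
  row_zero : ∀ i < k, ∀ a < T.p, (∀ e ∈ S i, T.em e ≠ a) → out (i * T.p + a) = 0
  rank : ∀ i < k, ∀ e ∈ S i, rk (i * T.p + T.em e) = T.rm e
  rank_top : ∀ i < k, ∀ a < T.p, (∀ e ∈ S i, T.em e ≠ a) → rk (i * T.p + a) = T.m + 1

theorem index_lt {i a k p : ℕ} (hi : i < k) (ha : a < p) : i * p + a < k * p :=
  calc i * p + a < (i + 1) * p := by rw [Nat.succ_mul]; omega
    _ ≤ k * p := Nat.mul_le_mul_right p hi

/-! ### Rows of ranks and dominance. -/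

section

variable {T : Tab} {k : ℕ} {out rk out' rk' cur : ℕ → ℕ} {S : ℕ → Finset ℕ} {M N : Finset ℕ}

theorem RecOK.congr (h : RecOK T k out rk S) (ho : ∀ i < k * T.p, out' i = out i)
    (hr : ∀ i < k * T.p, rk' i = rk i) : RecOK T k out' rk' S := by
  refine ⟨h.stable, h.irr, ?_, ?_, ?_, ?_, ?_⟩
  · intro i hi j hj hij
    refine h.ne i hi j hj fun a ha => ?_
    rw [← hr _ (index_lt hi ha), ← hr _ (index_lt hj ha), hij a ha]
  · intro i hi e he
    rw [ho _ (index_lt hi (T.em_lt ((h.stable i hi).lt e he))), h.row i hi e he]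
  · intro i hi a ha hn
    rw [ho _ (index_lt hi ha), h.row_zero i hi a ha hn]
  · intro i hi e he
    rw [hr _ (index_lt hi (T.em_lt ((h.stable i hi).lt e he))), h.rank i hi e he]
  · intro i hi a ha hn
    rw [hr _ (index_lt hi ha), h.rank_top i hi a ha hn]

/-- Unmatched men get the value `m + 1`, which is above every rank; with this convention dominance
is the pointwise order of the rank rows. -/
theorem dom_iff_of_ranks (hN : T.Stable N)
    (hM1 : ∀ e ∈ M, cur (T.em e) = T.rm e)
    (hM2 : ∀ a < T.p, (∀ e ∈ M, T.em e ≠ a) → cur a = T.m + 1)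
    (hMm : ∀ e ∈ M, T.rm e ≤ T.m)
    {cur' : ℕ → ℕ} (hN1 : ∀ e ∈ N, cur' (T.em e) = T.rm e)
    (hN2 : ∀ a < T.p, (∀ e ∈ N, T.em e ≠ a) → cur' a = T.m + 1) :
    T.Dom M N ↔ ∀ a < T.p, cur a ≤ cur' a := by
  constructor
  · intro hd a ha
    by_cases h : ∃ f ∈ N, T.em f = a
    · obtain ⟨f, hf, rfl⟩ := h
      obtain ⟨e, he, h1, h2⟩ := hd f hf
      rwa [hN1 f hf, ← h1, hM1 e he]
    · push Not at h
      rw [hN2 a ha h]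
      by_cases h' : ∃ e ∈ M, T.em e = a
      · obtain ⟨e, he, rfl⟩ := h'
        rw [hM1 e he]
        exact (hMm e he).trans (Nat.le_succ _)
      · push Not at h'
        rw [hM2 a ha h']
  · intro hle f hf
    have hfm := hN.lt f hf
    have h1 := hle _ (T.em_lt hfm)
    rw [hN1 f hf] at h1
    have h2 := T.rm_le hfm
    by_cases h' : ∃ e ∈ M, T.em e = T.em f
    · obtain ⟨e, he, h3⟩ := h'
      rw [← h3, hM1 e he] at h1
      exact ⟨e, he, h3, h1⟩
    · push Not at h'
      rw [hM2 _ (T.em_lt hfm) h'] at h1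
      omega

theorem RecOK.dom_iff (h : RecOK T k out rk S) {i j : ℕ} (hi : i < k) (hj : j < k) :
    T.Dom (S i) (S j) ↔ ∀ a < T.p, rk (i * T.p + a) ≤ rk (j * T.p + a) :=
  dom_iff_of_ranks (cur := fun a => rk (i * T.p + a)) (cur' := fun a => rk (j * T.p + a))
    (h.stable j hj) (h.rank i hi) (h.rank_top i hi)
    (fun e he => T.rm_le ((h.stable i hi).lt e he)) (h.rank j hj) (h.rank_top j hj)

theorem RecOK.push (h : RecOK T k out rk S) (ho : ∀ i < k * T.p, out' i = out i)
    (hr : ∀ i < k * T.p, rk' i = rk i) (hM : T.Stable M)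
    (hirr : ∃ e ∈ M, ∀ N, T.Stable N → e ∈ N → T.Dom M N)
    (hnew : ¬ ∃ i < k, ∀ a < T.p, rk (i * T.p + a) = cur a)
    (hrk : ∀ a < T.p, rk' (k * T.p + a) = cur a)
    (hM1 : ∀ e ∈ M, cur (T.em e) = T.rm e)
    (hM2 : ∀ a < T.p, (∀ e ∈ M, T.em e ≠ a) → cur a = T.m + 1)
    (hM3 : ∀ e ∈ M, out' (k * T.p + T.em e) = T.ew e + 1)
    (hM4 : ∀ a < T.p, (∀ e ∈ M, T.em e ≠ a) → out' (k * T.p + a) = 0) :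
    RecOK T (k + 1) out' rk' (Function.update S k M) := by
  have h' := h.congr ho hr
  have hSk : ∀ i < k, Function.update S k M i = S i := fun i hi =>
    Function.update_of_ne (by omega) _ _
  have split : ∀ {P : ℕ → Prop}, (∀ i < k, P i) → P k → ∀ i < k + 1, P i := by
    intro P h1 h2 i hi
    rcases Nat.lt_succ_iff_lt_or_eq.mp hi with hi | rfl
    exacts [h1 i hi, h2]
  refine ⟨?_, ?_, ?_, ?_, ?_, ?_, ?_⟩
  · refine split (fun i hi => ?_) ?_
    · rw [hSk i hi]
      exact h.stable i hi
    · rwa [Function.update_self]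
  · refine split (fun i hi => ?_) ?_
    · rw [hSk i hi]
      exact h.irr i hi
    · rwa [Function.update_self]
  · have hne : ∀ i < k, ¬ ∀ a < T.p, rk' (i * T.p + a) = rk' (k * T.p + a) := by
      intro i hi hall
      refine hnew ⟨i, hi, fun a ha => ?_⟩
      rw [← hr _ (index_lt hi ha), hall a ha, hrk a ha]
    refine split (fun i hi => split (fun j hj => h'.ne i hi j hj) ?_) (split (fun j hj => ?_) ?_)
    · exact fun hall => absurd hall (hne i hi)
    · exact fun hall => absurd (fun a ha => (hall a ha).symm) (hne j hj)
    · exact fun _ => rfl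
  · refine split (fun i hi => ?_) ?_
    · rw [hSk i hi]
      exact h'.row i hi
    · rwa [Function.update_self]
  · refine split (fun i hi => ?_) ?_
    · rw [hSk i hi]
      exact h'.row_zero i hi
    · rwa [Function.update_self]
  · refine split (fun i hi => ?_) ?_
    · rw [hSk i hi]
      exact h'.rank i hi
    · rw [Function.update_self]
      intro e he
      rw [hrk _ (T.em_lt (hM.lt e he)), hM1 e he]
  · refine split (fun i hi => ?_) ?_
    · rw [hSk i hi]
      exact h'.rank_top i hi
    · rw [Function.update_self]
      intro a ha hn
      rw [hrk a ha, hM2 a ha hn]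

end

namespace Algo

open Prog SSM.Expr

variable {T : Tab} {s : Mem}

theorem reset_spec {R : ℕ} (hc : Ctx T s) (hR : 60 * (T.p + T.q + 1) ≤ R) :
    Halts reset s R (fun u => (∀ a < T.p, u.arr 12 a = 0) ∧
      ∀ b < T.q, u.arr 13 b = 0 ∧ u.arr 11 b = T.wi b) := by
  refine Halts.seq (Halts.forTo T.p 5 (fun k u => ∀ a < k, u.arr 12 a = 0) (by simp)
    (fun u hf => (hf.reg 0 rfl).trans hc.p) rfl ?_ le_rfl) ?_ ?_
    (T' := 50 * T.q + 20)
  · intro k u hk hx hf hI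
    refine Halts.of_run rfl (by decide) ?_
    intro a ha
    simp only [run, Expr.eval, Mem.setA_arr, Mem.setR_arr, if_true, Function.update_apply, hx]
    split_ifs with h
    · rfl
    · exact hI a (by omega)
  · intro u hf hI
    have hc1 := hc.of_frame hf rfl
    refine Halts.mono (Halts.forTo T.q 30 (fun k v => ∀ b < k, v.arr 13 b = 0 ∧
      v.arr 11 b = T.wi b) (by simp) (fun u hf => (hf.reg 1 rfl).trans hc1.q) rfl ?_ le_rfl) ?_ ?_
    · intro k v hk hx hfv hv
      refine Halts.of_run rfl (by decide) ?_
      have hc2 : Ctx T (v.setA 13 k 0) := by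
        obtain ⟨h0, h1, h2, h3, h4, h5, h6, h7, h8⟩ := hc1.of_frame hfv rfl
        exact ⟨h0, h1, h2, by simpa using h3, by simpa using h4, by simpa using h5,
          by simpa using h6, by simpa using h7, by simpa using h8⟩
      have hini := initial_eval hc2
      have h6 : (v.setA 13 k 0).reg 6 = k := hx
      rw [h6] at hini
      intro b hb
      simp only [run, Expr.eval, hx, Mem.setR_arr, Mem.setA_reg]
      rw [hini]
      norm_num [Function.update_apply]
      by_cases hbk : b = k
      · simp [hbk]
      · simpa [hbk] using hv b (by omega)
    · simp only [Expr.cost]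
      omega
    · intro v hfv hv
      refine ⟨fun a ha => ?_, hv⟩
      rw [hfv.arr 12 rfl]
      exact hI a ha
  · simp only [Expr.cost]
    omega

theorem writeRow_spec {R : ℕ} (hc : Ctx T s) (hR : 50 * (T.p + 1) ≤ R) :
    Halts writeRow s R (fun u =>
      (∀ i < s.reg 3 * T.p, u.arr 6 i = s.arr 6 i ∧ u.arr 17 i = s.arr 17 i) ∧
      ∀ a < T.p, u.arr 6 (s.reg 3 * T.p + a) =
        (if s.arr 12 a = 0 then 0 else T.ew (s.arr 12 a - 1) + 1) ∧
        u.arr 17 (s.reg 3 * T.p + a) = s.arr 14 a) := by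
  refine Halts.mono (Halts.forTo T.p 40 (fun k u =>
      (∀ i < s.reg 3 * T.p, u.arr 6 i = s.arr 6 i ∧ u.arr 17 i = s.arr 17 i) ∧
      ∀ a < k, u.arr 6 (s.reg 3 * T.p + a) =
        (if s.arr 12 a = 0 then 0 else T.ew (s.arr 12 a - 1) + 1) ∧
        u.arr 17 (s.reg 3 * T.p + a) = s.arr 14 a) (by simp)
    (fun u hf => (hf.reg 0 rfl).trans hc.p) rfl ?_ le_rfl) ?_ (fun _ _ h => h)
  · rintro k u hk hx hf ⟨i1, i2⟩
    have hcu := hc.of_frame hf rfl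
    have u3 : u.reg 3 = s.reg 3 := hf.reg 3 rfl
    have u12 : u.arr 12 = s.arr 12 := hf.arr 12 rfl
    have u14 : u.arr 14 = s.arr 14 := hf.arr 14 rfl
    refine Halts.of_run rfl (by decide) ?_
    by_cases h0 : s.arr 12 k = 0
    · simp only [run, Expr.eval, BinOp.eval, hx, u3, u12, hcu.p]
      simp only [h0]
      norm_num
      simp only [u14, u3, hcu.p, hx, Function.update_apply]
      refine ⟨fun i hi => ?_, fun a ha => ?_⟩
      · have : i ≠ s.reg 3 * T.p + k := by omega
        simp only [this, if_false]
        exact i1 i hi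
      · by_cases hak : a = k
        · subst hak
          simp [h0]
        · have : ¬ s.reg 3 * T.p + a = s.reg 3 * T.p + k := by omega
          simp only [hak, if_false, Nat.add_left_cancel_iff]
          exact i2 a (by omega)
    · simp only [run, Expr.eval, BinOp.eval, hx, u3, u12, hcu.p, hcu.ew]
      simp only [h0]
      norm_num
      simp only [u14, u3, hcu.p, hx, Function.update_apply]
      refine ⟨fun i hi => ?_, fun a ha => ?_⟩
      · have : i ≠ s.reg 3 * T.p + k := by omega
        simp only [this, if_false]
        exact i1 i hi
      · by_cases hak : a = k
        · subst hak
          simp [h0]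
        · have : ¬ s.reg 3 * T.p + a = s.reg 3 * T.p + k := by omega
          simp only [hak, if_false, Nat.add_left_cancel_iff]
          exact i2 a (by omega)
  · simp only [Expr.cost]
    omega

theorem findRow_spec {R : ℕ} (hc : Ctx T s) (hR : 50 * (T.p + 1) * (s.reg 3 + 1) ≤ R) :
    Halts findRow s R (fun u => u.reg 15 ≠ 0 ↔
      ∃ i < s.reg 3, ∀ a < T.p, s.arr 17 (i * T.p + a) = s.arr 14 a) := by
  refine Halts.seq (Halts.of_run (T := 2) (Q := fun u => u.reg 15 = 0 ∧ u.arr = s.arr) rfl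
    (by decide) ⟨by simp [run, Expr.eval], rfl⟩) (fun s' hf' ⟨h15, harr⟩ => ?_)
    (T' := s.reg 3 * (30 * T.p + 40) + 10) (by nlinarith)
  have hc1 := hc.of_frame hf' rfl
  have h3 : s'.reg 3 = s.reg 3 := hf'.reg 3 rfl
  refine Halts.mono (Halts.forTo (s.reg 3) (30 * T.p + 20) (fun k u => u.reg 15 ≠ 0 ↔
      ∃ i < k, ∀ a < T.p, s.arr 17 (i * T.p + a) = s.arr 14 a) (by simp [h15])
    (fun u hf => (hf.reg 3 rfl).trans h3) rfl ?_ le_rfl) ?_ (fun _ _ h => h)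
  · intro k u hk hx hf hI
    have hcu := hc1.of_frame hf rfl
    have u17 : u.arr 17 = s.arr 17 := by rw [hf.arr 17 rfl, harr]
    have u14 : u.arr 14 = s.arr 14 := by rw [hf.arr 14 rfl, harr]
    refine Halts.seq (Q := fun v => v.reg 16 ≠ 0 ↔ ∀ a < T.p, s.arr 17 (k * T.p + a) = s.arr 14 a)
      (T := 30 * T.p + 14) (T' := 5) (Halts.seq (Halts.of_run (T := 2)
      (Q := fun v => v.reg 16 = 1 ∧ v.reg 7 = k ∧ v.arr = u.arr) rfl
      (by decide) ⟨by simp [run, Expr.eval], by simp [run, hx], rfl⟩)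
      (fun v hfv ⟨v16, v7, varr⟩ => ?_) (T' := 30 * T.p + 12) (by omega)) ?_ (by omega)
    · have hcv := hcu.of_frame hfv rfl
      refine Halts.mono (Halts.forTo T.p 22 (fun j w => w.reg 16 ≠ 0 ↔
          ∀ a < j, s.arr 17 (k * T.p + a) = s.arr 14 a) (by simp [v16])
        (fun u hf => (hf.reg 0 rfl).trans hcv.p) rfl ?_ le_rfl) ?_ (fun _ _ h => h)
      · intro j w hj hxw hfw hw
        have hcw := hcv.of_frame hfw rfl
        have w17 : w.arr 17 = s.arr 17 := by rw [hfw.arr 17 rfl, varr, u17]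
        have w14 : w.arr 14 = s.arr 14 := by rw [hfw.arr 14 rfl, varr, u14]
        have w7 : w.reg 7 = k := (hfw.reg 7 rfl).trans v7
        refine Halts.of_run rfl (by decide) ?_
        have hsplit : (∀ a < j + 1, s.arr 17 (k * T.p + a) = s.arr 14 a) ↔
            (∀ a < j, s.arr 17 (k * T.p + a) = s.arr 14 a) ∧
            s.arr 17 (k * T.p + j) = s.arr 14 j := by
          constructor
          · exact fun h => ⟨fun b hb => h b (by omega), h j (by omega)⟩
          · rintro ⟨h1, h2⟩ b hb
            rcases Nat.lt_succ_iff_lt_or_eq.mp hb with h' | rfl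
            exacts [h1 b h', h2]
        rw [hsplit, ← hw]
        simp only [run, Expr.eval, BinOp.eval, hxw, w7, w17, w14, hcw.p]
        by_cases h1 : s.arr 17 (k * T.p + j) = s.arr 14 j <;> simp [h1]
      · simp only [Expr.cost]
        omega
    · intro w hfw hw
      refine Halts.of_run rfl (by decide) ?_
      have w15 : w.reg 15 = u.reg 15 := hfw.reg 15 rfl
      have hsplit : (∃ i < k + 1, ∀ a < T.p, s.arr 17 (i * T.p + a) = s.arr 14 a) ↔
          (∃ i < k, ∀ a < T.p, s.arr 17 (i * T.p + a) = s.arr 14 a) ∨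
          ∀ a < T.p, s.arr 17 (k * T.p + a) = s.arr 14 a := by
        constructor
        · rintro ⟨i, hi, h⟩
          rcases Nat.lt_succ_iff_lt_or_eq.mp hi with h' | rfl
          exacts [.inl ⟨i, h', h⟩, .inr h]
        · rintro (⟨i, hi, h⟩ | h)
          exacts [⟨i, by omega, h⟩, ⟨k, by omega, h⟩]
      rw [hsplit, ← hI, ← hw, ← w15]
      simp only [run, Expr.eval]
      by_cases h : w.reg 16 = 0 <;> simp [h]
  · simp only [Expr.cost]
    have : s.reg 3 * (30 * T.p + 20 + 1 + 7) ≤ s.reg 3 * (30 * T.p + 40) :=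
      Nat.mul_le_mul_left _ (by omega)
    omega

end Algo

/-- The matching in the array `mM`. -/
def Tab.matchSet (T : Tab) (mM : ℕ → ℕ) : Finset ℕ :=
  (Finset.range T.m).filter (fun e => mM (T.em e) = e + 1)

theorem Tab.mem_matchSet {T : Tab} {mM : ℕ → ℕ} {e : ℕ} :
    e ∈ T.matchSet mM ↔ e < T.m ∧ mM (T.em e) = e + 1 := by
  simp [Tab.matchSet]

namespace Algo

open Prog SSM.Expr

variable {T : Tab} {s : Mem}

/-- The row is written before it is known to be new, at position `k`, where it cannot disturb the
earlier rows, and it counts only once register 3 is increased. If an earlier row has the same ranks,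
that row lies in the class of the current matching and serves in its place. -/
theorem record_spec {R : ℕ} {S : ℕ → Finset ℕ} (hc : Ctx T s) (hM : MOK T s)
    (hcur : CurOK T (s.arr 11) (s.arr 14))
    (hsat : ∀ e, T.Rem (s.arr 11) e → s.arr 12 (T.em e) ≠ 0)
    (hrec : RecOK T (s.reg 3) (s.arr 6) (s.arr 17) S)
    (hst : T.Stable (T.matchSet (s.arr 12)))
    (hirr : ∃ e ∈ T.matchSet (s.arr 12), ∀ N, T.Stable N → e ∈ N →
      T.Dom (T.matchSet (s.arr 12)) N)
    (hR : 110 * (T.p + 1) * (s.reg 3 + 1) ≤ R) :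
    Halts record s R (fun u => s.reg 3 ≤ u.reg 3 ∧ u.reg 3 ≤ s.reg 3 + 1 ∧
      ∃ S', RecOK T (u.reg 3) (u.arr 6) (u.arr 17) S' ∧ (∀ i < s.reg 3, S' i = S i) ∧
        ∃ i < u.reg 3, T.Dom (S' i) (T.matchSet (s.arr 12)) ∧
          ∀ e ∈ T.matchSet (s.arr 12), ∃ f ∈ S' i, T.em f = T.em e ∧ T.rm f = T.rm e) := by
  set M := T.matchSet (s.arr 12) with hMdef
  have hM1 : ∀ e ∈ M, s.arr 14 (T.em e) = T.rm e := by
    intro e he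
    obtain ⟨h1, h2⟩ := Tab.mem_matchSet.mp he
    have hE := hM.eng (T.em_lt h1) h2
    exact ((hcur.eng_iff hE.1).mp hE).symm
  have hM0 : ∀ a < T.p, (∀ e ∈ M, T.em e ≠ a) → s.arr 12 a = 0 := by
    intro a ha h
    by_contra hne
    obtain ⟨e, he⟩ := Nat.exists_eq_succ_of_ne_zero hne
    obtain ⟨h1, h2, -⟩ := hM.man a ha e he
    exact h e (Tab.mem_matchSet.mpr ⟨h2.1.1, by rw [h1, he]⟩) h1
  have hM2 : ∀ a < T.p, (∀ e ∈ M, T.em e ≠ a) → s.arr 14 a = T.m + 1 := by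
    intro a ha h
    rcases hcur.att a ha with h' | ⟨e, he, hea, -⟩
    · exact h'
    · exact absurd (hM0 a ha h) (hea ▸ hsat e he)
  refine Halts.seq (writeRow_spec hc le_rfl) (T' := 60 * (T.p + 1) * (s.reg 3 + 1)) ?_
    (by nlinarith)
  rintro u hfu ⟨w1, w2⟩
  have hcu := hc.of_frame hfu rfl
  have u3 : u.reg 3 = s.reg 3 := hfu.reg 3 rfl
  have u14 : u.arr 14 = s.arr 14 := hfu.arr 14 rfl
  refine Halts.seq (findRow_spec hcu le_rfl) (T' := 6) ?_ (by rw [u3]; nlinarith)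
  intro v hfv hv
  have v3 : v.reg 3 = s.reg 3 := (hfv.reg 3 rfl).trans u3
  have v6 : v.arr 6 = u.arr 6 := hfv.arr 6 rfl
  have v17 : v.arr 17 = u.arr 17 := hfv.arr 17 rfl
  have hex : (∃ i < u.reg 3, ∀ a < T.p, u.arr 17 (i * T.p + a) = u.arr 14 a) ↔
      ∃ i < s.reg 3, ∀ a < T.p, s.arr 17 (i * T.p + a) = s.arr 14 a := by
    rw [u3, u14]
    refine exists_congr fun i => and_congr_right fun hi => forall₂_congr fun a ha => ?_
    rw [(w1 _ (index_lt hi ha)).2]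
  rw [hex] at hv
  refine Halts.of_run rfl (by decide) ?_
  by_cases h15 : v.reg 15 = 0
  · simp only [run, Expr.eval, BinOp.eval]
    simp only [h15, if_true, Mem.setR_reg, Mem.setR_arr, v3, v6, v17]
    refine ⟨by omega, le_rfl, Function.update S (s.reg 3) M, ?_, ?_, ?_⟩
    · refine hrec.push (cur := s.arr 14) (fun i hi => (w1 i hi).1) (fun i hi => (w1 i hi).2) hst
        hirr (fun h => hv.mpr h h15) (fun a ha => (w2 a ha).2) hM1 hM2 ?_ ?_
      · intro e he
        obtain ⟨h1, h2⟩ := Tab.mem_matchSet.mp he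
        rw [(w2 _ (T.em_lt h1)).1, h2]
        simp
      · intro a ha h
        rw [(w2 a ha).1, if_pos (hM0 a ha h)]
    · intro i hi
      exact Function.update_of_ne (by omega) _ _
    · refine ⟨s.reg 3, by omega, ?_, ?_⟩
      · rw [Function.update_self]
        exact fun f hf => ⟨f, hf, rfl, le_rfl⟩
      · rw [Function.update_self]
        exact fun e he => ⟨e, he, rfl, rfl⟩
  · obtain ⟨i, hi, hia⟩ := hv.mp h15
    simp only [run, Expr.eval, BinOp.eval]
    simp only [h15, if_false, v3, v6, v17]
    refine ⟨le_rfl, by omega, S, hrec.congr (fun i hi => (w1 i hi).1) (fun i hi => (w1 i hi).2),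
      fun _ _ => rfl, i, hi, ?_, ?_⟩
    · refine (dom_iff_of_ranks (cur := fun a => s.arr 17 (i * T.p + a)) (cur' := s.arr 14) hst
        (hrec.rank i hi) (hrec.rank_top i hi)
        (fun e he => T.rm_le ((hrec.stable i hi).lt e he)) hM1 hM2).mpr ?_
      exact fun a ha => (hia a ha).le
    · intro e he
      have hem := hst.lt e he
      have h1 := hia _ (T.em_lt hem)
      rw [hM1 e he] at h1
      by_cases h : ∃ f ∈ S i, T.em f = T.em e
      · obtain ⟨f, hf, h2⟩ := h
        refine ⟨f, hf, h2, ?_⟩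
        rw [← hrec.rank i hi f hf, h2, h1]
      · push Not at h
        rw [hrec.rank_top i hi _ (T.em_lt hem) h] at h1
        have := T.rm_le hem
        omega

theorem force_spec {R a0 : ℕ} (hc : Ctx T s) (hM : MOK T s)
    (hcur : CurOK T (s.arr 11) (s.arr 14)) (ht : T.Tight (s.arr 11)) (h4 : s.reg 4 = a0)
    (hex : ∃ e, T.Eng (s.arr 11) e ∧ T.em e = a0) (hR : 80 * (T.m + 1) ≤ R) :
    Halts force s R (fun u => MOK T u ∧ mpot T u < mpot T s ∧ ∀ b,
      ((∃ e, T.Eng (s.arr 11) e ∧ T.em e = a0 ∧ T.ew e = b) → u.arr 11 b = s.arr 11 b - 1) ∧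
      ((¬ ∃ e, T.Eng (s.arr 11) e ∧ T.em e = a0 ∧ T.ew e = b) → u.arr 11 b = s.arr 11 b)) := by
  refine Halts.mono (Halts.forTo T.m 60 (fun k u => MOK T u ∧ mpot T u ≤ mpot T s ∧
      ((∃ e < k, T.Eng (s.arr 11) e ∧ T.em e = a0) → mpot T u < mpot T s) ∧ ∀ b,
      ((∃ e < k, T.Eng (s.arr 11) e ∧ T.em e = a0 ∧ T.ew e = b) →
        u.arr 11 b = s.arr 11 b - 1) ∧
      ((¬ ∃ e < k, T.Eng (s.arr 11) e ∧ T.em e = a0 ∧ T.ew e = b) →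
        u.arr 11 b = s.arr 11 b)) ?_
    (fun u hf => (hf.reg 2 rfl).trans hc.m) rfl ?_ le_rfl) ?_ ?_
  · exact ⟨hM, le_rfl, by simp, by simp⟩
  · rintro k u hk hx hfu ⟨i1, i2, i3, i4⟩
    have hcu := hc.of_frame hfu rfl
    have u14 : u.arr 14 = s.arr 14 := hfu.arr 14 rfl
    have u4 : u.reg 4 = a0 := (hfu.reg 4 rfl).trans h4
    refine Halts.seq (Halts.of_run (T := 3)
        (Q := fun v => v.reg 18 = T.ew k ∧ v.reg 6 = k ∧ v.reg 4 = a0 ∧ v.arr = u.arr) rfl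
        (by decide) ⟨by simp [run, Expr.eval, hx, hcu.ew], by simp [run, hx], by simp [run, u4],
          rfl⟩)
        (fun v hfv ⟨v18, v6, v4, varr⟩ => ?_) (T' := 57) (by omega)
    have hcv := hcu.of_frame hfv rfl
    -- Only one edge joins the man to each woman, so her threshold is still the original one when
    -- that edge is examined.
    have huk : T.em k = a0 → u.arr 11 (T.ew k) = s.arr 11 (T.ew k) := by
      intro hk0
      refine (i4 _).2 ?_
      rintro ⟨e, he, hE, hem, hew⟩
      have := T.inj hE.1.1 hk (hem.trans hk0.symm) hew
      omega
    classical
    have hev : (bin .mul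
          (bin .mul (bin .eq (get 8 (reg 6)) (reg 4))
            (bin .eq (get 2 (reg 6)) (get 14 (reg 4))))
          (bin .lt (get 10 (reg 6)) (bin .add (get 11 (reg 18)) (lit 1)))).eval v =
        if T.em k = a0 ∧ T.Eng (s.arr 11) k then 1 else 0 := by
      simp only [Expr.eval, BinOp.eval, v18, v6, v4, varr, hcu.em, hcu.rm, hcu.rw, u14, ind_mul]
      have : ((T.em k = a0 ∧ T.rm k = s.arr 14 a0) ∧ T.rw k < u.arr 11 (T.ew k) + 1) ↔
          T.em k = a0 ∧ T.Eng (s.arr 11) k := by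
        constructor
        · rintro ⟨⟨h1, h2⟩, h3⟩
          rw [huk h1] at h3
          exact ⟨h1, (hcur.eng_iff ⟨hk, by omega⟩).mpr (by rw [h1, h2])⟩
        · rintro ⟨h1, hE⟩
          have := hE.1.2
          refine ⟨⟨h1, ?_⟩, by rw [huk h1]; omega⟩
          rw [← h1]
          exact (hcur.eng_iff hE.1).mp hE
      simp only [this]
    refine Halts.ite (fun h => ?_) (fun h => ?_) (T := 30) (by decide)
    · rw [hev] at h
      obtain ⟨hk0, hE⟩ : T.em k = a0 ∧ T.Eng (s.arr 11) k := by
        by_contra hn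
        exact h (if_neg hn)
      have hrk := ht k hE
      have hpos := T.rw_pos hk
      refine Halts.mono (lower_spec (val := T.rw k - 1) (R := 30) hcv
        (by rw [MOK, varr]; exact i1) (by rw [v18]; exact T.ew_lt hk)
        (by simp [Expr.eval, BinOp.eval, v6, varr, hcu.rw])
        (by rw [v18, varr, huk hk0]; omega) (by decide)) le_rfl ?_
      rintro w hfw ⟨w1, w2, w3⟩
      rw [varr, v18] at w3
      simp only [mpot, varr] at w2
      simp only [MOK, mpot, Mem.setR_arr]
      refine ⟨w1, (w2.trans_le i2).le, fun _ => w2.trans_le i2, fun b => ?_⟩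
      rw [w3, Function.update_apply]
      by_cases hb : b = T.ew k
      · rw [if_pos hb, hrk, hb]
        exact ⟨fun _ => rfl, fun h => absurd ⟨k, by omega, hE, hk0, rfl⟩ h⟩
      · rw [if_neg hb]
        refine ⟨?_, fun hn => (i4 b).2 ?_⟩
        · rintro ⟨e, he, hE', hem, hew⟩
          refine (i4 b).1 ⟨e, lt_of_le_of_ne (by omega) ?_, hE', hem, hew⟩
          rintro rfl
          exact hb hew.symm
        · rintro ⟨e, he, h'⟩
          exact hn ⟨e, by omega, h'⟩
    · rw [hev] at h
      have hn : ¬ (T.em k = a0 ∧ T.Eng (s.arr 11) k) := by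
        intro hn
        simp [hn] at h
      refine Halts.of_run rfl (by decide) ?_
      simp only [run, MOK, mpot, Mem.setR_arr, varr]
      refine ⟨i1, i2, ?_, fun b => ⟨?_, fun hn' => (i4 b).2 ?_⟩⟩
      · rintro ⟨e, he, hE, hem⟩
        refine i3 ⟨e, lt_of_le_of_ne (by omega) ?_, hE, hem⟩
        rintro rfl
        exact hn ⟨hem, hE⟩
      · rintro ⟨e, he, hE, hem, hew⟩
        refine (i4 b).1 ⟨e, lt_of_le_of_ne (by omega) ?_, hE, hem, hew⟩
        rintro rfl
        exact hn ⟨hem, hE⟩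
      · rintro ⟨e, he, h'⟩
        exact hn' ⟨e, by omega, h'⟩
  · simp only [Expr.cost]
    omega
  · rintro u hfu ⟨i1, i2, i3, i4⟩
    obtain ⟨e0, h1, h2⟩ := hex
    refine ⟨i1, i3 ⟨e0, h1.1.1, h1, h2⟩, fun b => ⟨?_, fun hn => (i4 b).2 ?_⟩⟩
    · rintro ⟨e, he⟩
      exact (i4 b).1 ⟨e, he.1.1.1, he⟩
    · rintro ⟨e, -, he⟩
      exact hn ⟨e, he⟩

end Algo
end SSM

namespace SSM

/-! ### The run for one man -/

/-- One of the first `k` matchings dominates `N` and gives the man of the edge `e` a partner of the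
same rank. -/
def Tab.Cov (T : Tab) (k : ℕ) (S : ℕ → Finset ℕ) (N : Finset ℕ) (e : ℕ) : Prop :=
  ∃ i < k, T.Dom (S i) N ∧ ∃ f ∈ S i, T.em f = T.em e ∧ T.rm f = T.rm e

/-- The number of remaining edges of man `a`. -/
def Tab.remCount (T : Tab) (t : ℕ → ℕ) (a : ℕ) : ℕ :=
  ((Finset.range T.m).filter (fun e => T.em e = a ∧ T.rw e ≤ t (T.ew e))).card

/-- The invariant of the run for man `a`; all matchings that give him a partner of rank at most
`r` have been covered. -/
structure ManInv (T : Tab) (a : ℕ) (S : ℕ → Finset ℕ) (r : ℕ) (u : Mem) : Prop where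
  ctx : Ctx T u
  mok : MOK T u
  man : u.reg 4 = a
  recOK : RecOK T (u.reg 3) (u.arr 6) (u.arr 17) S
  prev : ∀ N, T.Stable N → ∀ e ∈ N, T.em e < a → T.Cov (u.reg 3) S N e
  low : ∀ N, T.Stable N → ∀ e ∈ N, T.em e = a → T.rm e ≤ r → T.Cov (u.reg 3) S N e
  below : ∀ N, T.Stable N → (∃ e ∈ N, T.em e = a ∧ r < T.rm e) → T.Below (u.arr 11) N
  rem : ∀ e, T.Rem (u.arr 11) e → T.em e = a → r < T.rm e
  done : u.reg 5 = 0 → ∀ N, T.Stable N → ∀ e ∈ N, T.em e = a → T.Cov (u.reg 3) S N e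
  count : u.reg 3 + T.remCount (u.arr 11) a ≤ T.off (a + 1)

section

variable {T : Tab} {a k k' r : ℕ} {S S' : ℕ → Finset ℕ} {N : Finset ℕ} {t t' mM mW : ℕ → ℕ}
  {s u : Mem} {e : ℕ}

theorem Tab.Cov.mono (h : T.Cov k S N e) (hk : k ≤ k') (hS : ∀ i < k, S' i = S i) :
    T.Cov k' S' N e := by
  obtain ⟨i, hi, h1, h2⟩ := h
  exact ⟨i, by omega, by rwa [hS i hi], by rwa [hS i hi]⟩

theorem Tab.remCount_le (ht : ∀ b < T.q, t' b ≤ t b) : T.remCount t' a ≤ T.remCount t a := by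
  refine Finset.card_le_card fun e he => ?_
  simp only [Finset.mem_filter, Finset.mem_range] at he ⊢
  exact ⟨he.1, he.2.1, he.2.2.trans (ht _ (T.ew_lt he.1))⟩

theorem Tab.remCount_lt (ht : ∀ b < T.q, t' b ≤ t b) (he : T.Rem t e) (hn : ¬ T.Rem t' e) :
    T.remCount t' (T.em e) < T.remCount t (T.em e) := by
  refine Finset.card_lt_card (Finset.ssubset_iff_of_subset ?_ |>.mpr ⟨e, ?_, ?_⟩)
  · intro f hf
    simp only [Finset.mem_filter, Finset.mem_range] at hf ⊢
    exact ⟨hf.1, hf.2.1, hf.2.2.trans (ht _ (T.ew_lt hf.1))⟩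
  · exact Finset.mem_filter.mpr ⟨Finset.mem_range.mpr he.1, rfl, he.2⟩
  · simp only [Finset.mem_filter, Finset.mem_range]
    exact fun h => hn ⟨h.1, h.2.2⟩

theorem Tab.remCount_le_off : T.off a + T.remCount t a ≤ T.off (a + 1) := by
  have h := T.off_mono (show a ≤ a + 1 by omega)
  suffices T.remCount t a ≤ T.off (a + 1) - T.off a by omega
  rw [← Nat.card_Ico]
  refine Finset.card_le_card fun e he => ?_
  simp only [Finset.mem_filter, Finset.mem_range] at he
  exact Finset.mem_Ico.mpr ((T.em_eq_iff he.1 a).mp he.2.1)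

/-- This covers all steps that change thresholds or matching but record nothing: they must lower
thresholds soundly, and everything else in the invariant is inherited. -/
theorem ManInv.update (h : ManInv T a S r s) (hc : Ctx T u) (hM : MOK T u)
    (h3 : u.reg 3 = s.reg 3) (h4 : u.reg 4 = s.reg 4) (h5 : u.reg 5 = 0 → s.reg 5 = 0)
    (h6 : u.arr 6 = s.arr 6) (h17 : u.arr 17 = s.arr 17) (hk : Algo.Keeps T (s.arr 11) (u.arr 11))
    (hle : ∀ b < T.q, u.arr 11 b ≤ s.arr 11 b) : ManInv T a S r u := by
  refine ⟨hc, hM, h4.trans h.man, ?_, ?_, ?_, ?_, ?_, ?_, ?_⟩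
  · rw [h3, h6, h17]
    exact h.recOK
  · rw [h3]
    exact h.prev
  · rw [h3]
    exact h.low
  · exact fun N hN he => hk N hN (h.below N hN he)
  · exact fun e he => h.rem e (he.mono (hle _ (T.ew_lt he.1)))
  · rw [h3]
    exact fun h0 => h.done (h5 h0)
  · rw [h3]
    exact (Nat.add_le_add_left (Tab.remCount_le hle) _).trans h.count

theorem MatchOK.eng_of_mem (h : MatchOK T t mM mW) (he : e ∈ T.matchSet mM) : T.Eng t e := by
  obtain ⟨h1, h2⟩ := Tab.mem_matchSet.mp he
  exact h.eng (T.em_lt h1) h2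

theorem MatchOK.man_inj : ∀ e ∈ T.matchSet mM, ∀ f ∈ T.matchSet mM, T.em e = T.em f → e = f := by
  intro e he f hf hef
  have h1 := (Tab.mem_matchSet.mp he).2
  have h2 := (Tab.mem_matchSet.mp hf).2
  rw [hef, h2] at h1
  omega

theorem MatchOK.woman_inj (h : MatchOK T t mM mW) :
    ∀ e ∈ T.matchSet mM, ∀ f ∈ T.matchSet mM, T.ew e = T.ew f → e = f := by
  intro e he f hf hef
  obtain ⟨h1, h2⟩ := Tab.mem_matchSet.mp he
  obtain ⟨k1, k2⟩ := Tab.mem_matchSet.mp hf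
  have h3 := (h.man _ (T.em_lt h1) e h2).2.2.2
  have k3 := (h.man _ (T.em_lt k1) f k2).2.2.2
  rw [hef, k3] at h3
  omega

theorem MatchOK.exists_man (h : MatchOK T t mM mW) {a : ℕ} (ha : a < T.p) (h0 : mM a ≠ 0) :
    ∃ f ∈ T.matchSet mM, T.em f = a := by
  obtain ⟨f, hf⟩ := Nat.exists_eq_succ_of_ne_zero h0
  obtain ⟨h1, h2, -⟩ := h.man a ha f hf
  exact ⟨f, Tab.mem_matchSet.mpr ⟨h2.1.1, by rw [h1, hf]⟩, h1⟩

theorem MatchOK.woman_iff (h : MatchOK T t mM mW) {b : ℕ} (hb : b < T.q) :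
    mW b ≠ 0 ↔ ∃ e ∈ T.matchSet mM, T.ew e = b := by
  constructor
  · intro h0
    obtain ⟨e, he⟩ := Nat.exists_eq_succ_of_ne_zero h0
    obtain ⟨h1, h2, h3⟩ := h.woman b hb e he
    exact ⟨e, Tab.mem_matchSet.mpr ⟨h1, h3⟩, h2⟩
  · rintro ⟨e, he, rfl⟩
    obtain ⟨h1, h2⟩ := Tab.mem_matchSet.mp he
    rw [(h.man _ (T.em_lt h1) e h2).2.2.2]
    omega

end

namespace Algo

open Prog SSM.Expr

variable {T : Tab} {s : Mem} {a : ℕ}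

/-- The time that the run for man `a` still needs. -/
def manPot (T : Tab) (a : ℕ) (u : Mem) : ℕ :=
  if u.reg 5 = 0 then 0 else
    400 * (T.p + T.q + T.m + 1) * (mpot T u + 1) +
      110 * (T.p + 1) * (T.m + 1) * T.remCount (u.arr 11) a

/-- A unit decrease of `mpot` releases `400 * (T.p + T.q + T.m + 1)` steps, the budget of one round.
-/
theorem manPot_le {u : Mem} (h : mpot T u < mpot T s)
    (hr : T.remCount (u.arr 11) a ≤ T.remCount (s.arr 11) a) :
    manPot T a u ≤ 400 * (T.p + T.q + T.m + 1) * mpot T s +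
      110 * (T.p + 1) * (T.m + 1) * T.remCount (s.arr 11) a := by
  rw [manPot]
  split_ifs
  · exact Nat.zero_le _
  · exact Nat.add_le_add (Nat.mul_le_mul_left _ h) (Nat.mul_le_mul_left _ hr)

/-- The memory has the invariant of the run for man `a`. -/
def Inv (T : Tab) (a : ℕ) (u : Mem) : Prop := ∃ S r, ManInv T a S r u

/-- Both outcomes make progress: an augmentation reduces the number of free men, and a failed search
leaves a critical set of women who may soundly lower their thresholds. -/
theorem path_spec {S : ℕ → Finset ℕ} {r B root : ℕ} (hI : ManInv T a S r s)
    (hcur : CurOK T (s.arr 11) (s.arr 14)) (ht : T.Tight (s.arr 11))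
    (h9 : s.reg 9 = root + 1) (hrp : root < T.p) (hroot : s.arr 12 root = 0)
    (hr14 : s.arr 14 root < T.m + 1)
    (hB : 200 * (T.p + T.q + T.m + 1) + 400 * (T.p + T.q + T.m + 1) * mpot T s +
      110 * (T.p + 1) * (T.m + 1) * T.remCount (s.arr 11) a ≤ B) :
    Halts.Within (seq search (ite (reg 12) augment reject)) s B (manPot T a) (Inv T a) := by
  have hc := hI.ctx
  refine Halts.seq_within (search_spec hc hI.mok hcur hroot hrp h9 le_rfl)
    (B' := 100 * (T.p + T.q + T.m + 1) + 400 * (T.p + T.q + T.m + 1) * mpot T s +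
      110 * (T.p + 1) * (T.m + 1) * T.remCount (s.arr 11) a) ?_ (by omega)
  rintro u hf ⟨hBI, hcl⟩
  have u11 : u.arr 11 = s.arr 11 := hf.arr 11 rfl
  have u12 : u.arr 12 = s.arr 12 := hf.arr 12 rfl
  have u13 : u.arr 13 = s.arr 13 := hf.arr 13 rfl
  have hcu := hc.of_frame hf rfl
  have hMu : MOK T u := by
    rw [MOK, u11, u12, u13]
    exact hI.mok
  have hIu : ManInv T a S r u := hI.update hcu hMu (hf.reg 3 rfl) (hf.reg 4 rfl)
    (fun h => (hf.reg 5 rfl) ▸ h) (hf.arr 6 rfl) (hf.arr 17 rfl) (by rw [u11]; exact fun _ _ h => h)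
    (by simp [u11])
  have hBu : MBInv T u u root := by
    rw [MBInv, u11, u12, u13]
    exact hBI
  have hpu : mpot T u = mpot T s := by rw [mpot, u11, u12]
  refine Halts.ite_within (B' := 60 * (T.p + T.q + T.m + 1) +
      400 * (T.p + T.q + T.m + 1) * mpot T s +
      110 * (T.p + 1) * (T.m + 1) * T.remCount (s.arr 11) a) (fun h => ?_) (fun h => ?_)
    (by simp only [Expr.cost]; omega)
  · obtain ⟨e0, he0⟩ := Nat.exists_eq_succ_of_ne_zero h
    refine Halts.within (Halts.mono (augment_spec hcu hMu (u11 ▸ ht) hBu (by rw [u12, hroot]) he0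
      le_rfl) (T' := 60 * (T.p + T.q + T.m + 1)) (by omega) ?_)
    rintro v hfv ⟨v1, v2⟩
    have v11 : v.arr 11 = s.arr 11 := (hfv.arr 11 rfl).trans u11
    have := manPot_le (a := a) (v2.trans_eq hpu) (by rw [v11])
    refine ⟨⟨S, r, hIu.update (hcu.of_frame hfv rfl) v1 (hfv.reg 3 rfl) (hfv.reg 4 rfl)
      (fun h => (hfv.reg 5 rfl) ▸ h) (hfv.arr 6 rfl) (hfv.arr 17 rfl)
      (by rw [v11, u11]; exact fun _ _ h => h) (by simp [v11, u11])⟩, by omega⟩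
  · have h12 : u.reg 12 = 0 := h
    rw [MBInv, h12] at hBI
    have hlt := fun N hN hb => hBI.exists_lt (N := N) hI.mok hroot ht hcl hN hb
    refine Halts.within (Halts.mono (reject_spec hcu hMu ?_ le_rfl)
      (T' := 60 * (T.p + T.q + T.m + 1)) (by omega) ?_)
    · intro b hb h15
      obtain ⟨e, he⟩ := Nat.exists_eq_succ_of_ne_zero h15
      obtain ⟨h1, h2, -⟩ := hBI.par_ok b hb e he
      rw [u11, ← h2, ← ht e h1]
      exact T.rw_pos h1.1.1
    · rintro v hfv ⟨v1, v2, v3⟩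
      have hle : ∀ b < T.q, v.arr 11 b ≤ u.arr 11 b := by
        intro b hb
        rw [v2 b hb]
        split_ifs <;> omega
      -- The critical set is not empty: the root has a remaining edge, hence an engaged one, and the
      -- search visits its woman.
      have hvis : ∃ b < T.q, u.arr 15 b ≠ 0 := by
        rcases hcur.att root hrp with h' | ⟨e, he, hem, her⟩
        · omega
        · refine ⟨T.ew e, T.ew_lt he.1, hcl 0 hBI.tail_pos e ?_ (hem.trans hBI.q_zero.symm)⟩
          exact (hcur.eng_iff he).mpr (by rw [her, hem])
      have hrc : T.remCount (v.arr 11) a ≤ T.remCount (s.arr 11) a := by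
        rw [← u11]
        exact Tab.remCount_le hle
      have := manPot_le (a := a) ((v3 hvis).trans_eq hpu) hrc
      refine ⟨⟨S, r, hIu.update (hcu.of_frame hfv rfl) v1 (hfv.reg 3 rfl) (hfv.reg 4 rfl)
        (fun h => (hfv.reg 5 rfl) ▸ h) (hfv.arr 6 rfl) (hfv.arr 17 rfl) ?_ hle⟩, by omega⟩
      intro N hN hb b hbq hbt
      rw [u11] at hb
      rw [v2 b hbq, u11] at hbt ⊢
      split_ifs at hbt ⊢ with h15
      · obtain ⟨e, he, h1, h2⟩ := hlt N hN hb b hbq h15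
        exact ⟨e, he, h1, by omega⟩
      · exact hb b hbq hbt

/-- Now the matching dominates every matching that is still to be covered. If it is valid and
matches `a` by `e0`, it is strongly stable and man-optimal for `e0`, since every `N` containing `e0`
obeys the thresholds. If it is invalid or leaves `a` free, no strongly stable matching gives `a` a
rank above `r`, and the run for `a` is finished. -/
theorem complete_spec {S : ℕ → Finset ℕ} {r B : ℕ} (hI : ManInv T a S r s) (ha : a < T.p)
    (hcur : CurOK T (s.arr 11) (s.arr 14)) (ht : T.Tight (s.arr 11))
    (hsat : ∀ e, T.Rem (s.arr 11) e → s.arr 12 (T.em e) ≠ 0)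
    (hB : 150 * (T.p + T.q + T.m + 1) + 400 * (T.p + T.q + T.m + 1) * mpot T s +
      110 * (T.p + 1) * (T.m + 1) * T.remCount (s.arr 11) a ≤ B) :
    Halts.Within (seq validate (ite (.bin .mul (reg 17) (get 12 (reg 4)))
      (seq record force) (assign 5 (lit 0)))) s B (manPot T a) (Inv T a) := by
  have hc := hI.ctx
  have hE : ∀ e ∈ T.matchSet (s.arr 12), T.Eng (s.arr 11) e := fun e he => hI.mok.eng_of_mem he
  have hsat' : ∀ e, T.Rem (s.arr 11) e → ∃ f ∈ T.matchSet (s.arr 12), T.em f = T.em e :=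
    fun e he => hI.mok.exists_man (T.em_lt he.1) (hsat e he)
  refine Halts.seq_within (validate_spec hc le_rfl)
    (B' := 100 * (T.p + T.q + T.m + 1) + 400 * (T.p + T.q + T.m + 1) * mpot T s +
      110 * (T.p + 1) * (T.m + 1) * T.remCount (s.arr 11) a) ?_ (by omega)
  intro u hf hv
  have u11 : u.arr 11 = s.arr 11 := hf.arr 11 rfl
  have u12 : u.arr 12 = s.arr 12 := hf.arr 12 rfl
  have u13 : u.arr 13 = s.arr 13 := hf.arr 13 rfl
  have u14 : u.arr 14 = s.arr 14 := hf.arr 14 rfl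
  have u4 : u.reg 4 = a := (hf.reg 4 rfl).trans hI.man
  have hcu := hc.of_frame hf rfl
  have hMu : MOK T u := by
    rw [MOK, u11, u12, u13]
    exact hI.mok
  have hIu : ManInv T a S r u := hI.update hcu hMu (hf.reg 3 rfl) (hf.reg 4 rfl)
    (fun h => (hf.reg 5 rfl) ▸ h) (hf.arr 6 rfl) (hf.arr 17 rfl) (by rw [u11]; exact fun _ _ h => h)
    (by simp [u11])
  have hpu : mpot T u = mpot T s := by rw [mpot, u11, u12]
  have hval : u.reg 17 ≠ 0 ↔
      ∀ b < T.q, s.arr 11 b < T.wi b → ∃ e ∈ T.matchSet (s.arr 12), T.ew e = b := by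
    rw [hv]
    exact forall₃_congr fun b hb _ => hI.mok.woman_iff hb
  refine Halts.ite_within (B' := 80 * (T.m + 1) + 400 * (T.p + T.q + T.m + 1) * mpot T s +
      110 * (T.p + 1) * (T.m + 1) * T.remCount (s.arr 11) a) (fun h => ?_) (fun h => ?_)
    (by simp only [Expr.cost]; omega)
  · simp only [Expr.eval, BinOp.eval, u4, u12, ne_eq, Nat.mul_eq_zero, not_or] at h
    obtain ⟨h17, hm⟩ := h
    have hst := Tab.stable_of_tight ht hE MatchOK.man_inj hI.mok.woman_inj hsat' (hval.mp h17)
    obtain ⟨e0, he0, hea⟩ := hI.mok.exists_man ha hm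
    have hE0 := hE e0 he0
    have hr0 : r < T.rm e0 := hI.rem e0 hE0.1 hea
    have hlow : ∀ N, T.Stable N → (∃ e ∈ N, T.em e = a ∧ r < T.rm e) →
        T.Dom (T.matchSet (s.arr 12)) N :=
      fun N hN he => hN.dom_of_below (hI.below N hN he) hE hsat'
    have hrem1 : 1 ≤ T.remCount (s.arr 11) a := by
      refine Finset.card_pos.mpr ⟨e0, ?_⟩
      simp only [Finset.mem_filter, Finset.mem_range]
      exact ⟨hE0.1.1, hea, hE0.1.2⟩
    -- Each row has used up an edge, so by `count` the comparison runs over at most `m` earlier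
    -- rows.
    have hk3 : u.reg 3 + 1 ≤ T.m + 1 := by
      have h1 := hIu.count
      rw [u11] at h1
      have := T.off_le (a + 1)
      omega
    have hrt : 110 * (T.p + 1) * (u.reg 3 + 1) ≤ 110 * (T.p + 1) * (T.m + 1) :=
      Nat.mul_le_mul_left _ hk3
    -- The edge `e0` will cease to remain; its share of the potential pays for the record.
    have hsub : 110 * (T.p + 1) * (T.m + 1) +
        110 * (T.p + 1) * (T.m + 1) * (T.remCount (s.arr 11) a - 1) =
        110 * (T.p + 1) * (T.m + 1) * T.remCount (s.arr 11) a := by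
      conv_rhs => rw [show T.remCount (s.arr 11) a = 1 + (T.remCount (s.arr 11) a - 1) by omega]
      ring
    refine Halts.seq_within (record_spec (S := S) hcu hMu (by rw [u11, u14]; exact hcur)
      (by rw [u11, u12]; exact hsat) hIu.recOK (by rw [u12]; exact hst) ?_ hrt)
      (B' := 80 * (T.m + 1) + 400 * (T.p + T.q + T.m + 1) * mpot T s +
        110 * (T.p + 1) * (T.m + 1) * (T.remCount (s.arr 11) a - 1)) ?_ (by omega)
    · rw [u12]
      exact ⟨e0, he0, fun N hN he => hlow N hN ⟨e0, he, hea, hr0⟩⟩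
    rintro v hfv ⟨v3, v3', S', hrec, hS', i, hi, hdom, hrk⟩
    rw [u12] at hdom hrk
    have v11 : v.arr 11 = s.arr 11 := (hfv.arr 11 rfl).trans u11
    have v12 : v.arr 12 = s.arr 12 := (hfv.arr 12 rfl).trans u12
    have v13 : v.arr 13 = s.arr 13 := (hfv.arr 13 rfl).trans u13
    have v14 : v.arr 14 = s.arr 14 := (hfv.arr 14 rfl).trans u14
    have v4 : v.reg 4 = a := (hfv.reg 4 rfl).trans u4
    have hcv := hcu.of_frame hfv rfl
    have hMv : MOK T v := by
      rw [MOK, v11, v12, v13]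
      exact hI.mok
    have hpv : mpot T v = mpot T s := by rw [mpot, v11, v12]
    refine Halts.within (Halts.mono (force_spec hcv hMv (by rw [v11, v14]; exact hcur)
      (v11 ▸ ht) v4 (by rw [v11]; exact ⟨e0, hE0, hea⟩) le_rfl) le_rfl ?_)
    rintro w hfw ⟨w1, w2, w3⟩
    rw [v11] at w3
    have w3r : w.reg 3 = v.reg 3 := hfw.reg 3 rfl
    have hwle : ∀ b < T.q, w.arr 11 b ≤ s.arr 11 b := by
      intro b _
      by_cases hb : ∃ e, T.Eng (s.arr 11) e ∧ T.em e = a ∧ T.ew e = b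
      · rw [(w3 b).1 hb]
        exact Nat.sub_le _ _
      · rw [(w3 b).2 hb]
    have hkill : ∀ e, T.Eng (s.arr 11) e → T.em e = a → ¬ T.Rem (w.arr 11) e := by
      intro e he hem hre
      have h1 := hre.2
      rw [(w3 _).1 ⟨e, he, hem, rfl⟩, ← ht e he] at h1
      have := T.rw_pos he.1.1
      omega
    have hrw : T.remCount (w.arr 11) a < T.remCount (s.arr 11) a := by
      have := Tab.remCount_lt hwle hE0.1 (hkill e0 hE0 hea)
      rwa [hea] at this
    have hcov : ∀ N, T.Stable N → ∀ e ∈ N, T.em e = a → T.rm e ≤ T.rm e0 →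
        T.Cov (v.reg 3) S' N e := by
      intro N hN e he hem her
      by_cases hr : T.rm e ≤ r
      · exact (hIu.low N hN e he hem hr).mono v3 hS'
      · have hx : ∃ e ∈ N, T.em e = a ∧ r < T.rm e := ⟨e, he, hem, by omega⟩
        -- A matching with rank above `r` for `a` obeys the thresholds, so its edge at `a` remains
        -- and cannot be better than `e0`; the ranks are equal and the new row covers it.
        have hre := hN.rem (hI.below N hN hx) he
        have heq : T.rm e0 = T.rm e := le_antisymm (hE0.2 e hre (hem.trans hea.symm)) her
        have hd := hlow N hN hx
        obtain ⟨f, hf1, hf2, hf3⟩ := hrk e0 he0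
        refine ⟨i, hi, fun g hg => ?_, f, hf1, hf2.trans (hea.trans hem.symm), hf3.trans heq⟩
        obtain ⟨g', h1, h2, h3⟩ := hd g hg
        obtain ⟨g'', k1, k2, k3⟩ := hdom g' h1
        exact ⟨g'', k1, k2.trans h2, k3.trans h3⟩
    have hpot : manPot T a w ≤ 400 * (T.p + T.q + T.m + 1) * mpot T s +
        110 * (T.p + 1) * (T.m + 1) * (T.remCount (s.arr 11) a - 1) := by
      rw [manPot]
      split_ifs
      · exact Nat.zero_le _
      · exact Nat.add_le_add (Nat.mul_le_mul_left _ (w2.trans_eq hpv))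
          (Nat.mul_le_mul_left _ (by omega))
    refine ⟨⟨S', T.rm e0, hcv.of_frame hfw rfl, w1, (hfw.reg 4 rfl).trans v4, ?_, ?_, ?_, ?_, ?_,
      ?_, ?_⟩, by omega⟩
    · have w6 : w.arr 6 = v.arr 6 := hfw.arr 6 rfl
      have w17 : w.arr 17 = v.arr 17 := hfw.arr 17 rfl
      rw [w3r, w6, w17]
      exact hrec
    · rw [w3r]
      exact fun N hN e he hem => (hIu.prev N hN e he hem).mono v3 hS'
    · rw [w3r]
      exact hcov
    · rintro N hN ⟨e, he, hem, her⟩ b hbq hbt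
      have hb := hI.below N hN ⟨e, he, hem, by omega⟩
      by_cases hx : ∃ e, T.Eng (s.arr 11) e ∧ T.em e = a ∧ T.ew e = b
      · rw [(w3 b).1 hx] at hbt ⊢
        obtain ⟨g, hg1, hg2, hg3⟩ := hx
        -- From now on only matchings that are worse for `a` than `e0` count. They give him no
        -- engaged edge, so all women engaged to him do strictly better.
        have hno : ∀ f ∈ N, T.em f = T.em g → ¬ T.Eng (s.arr 11) f := by
          intro f hf hfm hfE
          have := hN.man f hf e he (hfm.trans (hg2.trans hem.symm))
          have h1 := hfE.2 e0 hE0.1 (hea.trans (hg2.symm.trans hfm.symm))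
          rw [this] at h1
          omega
        obtain ⟨f, k1, k2, k3⟩ := hN.exists_lt_of_eng hb hg1 hno
        refine ⟨f, k1, k2.trans hg3, ?_⟩
        rw [← hg3, ← ht g hg1]
        omega
      · rw [(w3 b).2 hx] at hbt ⊢
        exact hb b hbq hbt
    · intro e he hem
      have hre : T.Rem (s.arr 11) e := he.mono (hwle _ (T.ew_lt he.1))
      refine lt_of_le_of_ne (hE0.2 e hre (hem.trans hea.symm)) fun heq => ?_
      -- A remaining edge of `a` with the rank of `e0` would have been engaged, but all engaged
      -- edges of `a` have been rejected; so the bound `r` moves up to `T.rm e0`.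
      exact hkill e (hE0.of_rm_le hre (hem.trans hea.symm) heq.ge) hem he
    · intro h0
      rw [w3r]
      have h5 : u.reg 5 = 0 := by
        rw [← hfv.reg 5 rfl, ← hfw.reg 5 rfl, h0]
      exact fun N hN e he hem => (hIu.done h5 N hN e he hem).mono v3 hS'
    · have h1 := hIu.count
      rw [u11] at h1
      omega
  · refine Halts.within (Halts.of_run (T := 2) rfl (by decide) ?_)
    have hcov : ∀ N, T.Stable N → ∀ e ∈ N, T.em e = a → T.Cov (u.reg 3) S N e := by
      intro N hN e he hem
      by_cases hr : T.rm e ≤ r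
      · exact hIu.low N hN e he hem hr
      · exfalso
        have hb := hI.below N hN ⟨e, he, hem, by omega⟩
        -- An uncovered `N` would obey the thresholds, which makes the matching valid, and its edge
        -- at `a` would remain, which makes `a` matched; but the test has failed.
        have h17 := hval.mpr (hN.valid_of_below hb ht hE hI.mok.woman_inj hsat')
        have h0 := hsat e (hN.rem hb he)
        simp only [Expr.eval, BinOp.eval, u4, u12, Nat.mul_eq_zero] at h
        rw [hem] at h0
        exact h.elim h17 h0
    refine ⟨⟨S, r, ?_⟩, ?_⟩
    · refine ⟨(hcu.of_frame (c := assign 5 (lit 0)) ?_ rfl), hMu, u4, hIu.recOK, hIu.prev, hIu.low,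
        hIu.below, hIu.rem, fun _ => hcov, hIu.count⟩
      exact (Steps.assign u 5 (lit 0)).frame
    · have : manPot T a ((assign 5 (lit 0)).run u) = 0 := if_pos (by simp [run, Expr.eval])
      omega

theorem round_spec (hI : Inv T a s) (ha : a < T.p) (h5 : s.reg 5 ≠ 0) :
    ∃ B, B + 2 ≤ manPot T a s ∧ Halts.Within round s B (manPot T a) (Inv T a) := by
  obtain ⟨S, r, hI⟩ := hI
  refine ⟨390 * (T.p + T.q + T.m + 1) + 400 * (T.p + T.q + T.m + 1) * mpot T s +
      110 * (T.p + 1) * (T.m + 1) * T.remCount (s.arr 11) a, ?_, ?_⟩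
  · rw [manPot, if_neg h5, mul_add_one (400 * (T.p + T.q + T.m + 1))]
    omega
  have hc := hI.ctx
  refine Halts.seq_within (T := 120 * (T.p + T.m + 1)) (Halts.seq (bestRanks_spec hc le_rfl)
    (fun u hf hcur => ?_) (T' := 80 * (T.m + 1)) (by omega)) ?_
    (B' := 250 * (T.p + T.q + T.m + 1) + 400 * (T.p + T.q + T.m + 1) * mpot T s +
      110 * (T.p + 1) * (T.m + 1) * T.remCount (s.arr 11) a) (by omega)
    (Q := fun v => CurOK T (s.arr 11) (v.arr 14) ∧ MOK T v ∧
      Keeps T (s.arr 11) (v.arr 11) ∧ (∀ b, v.arr 11 b ≤ s.arr 11 b) ∧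
      (v.reg 8 = 0 → (v.arr 11 = s.arr 11 ∧ v.arr 12 = s.arr 12) ∧ T.Tight (v.arr 11)) ∧
      (v.reg 8 ≠ 0 → mpot T v < mpot T s))
  · have u11 : u.arr 11 = s.arr 11 := hf.arr 11 rfl
    have u12 : u.arr 12 = s.arr 12 := hf.arr 12 rfl
    have u13 : u.arr 13 = s.arr 13 := hf.arr 13 rfl
    refine Halts.mono (tighten_spec (hc.of_frame hf rfl)
      (by rw [MOK, u11, u12, u13]; exact hI.mok) (by rw [u11]; exact hcur) le_rfl) le_rfl ?_
    rintro v hfv ⟨v1, v2, v3, v4, v5⟩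
    have v14 : v.arr 14 = u.arr 14 := hfv.arr 14 rfl
    simp only [mpot, u11, u12] at v2 v3 v4 v5
    refine ⟨by rw [v14]; exact hcur, v1, v2, v3, fun h => ⟨⟨(v4 h).1.1, (v4 h).1.2.1⟩, (v4 h).2⟩,
      v5⟩
  rintro v hf ⟨hcur, hMv, hk, hle, hz, hnz⟩
  have hcv := hc.of_frame hf rfl
  have hIv : ManInv T a S r v := hI.update hcv hMv (hf.reg 3 rfl) (hf.reg 4 rfl)
    (fun h => (hf.reg 5 rfl) ▸ h) (hf.arr 6 rfl) (hf.arr 17 rfl) hk (fun b _ => hle b)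
  refine Halts.ite_within (B' := 245 * (T.p + T.q + T.m + 1) +
      400 * (T.p + T.q + T.m + 1) * mpot T s +
      110 * (T.p + 1) * (T.m + 1) * T.remCount (s.arr 11) a) (fun h8 => ?_) (fun h8 => ?_)
    (by simp only [Expr.cost]; omega)
  · refine Halts.within (Halts.of_run (T := 1) rfl (by decide) ?_)
    have := manPot_le (a := a) (hnz h8) (Tab.remCount_le fun b _ => hle b)
    exact ⟨⟨S, r, hIv⟩, by simp only [run]; omega⟩
  · obtain ⟨⟨v11, v12⟩, ht⟩ := hz h8
    refine Halts.seq_within (findRoot_spec hcv le_rfl)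
      (B' := 205 * (T.p + T.q + T.m + 1) + 400 * (T.p + T.q + T.m + 1) * mpot T s +
        110 * (T.p + 1) * (T.m + 1) * T.remCount (s.arr 11) a) ?_ (by omega)
    rintro w hfw ⟨w1, w2⟩
    have w11 : w.arr 11 = v.arr 11 := hfw.arr 11 rfl
    have w12 : w.arr 12 = v.arr 12 := hfw.arr 12 rfl
    have w13 : w.arr 13 = v.arr 13 := hfw.arr 13 rfl
    have w14 : w.arr 14 = v.arr 14 := hfw.arr 14 rfl
    have hIw : ManInv T a S r w := hIv.update (hcv.of_frame hfw rfl)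
      (by rw [MOK, w11, w12, w13]; exact hMv) (hfw.reg 3 rfl) (hfw.reg 4 rfl)
      (fun h => (hfw.reg 5 rfl) ▸ h) (hfw.arr 6 rfl) (hfw.arr 17 rfl)
      (by rw [w11]; exact fun _ _ h => h) (by simp [w11])
    have hcw : CurOK T (w.arr 11) (w.arr 14) := by
      rw [w11, w14, v11]
      exact hcur
    have hpw : mpot T w = mpot T s := by rw [mpot, w11, w12, v11, v12]
    have hrw : T.remCount (w.arr 11) a = T.remCount (s.arr 11) a := by rw [w11, v11]
    refine Halts.ite_within (B' := 200 * (T.p + T.q + T.m + 1) +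
      400 * (T.p + T.q + T.m + 1) * mpot T s +
      110 * (T.p + 1) * (T.m + 1) * T.remCount (s.arr 11) a) (fun h9 => ?_) (fun h9 => ?_)
      (by simp only [Expr.cost]; omega)
    · obtain ⟨root, hroot⟩ := Nat.exists_eq_succ_of_ne_zero h9
      obtain ⟨h1, h2, h3⟩ := w2 root hroot
      exact path_spec hIw hcw (w11 ▸ ht) hroot h1 (by rw [w12, h2]) (by rw [w14]; exact h3)
        (by rw [hpw, hrw])
    · refine complete_spec hIw ha hcw (w11 ▸ ht) ?_ (by rw [hpw, hrw]; omega)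
      intro e he h0
      rw [w12] at h0
      have h1 := w1 h9 _ (T.em_lt he.1) h0
      have h2 := hcw.le e he
      rw [w14] at h2
      have := T.rm_le he.1
      omega

end Algo
end SSM

/-! ### The loop over the men, the table of the order and the preprocessing. -/

namespace SSM

namespace Algo

open Prog SSM.Expr

variable {T : Tab} {s : Mem} {a : ℕ}

/-- The rows cover all pairs of a strongly stable matching and an edge at one of the first `k`
men in it. -/
def Covered (T : Tab) (k : ℕ) (S : ℕ → Finset ℕ) (u : Mem) : Prop :=
  RecOK T (u.reg 3) (u.arr 6) (u.arr 17) S ∧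
    (∀ N, T.Stable N → ∀ e ∈ N, T.em e < k → T.Cov (u.reg 3) S N e) ∧ u.reg 3 ≤ T.off k

/-- The time for man `a`. -/
def manTime (T : Tab) (a : ℕ) : ℕ :=
  10 + 470 * ((T.p + T.q + 1) * (5 * T.m + 1)) * (T.off (a + 1) - T.off a) +
    470 * (T.m * (5 * T.m + 1)) + 110 * (T.p + 1) * (T.m + 1) * (T.off (a + 1) - T.off a)

/-- A woman without edges has initial threshold 0 rather than 1, so the bound contains no term for
the number of women. -/
theorem sum_wi_le (T : Tab) : ∑ b ∈ Finset.range T.q, T.wi b ≤ 2 * T.m := by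
  rw [← T.sum_wd, Finset.mul_sum]
  refine Finset.sum_le_sum fun b _ => ?_
  rw [Tab.wi]
  split_ifs <;> omega

theorem manRun_spec {S : ℕ → Finset ℕ} (hc : Ctx T s) (h4 : s.reg 4 = a) (ha : a < T.p)
    (hS : Covered T a S s) :
    Halts manRun s (manTime T a) (fun u => ∃ S', Covered T (a + 1) S' u) := by
  obtain ⟨hrec, hprev, hk⟩ := hS
  have hmono := T.off_mono (show a ≤ a + 1 by omega)
  have hev : (bin .lt (get 0 (reg 4)) (get 0 (bin .add (reg 4) (lit 1)))).eval s =
      if T.off a < T.off (a + 1) then 1 else 0 := by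
    simp only [Expr.eval, BinOp.eval, hc.off, h4]
  refine Halts.ite (T := manTime T a - 8) (fun h => ?_) (fun h => ?_)
    (by simp only [Expr.cost, manTime]; omega)
  · have hlt : T.off a < T.off (a + 1) := by
      by_contra hn
      rw [hev, if_neg hn] at h
      exact h rfl
    set X := (T.p + T.q + 1) * (5 * T.m + 1) with hX
    have htime : 60 * (T.p + T.q + 1) + (4 + (400 * (T.p + T.q + T.m + 1) * (5 * T.m + 1) +
        110 * (T.p + 1) * (T.m + 1) * (T.off (a + 1) - T.off a))) ≤ manTime T a - 8 := by
      -- This man has an edge, so the part of his time that involves the number of vertices can be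
      -- charged to his degree. Summed over the men this gives a factor `m` in place of `p`.
      have h1 : X * 1 ≤ X * (T.off (a + 1) - T.off a) := Nat.mul_le_mul_left _ (by omega)
      have h2 : T.p + T.q + 1 ≤ X := Nat.le_mul_of_pos_right _ (by omega)
      have h3 : 400 * (T.p + T.q + T.m + 1) * (5 * T.m + 1) =
          400 * X + 400 * (T.m * (5 * T.m + 1)) := by
        rw [hX]
        ring
      have h4 : 470 * X * (T.off (a + 1) - T.off a) = 470 * (X * (T.off (a + 1) - T.off a)) := by
        ring
      rw [manTime, h3, h4]
      omega
    refine Halts.seq (reset_spec hc le_rfl) ?_ htime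
    rintro u hf ⟨u12, u1113⟩
    refine Halts.seq (Halts.of_run (T := 2) (Q := fun v => v = u.setR 5 1) rfl (by decide) rfl) ?_
      (T' := 2 + (400 * (T.p + T.q + T.m + 1) * (5 * T.m + 1) +
        110 * (T.p + 1) * (T.m + 1) * (T.off (a + 1) - T.off a))) (by omega)
    intro v hfv hv
    have hcv := (hc.of_frame hf rfl).of_frame hfv rfl
    have v11 : v.arr 11 = u.arr 11 := hfv.arr 11 rfl
    have v12 : v.arr 12 = u.arr 12 := hfv.arr 12 rfl
    have v13 : v.arr 13 = u.arr 13 := hfv.arr 13 rfl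
    have v3 : v.reg 3 = s.reg 3 := (hfv.reg 3 rfl).trans (hf.reg 3 rfl)
    have v4 : v.reg 4 = a := ((hfv.reg 4 rfl).trans (hf.reg 4 rfl)).trans h4
    have v6 : v.arr 6 = s.arr 6 := (hfv.arr 6 rfl).trans (hf.arr 6 rfl)
    have v17 : v.arr 17 = s.arr 17 := (hfv.arr 17 rfl).trans (hf.arr 17 rfl)
    have v5 : v.reg 5 = 1 := by simp [hv]
    have hI : ManInv T a S 0 v := by
      refine ⟨hcv, ⟨fun x hx e he => ?_, fun b hb e he => ?_⟩, v4, ?_, ?_, ?_, ?_, ?_, ?_, ?_⟩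
      · rw [v12, u12 x hx] at he
        omega
      · rw [v13, (u1113 b hb).1] at he
        omega
      · rwa [v3, v6, v17]
      · rwa [v3]
      · intro N hN e he _ h0
        have := T.rm_pos (hN.lt e he)
        omega
      · intro N _ _ b hb hlt
        rw [v11, (u1113 b hb).2] at hlt
        omega
      · exact fun e he _ => T.rm_pos he.1
      · rw [v5]
        exact fun h => absurd h one_ne_zero
      · have := T.remCount_le_off (a := a) (t := v.arr 11)
        omega
    refine Halts.mono (Halts.loop_within (Inv T a) (manPot T a) ⟨S, 0, hI⟩ ?_ le_rfl) ?_ ?_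
    · intro w hw _ h5
      exact round_spec hw ha h5
    -- Twice the sum of the initial thresholds is at most `4 * T.m`, and at most `T.m` men have an
    -- edge.
    · have hp : mpot T v ≤ 5 * T.m := by
        have h1 : ∑ b ∈ Finset.range T.q, v.arr 11 b = ∑ b ∈ Finset.range T.q, T.wi b := by
          refine Finset.sum_congr rfl fun b hb => ?_
          rw [v11, (u1113 b (Finset.mem_range.mp hb)).2]
        have h2 := sum_wi_le T
        have h3 : (((Finset.range T.m).image T.em).filter (fun a => v.arr 12 a = 0)).card ≤ T.m :=
          (Finset.card_filter_le _ _).trans (Finset.card_image_le.trans (by simp))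
        rw [mpot, Tab.pot, h1]
        omega
      have hr : T.remCount (v.arr 11) a ≤ T.off (a + 1) - T.off a := by
        have := T.remCount_le_off (a := a) (t := v.arr 11)
        omega
      have h1 : 400 * (T.p + T.q + T.m + 1) * (mpot T v + 1) ≤
          400 * (T.p + T.q + T.m + 1) * (5 * T.m + 1) := Nat.mul_le_mul_left _ (by omega)
      have h2 : 110 * (T.p + 1) * (T.m + 1) * T.remCount (v.arr 11) a ≤
          110 * (T.p + 1) * (T.m + 1) * (T.off (a + 1) - T.off a) := Nat.mul_le_mul_left _ hr
      rw [manPot]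
      simp only [Expr.cost]
      split_ifs <;> omega
    · rintro w _ ⟨⟨S', r, hw⟩, h5⟩
      refine ⟨S', hw.recOK, fun N hN e he hem => ?_, ?_⟩
      · rcases Nat.lt_succ_iff_lt_or_eq.mp hem with h' | h'
        · exact hw.prev N hN e he h'
        · exact hw.done h5 N hN e he h'
      · exact (Nat.le_add_right _ _).trans hw.count
  · have hle : ¬ T.off a < T.off (a + 1) := by
      intro hn
      rw [hev, if_pos hn] at h
      exact one_ne_zero h
    refine Halts.of_run rfl (by simp only [maxCost, manTime]; omega) ⟨S, hrec, ?_, ?_⟩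
    · intro N hN e he hem
      refine hprev N hN e he (lt_of_le_of_ne (by omega) fun h0 => hle ?_)
      have := (T.em_eq_iff (hN.lt e he) a).mp h0
      omega
    · exact hk.trans hmono

theorem menLoop_spec (hc : Ctx T s) (h3 : s.reg 3 = 0) :
    Halts (forTo 4 (reg 0) manRun) s (∑ a ∈ Finset.range T.p, (manTime T a + 8) + 6)
      (fun u => ∃ S, Covered T T.p S u) := by
  refine Halts.forTo_sum T.p (manTime T) (fun k u => ∃ S, Covered T k S u) ⟨fun _ => ∅, ?_⟩
    (fun u hf => (hf.reg 0 rfl).trans hc.p) rfl ?_ le_rfl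
  · have h : (s.setR 4 0).reg 3 = 0 := h3
    rw [Covered, h]
    refine ⟨⟨?_, ?_, ?_, ?_, ?_, ?_, ?_⟩, ?_, Nat.zero_le _⟩
    all_goals first
      | exact fun i hi => absurd hi (Nat.not_lt_zero i)
      | exact fun N _ e _ hem => absurd hem (Nat.not_lt_zero _)
  · rintro k u hk hx hf ⟨S, hS⟩
    exact manRun_spec (hc.of_frame hf rfl) hx hk hS

/-- Register 15 records whether row `j` is nowhere larger than row `i`, and register 16 whether it
is somewhere smaller. The table enters as a function `F` with prescribed values, which keeps the
decidability instance of its `if` out of the argument. -/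
theorem order_spec {R : ℕ} {S : ℕ → Finset ℕ} {F : ℕ → ℕ → ℕ} (hc : Ctx T s)
    (hrec : RecOK T (s.reg 3) (s.arr 6) (s.arr 17) S)
    (hF : ∀ i j, T.Dom (S j) (S i) → ¬ T.Dom (S i) (S j) → F i j = 1)
    (hF0 : ∀ i j, ¬ (T.Dom (S j) (S i) ∧ ¬ T.Dom (S i) (S j)) → F i j = 0)
    (hR : s.reg 3 * (s.reg 3 * (60 * T.p + 60) + 20) + 6 ≤ R) :
    Halts order s R (fun u => ∀ i < s.reg 3, ∀ j < s.reg 3, u.arr 7 (i * s.reg 3 + j) = F i j) := by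
  refine Halts.mono (Halts.forTo (s.reg 3) (s.reg 3 * (60 * T.p + 60) + 6)
    (fun i u => ∀ i' < i, ∀ j < s.reg 3, u.arr 7 (i' * s.reg 3 + j) = F i' j) (by simp)
    (fun u hf => hf.reg 3 rfl) rfl ?_ le_rfl) ?_ (fun _ _ h => h)
  · intro i u hi hx hf hI
    have hcu := hc.of_frame hf rfl
    have u3 : u.reg 3 = s.reg 3 := hf.reg 3 rfl
    have u17 : u.arr 17 = s.arr 17 := hf.arr 17 rfl
    refine Halts.mono (Halts.forTo (s.reg 3) (60 * T.p + 50)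
      (fun j v => (∀ i' < i, ∀ j < s.reg 3, v.arr 7 (i' * s.reg 3 + j) = F i' j) ∧
        ∀ j' < j, v.arr 7 (i * s.reg 3 + j') = F i j') ⟨hI, by simp⟩
      (fun v hf => (hf.reg 3 rfl).trans u3) rfl ?_ le_rfl) ?_ ?_
    · rintro j v hj hxv hfv ⟨i1, i2⟩
      have hcv := hcu.of_frame hfv rfl
      have v3 : v.reg 3 = s.reg 3 := (hfv.reg 3 rfl).trans u3
      have v6 : v.reg 6 = i := (hfv.reg 6 rfl).trans hx
      have v17 : v.arr 17 = s.arr 17 := (hfv.arr 17 rfl).trans u17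
      refine Halts.seq (Halts.of_run (T := 4) (Q := fun w => w.reg 15 = 1 ∧ w.reg 16 = 0 ∧
        w.reg 6 = i ∧ w.reg 7 = j ∧ w.reg 3 = s.reg 3 ∧ w.arr = v.arr) rfl (by decide)
        (by simp [run, Expr.eval, v6, hxv, v3])) ?_ (T' := 60 * T.p + 46) (by omega)
      rintro w hfw ⟨w15, w16, w6, w7, w3, warr⟩
      have hcw := hcv.of_frame hfw rfl
      refine Halts.seq (Q := fun x => (x.reg 15 ≠ 0 ↔ T.Dom (S j) (S i)) ∧
        (x.reg 16 = 0 ∨ x.reg 16 = 1) ∧ (x.reg 16 = 0 ↔ T.Dom (S i) (S j)))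
        (T := 60 * T.p + 6) (T' := 20) ?_ ?_ (by omega)
      · refine Halts.mono (Halts.forTo T.p 52 (fun b x =>
          (x.reg 15 ≠ 0 ↔ ∀ c < b, s.arr 17 (j * T.p + c) ≤ s.arr 17 (i * T.p + c)) ∧
          (x.reg 16 = 0 ∨ x.reg 16 = 1) ∧
          (x.reg 16 = 0 ↔ ∀ c < b, s.arr 17 (i * T.p + c) ≤ s.arr 17 (j * T.p + c)))
          (by simp [w15, w16]) (fun x hf => (hf.reg 0 rfl).trans hcw.p) rfl ?_ le_rfl) ?_ ?_
        · rintro b x hb hxx hfx ⟨j1, j2, j3⟩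
          have hcx := hcw.of_frame hfx rfl
          have x6 : x.reg 6 = i := (hfx.reg 6 rfl).trans w6
          have x7 : x.reg 7 = j := (hfx.reg 7 rfl).trans w7
          have x17 : x.arr 17 = s.arr 17 := by rw [hfx.arr 17 rfl, warr, v17]
          refine Halts.of_run rfl (by decide) ?_
          have hsplit : ∀ f g : ℕ → ℕ, (∀ c < b + 1, f c ≤ g c) ↔ (∀ c < b, f c ≤ g c) ∧
              f b ≤ g b := by
            intro f g
            constructor
            · exact fun h => ⟨fun c hc => h c (by omega), h b (by omega)⟩
            · rintro ⟨h1, h2⟩ c hc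
              rcases Nat.lt_succ_iff_lt_or_eq.mp hc with h' | rfl
              exacts [h1 c h', h2]
          rw [hsplit (fun c => s.arr 17 (j * T.p + c)) (fun c => s.arr 17 (i * T.p + c)),
            hsplit (fun c => s.arr 17 (i * T.p + c)) (fun c => s.arr 17 (j * T.p + c)), ← j1, ← j3]
          simp only [run, Expr.eval, BinOp.eval, hxx, x6, x7, x17, hcx.p]
          rcases lt_trichotomy (s.arr 17 (i * T.p + b)) (s.arr 17 (j * T.p + b)) with h | h | h
          · have h' := h.not_gt
            have h'' := h.not_ge
            simp [h, h', h'', h.le, hxx, x6, x7, x17, hcx.p, j2]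
          · simp [h, j2, hxx, x6, x7, x17, hcx.p]
          · have h' := h.not_gt
            have h'' := h.not_ge
            simp [h, h', h'', h.le, hxx, x6, x7, x17, hcx.p]
        · simp only [Expr.cost]
          omega
        · rintro x _ ⟨j1, j2, j3⟩
          exact ⟨j1.trans (hrec.dom_iff hj hi).symm, j2, j3.trans (hrec.dom_iff hi hj).symm⟩
      · rintro x hfx ⟨x15, x16, x16'⟩
        refine Halts.of_run rfl (by decide) ?_
        have x6 : x.reg 6 = i := (hfx.reg 6 rfl).trans w6
        have x7 : x.reg 7 = j := (hfx.reg 7 rfl).trans w7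
        have x3 : x.reg 3 = s.reg 3 := (hfx.reg 3 rfl).trans w3
        have x7a : x.arr 7 = v.arr 7 := by rw [hfx.arr 7 rfl, warr]
        have hupd : ∀ c, c = F i j → (∀ i' < i, ∀ j' < s.reg 3, Function.update (v.arr 7)
            (i * s.reg 3 + j) c (i' * s.reg 3 + j') = F i' j') ∧ ∀ j' < j + 1,
            Function.update (v.arr 7) (i * s.reg 3 + j) c (i * s.reg 3 + j') = F i j' := by
          rintro c rfl
          refine ⟨fun i' hi' j' hj' => ?_, fun j' hj' => ?_⟩
          · have := index_lt hi' hj'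
            rw [Function.update_of_ne (by omega)]
            exact i1 i' hi' j' hj'
          · rcases Nat.lt_succ_iff_lt_or_eq.mp hj' with h' | rfl
            · rw [Function.update_of_ne (by omega)]
              exact i2 j' h'
            · exact Function.update_self _ _ _
        by_cases h15 : x.reg 15 = 0
        · have h0 : 0 = F i j := (hF0 i j fun h => x15.mpr h.1 h15).symm
          have := hupd 0 h0
          simp only [run, Expr.eval, BinOp.eval, x6, x7, x3]
          simpa [h15, x7a] using this
        · have h0 : x.reg 16 = F i j := by
            rcases x16 with h | h
            · rw [h, hF0 i j fun hn => hn.2 (x16'.mp h)]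
            · rw [h, hF i j (x15.mp h15) fun hn => by simp [x16'.mpr hn] at h]
          have := hupd _ h0
          simp only [run, Expr.eval, BinOp.eval, x6, x7, x3]
          simpa [h15, x7a] using this
    · simp only [Expr.cost]
      have : s.reg 3 * (60 * T.p + 50 + 1 + 7) ≤ s.reg 3 * (60 * T.p + 60) :=
        Nat.mul_le_mul_left _ (by omega)
      omega
    · rintro v _ ⟨h1, h2⟩ i' hi' j hj
      rcases Nat.lt_succ_iff_lt_or_eq.mp hi' with h' | rfl
      exacts [h1 i' h' j hj, h2 j hj]
  · simp only [Expr.cost]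
    have : s.reg 3 * (s.reg 3 * (60 * T.p + 60) + 6 + 1 + 7) ≤
        s.reg 3 * (s.reg 3 * (60 * T.p + 60) + 20) := Nat.mul_le_mul_left _ (by omega)
    omega

theorem owners_spec {R N m A B : ℕ} {n : Expr} {own : ℕ → ℕ} (hAB : A ≠ B)
    (hn : ∀ u, u.reg 0 = s.reg 0 → u.reg 1 = s.reg 1 → n.eval u = N) (hcost : n.cost = 1)
    (hm : s.reg 2 = m)
    (hown : ∀ e < m, own e < N ∧ ∀ i, s.arr A i ≤ e ↔ i ≤ own e)
    (hR : N * (30 * m + 30) + 6 ≤ R) :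
    Halts (owners n A B) s R
      (fun u => ∀ e, u.arr B e = if e < m then own e else s.arr B e) := by
  have hreg : ∀ x < 6, (owners n A B).regs.contains x = false := by
    intro x hx
    simp [owners, forTo, regs]
    omega
  have hreg' : ∀ x < 6, (forTo 7 (reg 2) (ite (bin .lt (get A (reg 6)) (bin .add (reg 7) (lit 1)))
      (store B (reg 7) (reg 6)) skip)).regs.contains x = false := by
    intro x hx
    simp [forTo, regs]
    omega
  have hAarr : (owners n A B).arrs.contains A = false := by
    simp [owners, forTo, arrs, hAB]
  have hAarr' : (forTo 7 (reg 2) (ite (bin .lt (get A (reg 6)) (bin .add (reg 7) (lit 1)))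
      (store B (reg 7) (reg 6)) skip)).arrs.contains A = false := by
    simp [forTo, arrs, hAB]
  -- The last write wins: pass `k` overwrites exactly the entries at or after the start of the list
  -- of `k`. After the passes below `k` an entry therefore holds the smaller of its owner and `k -
  -- 1`.
  refine Halts.mono (Halts.forTo N (30 * m + 10) (fun k u => ∀ e, u.arr B e =
      if e < m ∧ 0 < k then min (own e) (k - 1) else s.arr B e) (by simp)
    (fun u hf => hn u (hf.reg 0 (hreg 0 (by omega))) (hf.reg 1 (hreg 1 (by omega)))) (by simp [forTo, regs]) ?_
    le_rfl) ?_ ?_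
  · intro k u hk hx hf hI
    have uA : u.arr A = s.arr A := hf.arr A hAarr
    have u2 : u.reg 2 = m := (hf.reg 2 (hreg 2 (by omega))).trans hm
    refine Halts.mono (Halts.forTo m 20 (fun j v => ∀ e, v.arr B e =
        if e < j then min (own e) k else u.arr B e) (by simp)
      (fun v hf => (hf.reg 2 (hreg' 2 (by omega))).trans u2) (by simp [regs]) ?_ le_rfl) ?_ ?_
    · intro j v hj hxv hfv hv
      have vA : v.arr A = s.arr A := (hfv.arr A hAarr').trans uA
      have v6 : v.reg 6 = k := (hfv.reg 6 (by simp [forTo, regs])).trans hx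
      refine Halts.of_run rfl (by simp [maxCost, Expr.cost]) ?_
      obtain ⟨hN, hle⟩ := hown j hj
      intro e
      have huj : u.arr B j = if 0 < k then min (own j) (k - 1) else s.arr B j := by
        rw [hI j]
        simp [hj]
      by_cases hc : s.arr A k ≤ j
      · have hc' : s.arr A k < j + 1 := by omega
        have := (hle k).mp hc
        simp only [run, Expr.eval, BinOp.eval, v6, hxv, vA]
        simp only [hc', if_true, one_ne_zero, if_false, Mem.setR_arr, Mem.setA_arr,
          Function.update_apply, hv]
        by_cases he : e = j
        · subst he
          simp [this]
        · have : e < j + 1 ↔ e < j := by omega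
          simp only [he, this, if_false]
      · have hc' : ¬ s.arr A k < j + 1 := by omega
        have h1 : ¬ k ≤ own j := fun h => hc ((hle k).mpr h)
        simp only [run, Expr.eval, BinOp.eval, v6, hxv, vA]
        simp only [hc', if_false, if_true, Mem.setR_arr, hv]
        by_cases he : e = j
        · subst he
          have hk0 : 0 < k := by omega
          simp only [lt_irrefl, if_false, huj, hk0, if_true, Nat.lt_succ_self]
          omega
        · have : e < j + 1 ↔ e < j := by omega
          simp only [this]
    · simp only [Expr.cost]
      omega
    · intro v hfv hv e
      rw [Mem.setR_arr, hv e, hI e]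
      by_cases he : e < m
      · simp [he]
      · simp [he]
  · rw [hcost]
    have : N * (30 * m + 10 + 1 + 7) ≤ N * (30 * m + 30) := Nat.mul_le_mul_left _ (by omega)
    omega
  · intro u _ hu e
    rw [hu e]
    by_cases he : e < m
    · have := (hown e he).1
      have hN : 0 < N := by omega
      simp only [he, hN, and_self, if_true]
      omega
    · simp [he]

/-- Each edge is looked up in the women's lists by comparison with all entries; the resulting m²
steps are within the budget. A pair occurs at least once by `h1`, and all its occurrences give the
same rank by `h2`. -/
theorem womenRanks_spec {R m : ℕ} {rw : ℕ → ℕ} (hm : s.reg 2 = m)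
    (h1 : ∀ e < m, ∃ f < m, s.arr 9 f = s.arr 1 e ∧ s.arr 4 f = s.arr 8 e)
    (h2 : ∀ e < m, ∀ f < m, s.arr 9 f = s.arr 1 e → s.arr 4 f = s.arr 8 e → s.arr 5 f = rw e)
    (hR : m * (40 * m + 30) + 6 ≤ R) :
    Halts womenRanks s R
      (fun u => ∀ e, u.arr 10 e = if e < m then rw e else s.arr 10 e) := by
  refine Halts.mono (Halts.forTo m (40 * m + 10) (fun k u => ∀ e, u.arr 10 e =
      if e < k then rw e else s.arr 10 e) (by simp)
    (fun u hf => (hf.reg 2 rfl).trans hm) rfl ?_ le_rfl) ?_ (fun _ _ h => h)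
  · intro k u hk hx hf hI
    have u2 : u.reg 2 = m := (hf.reg 2 rfl).trans hm
    have ua : ∀ A, A = 1 ∨ A = 4 ∨ A = 5 ∨ A = 8 ∨ A = 9 → u.arr A = s.arr A := by
      rintro A (rfl | rfl | rfl | rfl | rfl) <;> exact hf.arr _ rfl
    refine Halts.mono (Halts.forTo m 30 (fun j v => (∀ e, e ≠ k → v.arr 10 e =
        if e < k then rw e else s.arr 10 e) ∧
        ((∃ f < j, s.arr 9 f = s.arr 1 k ∧ s.arr 4 f = s.arr 8 k) → v.arr 10 k = rw k))
      ⟨fun e _ => hI e, by simp⟩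
      (fun v hf => (hf.reg 2 rfl).trans u2) rfl ?_ le_rfl) ?_ ?_
    · rintro j v hj hxv hfv ⟨i1, i2⟩
      have v6 : v.reg 6 = k := (hfv.reg 6 rfl).trans hx
      have va : ∀ A, A = 1 ∨ A = 4 ∨ A = 5 ∨ A = 8 ∨ A = 9 → v.arr A = s.arr A := by
        intro A hA
        rw [← ua A hA]
        rcases hA with rfl | rfl | rfl | rfl | rfl <;> exact hfv.arr _ rfl
      have hev : (bin .mul (bin .eq (get 9 (reg 7)) (get 1 (reg 6)))
          (bin .eq (get 4 (reg 7)) (get 8 (reg 6)))).eval v =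
          if s.arr 9 j = s.arr 1 k ∧ s.arr 4 j = s.arr 8 k then 1 else 0 := by
        simp only [Expr.eval, BinOp.eval, v6, hxv, va 9 (by simp), va 1 (by simp), va 4 (by simp),
          va 8 (by simp), ind_mul]
      refine Halts.ite (fun h => ?_) (fun h => ?_) (T := 10) (by decide)
      · have hc : s.arr 9 j = s.arr 1 k ∧ s.arr 4 j = s.arr 8 k := by
          by_contra hn
          exact h (by rw [hev, if_neg hn])
        refine Halts.of_run rfl (by decide) ?_
        simp only [run, Expr.eval, v6, hxv, va 5 (by simp), Mem.setR_arr, Mem.setA_arr, if_true]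
        refine ⟨fun e he => ?_, fun _ => ?_⟩
        · rw [Function.update_of_ne he]
          exact i1 e he
        · rw [Function.update_self]
          exact h2 k hk j hj hc.1 hc.2
      · have hc : ¬ (s.arr 9 j = s.arr 1 k ∧ s.arr 4 j = s.arr 8 k) := by
          intro hn
          rw [hev, if_pos hn] at h
          exact one_ne_zero h
        refine Halts.of_run rfl (by decide) ?_
        simp only [run, Mem.setR_arr]
        refine ⟨i1, ?_⟩
        rintro ⟨f, hf, hfe⟩
        refine i2 ⟨f, lt_of_le_of_ne (by omega) ?_, hfe⟩
        rintro rfl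
        exact hc hfe
    · simp only [Expr.cost]
      omega
    · rintro v _ ⟨i1, i2⟩ e
      rw [Mem.setR_arr]
      by_cases he : e = k
      · subst he
        simp [i2 (h1 e hk)]
      · rw [i1 e he]
        have : e < k + 1 ↔ e < k := by omega
        simp only [this]
  · simp only [Expr.cost]
    have : m * (40 * m + 10 + 1 + 7) ≤ m * (40 * m + 30) := Nat.mul_le_mul_left _ (by omega)
    omega

end Algo
end SSM

namespace SSM

/-! ### Correctness and running time -/

namespace PrefLists

variable {p q : ℕ} (L : PrefLists p q)

theorem getD_owner_le_iff {e : ℕ} (he : e < L.pairs.length) (i : ℕ) :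
    L.offset i ≤ e ↔ i ≤ (L.pairs.map (fun x => x.1.val)).getD e 0 := by
  have h := List.getElem_lt_iff_lt_countP L.pairwise_pairs (i := i) (e := e) (by simpa using he)
  rw [← L.offset_eq_countP] at h
  rw [List.getD_eq_getElem _ _ (by simpa using he)]
  omega

theorem _root_.List.getD_le_of_forall_le {l : List ℕ} {B : ℕ} (h : ∀ x ∈ l, x ≤ B) (i : ℕ) :
    l.getD i 0 ≤ B := by
  by_cases hi : i < l.length
  · rw [List.getD_eq_getElem _ _ hi]
    exact h _ (List.getElem_mem hi)
  · rw [List.getD_eq_default _ _ (not_lt.mp hi)]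
    exact Nat.zero_le _

theorem getD_adjList_le (i : ℕ) : L.adjList.getD i 0 ≤ q := by
  refine List.getD_le_of_forall_le (fun x hx => ?_) i
  rw [adjList_eq] at hx
  obtain ⟨y, -, rfl⟩ := List.mem_map.mp hx
  exact y.2.2.le

theorem getD_rankList_le (h : ∀ v, ∀ t ∈ L v, t ≠ []) (i : ℕ) :
    L.rankList.getD i 0 ≤ L.pairs.length := by
  refine List.getD_le_of_forall_le (fun x hx => ?_) i
  rw [rankList_eq] at hx
  obtain ⟨y, hy, rfl⟩ := List.mem_map.mp hx
  have h1 := L.rank_le h (L.mem_pairs.mp hy)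
  have h2 := L.offset_succ y.1
  have h3 := L.offset_le (y.1 + 1)
  omega

end PrefLists

namespace Inst

variable (I : Inst)

theorem input_le : I.input.Le (I.numVertices + I.numEdges + 2) := by
  have hm := I.length_menPairs
  have hw := I.length_womenPairs
  constructor
  · intro x
    simp only [input]
    split
    all_goals simp only [numVertices]
    all_goals omega
  · intro A i
    have h0 := I.menPref.offset_le i
    have h1 := I.menPref.getD_adjList_le i
    have h2 := I.menPref.getD_rankList_le I.men_ties_nonempty i
    have h3 := I.womenPref.offset_le i
    have h4 := I.womenPref.getD_adjList_le i
    have h5 := I.womenPref.getD_rankList_le I.women_ties_nonempty i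
    simp only [input]
    split
    all_goals simp only [numVertices]
    all_goals omega

theorem exists_womenPair {a : Fin I.numMen} {b : Fin I.numWomen} (h : (a, b) ∈ I.edges) :
    ∃ f < I.numEdges, (I.womenPref.pairs.map (fun x => x.1.val)).getD f 0 = b ∧
      I.womenPref.adjList.getD f 0 = a := by
  have h1 : (b, a) ∈ I.womenPref.pairs := by
    simpa [PrefLists.mem_pairs, edges, I.mem_nbrs_iff] using h
  obtain ⟨f, hf, h2⟩ := List.getElem_of_mem h1
  refine ⟨f, by rwa [← length_womenPairs], ?_, ?_⟩
  all_goals simp [PrefLists.adjList_eq, List.getD, hf, h2]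

theorem getD_womenRank {f : ℕ} (hf : f < I.numEdges) {a : Fin I.numMen} {b : Fin I.numWomen}
    (hb : (I.womenPref.pairs.map (fun x => x.1.val)).getD f 0 = b)
    (ha : I.womenPref.adjList.getD f 0 = a) :
    I.womenPref.rankList.getD f 0 = I.womenPref.rank b a := by
  rw [← length_womenPairs] at hf
  simp only [PrefLists.adjList_eq, PrefLists.rankList_eq, List.getD, List.getElem?_map,
    List.getElem?_eq_getElem hf, Option.map_some, Option.getD_some] at ha hb ⊢
  rw [Fin.ext ha, Fin.ext hb]

end Inst

namespace Algo

open Prog SSM.Expr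

variable (I : Inst)

theorem setup_spec {R : ℕ} (hR : I.numMen * (30 * I.numEdges + 30) + 6 +
      (I.numWomen * (30 * I.numEdges + 30) + 6 + (I.numEdges * (40 * I.numEdges + 30) + 6)) ≤ R) :
    Halts setup I.input R (Ctx I.tab) := by
  refine Halts.seq (owners_spec (A := 0) (B := 8) (N := I.numMen) (m := I.numEdges)
    (own := I.tab.em) (by decide) (fun u h _ => h) rfl rfl (fun e he => ⟨I.tab.em_lt he, fun i => ?_⟩)
    le_rfl) ?_ hR
  · have h := I.tab.lt_off he i
    have h' : I.input.arr 0 i = I.tab.off i := rfl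
    omega
  intro u hf hu
  refine Halts.seq (owners_spec (s := u) (A := 3) (B := 9) (N := I.numWomen) (m := I.numEdges)
    (own := fun f => (I.womenPref.pairs.map (fun x => x.1.val)).getD f 0) (by decide)
    (fun v _ h => h.trans (hf.reg 1 rfl)) rfl (hf.reg 2 rfl) (fun f hf' => ⟨?_, fun i => ?_⟩)
    le_rfl) ?_ le_rfl
  · rw [← I.length_womenPairs] at hf'
    rw [List.getD_eq_getElem _ _ (by simpa using hf')]
    simp
  · rw [← I.length_womenPairs] at hf'
    have h' : u.arr 3 = I.input.arr 3 := hf.arr 3 rfl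
    rw [h']
    exact I.womenPref.getD_owner_le_iff hf' i
  intro v hfv hv
  have va : ∀ A, A ≠ 8 → A ≠ 9 → v.arr A = I.input.arr A := by
    intro A h8 h9
    rw [hfv.arr A (by simp [owners, forTo, arrs, h9]), hf.arr A (by simp [owners, forTo, arrs, h8])]
  have v8 : v.arr 8 = I.tab.em := by
    rw [hfv.arr 8 rfl]
    funext e
    rw [hu e]
    split_ifs with he
    · rfl
    · refine (List.getD_eq_default _ _ ?_).symm
      rw [List.length_map, I.length_menPairs]
      omega
  have v1 : v.arr 1 = I.tab.ew := va 1 (by decide) (by decide)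
  have v4 : ∀ f, v.arr 4 f = I.womenPref.adjList.getD f 0 :=
    fun f => by rw [va 4 (by decide) (by decide)]; rfl
  have v5 : ∀ f, v.arr 5 f = I.womenPref.rankList.getD f 0 :=
    fun f => by rw [va 5 (by decide) (by decide)]; rfl
  have vr : ∀ x < 3, v.reg x = I.input.reg x := by
    intro x hx
    interval_cases x
    all_goals exact (hfv.reg _ rfl).trans (hf.reg _ rfl)
  refine Halts.mono (womenRanks_spec (m := I.numEdges) (rw := I.tab.rw) (vr 2 (by omega)) (fun e he => ?_)
    (fun e he f hf' h9 h4 => ?_) le_rfl) le_rfl ?_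
  · obtain ⟨a, b, hab, h1, h2, -⟩ := I.tab_exists_pair he
    obtain ⟨f, hf', h3, h4⟩ := I.exists_womenPair hab
    refine ⟨f, hf', ?_, ?_⟩
    · rw [hv f, if_pos hf', v1, h2, h3]
    · rw [v4, v8, h1, h4]
  · obtain ⟨a, b, -, h1, h2, -, h3⟩ := I.tab_exists_pair he
    rw [hv f, if_pos hf', v1, h2] at h9
    rw [v4, v8, h1] at h4
    rw [v5, h3]
    exact I.getD_womenRank hf' h9 h4
  · intro w hfw hw
    have wa : ∀ A, A ≠ 8 → A ≠ 9 → A ≠ 10 → w.arr A = I.input.arr A := by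
      intro A h8 h9 h10
      rw [hfw.arr A (by simp [womenRanks, forTo, arrs, h10]), va A h8 h9]
    have wr : ∀ x < 3, w.reg x = I.input.reg x := by
      intro x hx
      rw [← vr x hx]
      interval_cases x
      all_goals exact hfw.reg _ rfl
    refine ⟨wr 0 (by decide), wr 1 (by decide), wr 2 (by decide), wa 0 (by decide) (by decide)
      (by decide), wa 1 (by decide) (by decide) (by decide), wa 2 (by decide) (by decide)
      (by decide), fun b => ?_, (hfw.arr 8 rfl).trans v8, ?_⟩
    · rw [wa 3 (by decide) (by decide) (by decide)]
      rfl
    · funext e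
      rw [hw e]
      split_ifs with he
      · rfl
      · rw [va 10 (by decide) (by decide)]
        refine (List.getD_eq_default _ _ ?_).symm
        rw [List.length_map, I.length_menPairs]
        omega

/-- The degrees of the men sum up to at most `m`. Terms of order nm carry a degree as factor, and
the term of order m² is multiplied by the number of men; both contribute O(nm²). -/
theorem sum_manTime_le (T : Tab) (hm : 1 ≤ T.m) (hp : 1 ≤ T.p) :
    ∑ a ∈ Finset.range T.p, (manTime T a + 8) ≤ 9000 * ((T.p + T.q) * T.m ^ 2) := by
  have h := T.sum_off_le T.p
  have h1 : ∑ a ∈ Finset.range T.p, (manTime T a + 8) = T.p * (18 + 470 * (T.m * (5 * T.m + 1))) +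
      (470 * ((T.p + T.q + 1) * (5 * T.m + 1)) + 110 * (T.p + 1) * (T.m + 1)) *
        ∑ a ∈ Finset.range T.p, (T.off (a + 1) - T.off a) := by
    have hc := Finset.sum_const (s := Finset.range T.p) (18 + 470 * (T.m * (5 * T.m + 1)))
    rw [Finset.card_range, smul_eq_mul] at hc
    rw [Finset.mul_sum, ← hc, ← Finset.sum_add_distrib]
    refine Finset.sum_congr rfl fun a _ => ?_
    rw [manTime]
    ring
  have h2 : T.p * (18 + 470 * (T.m * (5 * T.m + 1))) ≤ (T.p + T.q) * (2838 * T.m ^ 2) :=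
    Nat.mul_le_mul (by omega) (by nlinarith)
  have h3 : 470 * ((T.p + T.q + 1) * (5 * T.m + 1)) ≤ 470 * ((2 * (T.p + T.q)) * (6 * T.m)) :=
    Nat.mul_le_mul_left _ (Nat.mul_le_mul (by omega) (by omega))
  have h4 : 110 * (T.p + 1) * (T.m + 1) ≤ 110 * (2 * (T.p + T.q)) * (2 * T.m) :=
    Nat.mul_le_mul (by omega) (by omega)
  rw [h1]
  calc _ ≤ (T.p + T.q) * (2838 * T.m ^ 2) + (470 * ((2 * (T.p + T.q)) * (6 * T.m)) +
        110 * (2 * (T.p + T.q)) * (2 * T.m)) * T.m :=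
      Nat.add_le_add h2 (Nat.mul_le_mul (Nat.add_le_add h3 h4) h)
    _ = 8918 * ((T.p + T.q) * T.m ^ 2) := by ring
    _ ≤ _ := Nat.mul_le_mul_right _ (by omega)

theorem main_spec : Halts main I.input (10000 * (I.numVertices * I.numEdges ^ 2 + 1))
    I.IsRepresentation := by
  classical
  -- Without edges the time bound is a constant, so not even a loop over the vertices is affordable.
  -- The program then does nothing, and the zero in register 3 is correct: there are no irreducible
  -- classes.
  refine Halts.ite (T := 10000 * (I.numVertices * I.numEdges ^ 2) + 9000) (fun h => ?_)
    (fun h => ?_) (by simp only [Expr.cost]; omega)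
  · have hm : 1 ≤ I.numEdges := Nat.one_le_iff_ne_zero.mpr h
    have hp : 1 ≤ I.numMen := by
      have := I.tab.em_lt (e := 0) hm
      exact Nat.one_le_iff_ne_zero.mpr fun h0 => by
        rw [show I.tab.p = I.numMen from rfl, h0] at this
        exact Nat.not_lt_zero _ this
    have hn : I.numVertices = I.numMen + I.numWomen := rfl
    have hmm : I.numEdges ≤ I.numEdges ^ 2 := Nat.le_self_pow two_ne_zero _
    have hnm : I.numEdges ^ 2 ≤ I.numVertices * I.numEdges ^ 2 :=
      Nat.le_mul_of_pos_left _ (by omega)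
    have hnm' : I.numVertices * I.numEdges ≤ I.numVertices * I.numEdges ^ 2 :=
      Nat.mul_le_mul_left _ hmm
    have hn' : I.numVertices ≤ I.numVertices * I.numEdges := Nat.le_mul_of_pos_right _ (by omega)
    refine Halts.seq (setup_spec I le_rfl)
      (T' := 9200 * (I.numVertices * I.numEdges ^ 2) + 100) ?_ ?_
    · intro u hf hc
      refine Halts.seq (menLoop_spec hc (hf.reg 3 rfl))
        (T' := 200 * (I.numVertices * I.numEdges ^ 2) + 90) ?_ ?_
      · rintro v hfv ⟨S, hrec, hcov, hk⟩
        have hcv := hc.of_frame hfv rfl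
        have hkm : v.reg 3 ≤ I.numEdges := hk.trans (I.tab.off_le _)
        refine Halts.mono (order_spec (F := fun i j =>
          if I.tab.Dom (S j) (S i) ∧ ¬ I.tab.Dom (S i) (S j) then 1 else 0) hcv hrec
          (fun i j h1 h2 => if_pos ⟨h1, h2⟩) (fun i j h => if_neg h) le_rfl) ?_ ?_
        · have h1 : v.reg 3 * (60 * I.tab.p + 60) ≤ I.numEdges * (120 * I.numVertices) :=
            Nat.mul_le_mul hkm (by
              have : I.tab.p = I.numMen := rfl
              omega)
          have h2 : v.reg 3 * (v.reg 3 * (60 * I.tab.p + 60) + 20) ≤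
              I.numEdges * (I.numEdges * (120 * I.numVertices) + 20) :=
            Nat.mul_le_mul hkm (by omega)
          have h3 : I.numEdges * (I.numEdges * (120 * I.numVertices) + 20) =
              120 * (I.numVertices * I.numEdges ^ 2) + 20 * I.numEdges := by ring
          omega
        · intro w hfw hw
          have w3 : w.reg 3 = v.reg 3 := hfw.reg 3 rfl
          have w6 : w.arr 6 = v.arr 6 := hfw.arr 6 rfl
          refine Tab.Output.isRepresentation (S := S) ⟨?_, ?_, ?_, ?_, ?_, ?_, ?_⟩
          all_goals rw [w3]
          · exact hrec.stable
          · exact hrec.irr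
          · intro i hi j hj h1 h2
            refine hrec.ne i hi j hj fun a ha => ?_
            exact le_antisymm ((hrec.dom_iff hi hj).mp h1 a ha) ((hrec.dom_iff hj hi).mp h2 a ha)
          · exact fun N hN e he => hcov N hN e he (I.tab.em_lt (hN.lt e he))
          · rw [w6]
            exact hrec.row
          · rw [w6]
            exact hrec.row_zero
          · exact hw
      · have := sum_manTime_le I.tab hm hp
        have hx : (I.tab.p + I.tab.q) * I.tab.m ^ 2 = I.numVertices * I.numEdges ^ 2 := rfl
        rw [hx] at this
        omega
    · have h1 : I.numMen * (30 * I.numEdges + 30) + I.numWomen * (30 * I.numEdges + 30) =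
          30 * (I.numVertices * I.numEdges) + 30 * I.numVertices := by
        rw [hn]
        ring
      have h2 : I.numEdges * (40 * I.numEdges + 30) =
          40 * I.numEdges ^ 2 + 30 * I.numEdges := by ring
      omega
  · refine Halts.of_run rfl (by simp only [maxCost]; omega) ?_
    have hm : I.tab.m = 0 := h
    have h3 : (skip.run I.input).reg 3 = 0 := rfl
    refine Tab.Output.isRepresentation (S := fun _ => ∅) ⟨?_, ?_, ?_, ?_, ?_, ?_, ?_⟩
    all_goals rw [h3]
    all_goals first
      | exact fun i hi => absurd hi (Nat.not_lt_zero i)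
      | exact fun N hN e he => absurd (hN.lt e he) (by omega)

end Algo

end SSM

theorem mainTheorem5 :
    ∃ (P : SSM.Prog) (C d : ℕ), ∀ I : SSM.Inst, ∃ (t : ℕ) (u : SSM.Mem),
      SSM.Exec ((I.numVertices + I.numEdges + 2) ^ d) P I.input t u ∧
      t ≤ C * (I.numVertices * I.numEdges ^ 2 + 1) ∧
      I.IsRepresentation u := by
  -- The exponent is 17 times 20: memory values stay below `B ^ 17`, and expressions have size at
  -- most 20.
  refine ⟨SSM.Algo.main, 10000, 340, fun I => ?_⟩
  obtain ⟨t, u, h1, h2, h3⟩ := SSM.Algo.main_spec I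
  refine ⟨t, u, (h1.exec SSM.Algo.main_incr I.input_le (by omega) ?_).1, h2, h3⟩
  set B := I.numVertices + I.numEdges + 2 with hB
  have h4 : I.numVertices * I.numEdges ^ 2 + 1 ≤ B ^ 3 := by
    have h5 : I.numVertices * I.numEdges ^ 2 ≤ (B - 1) * (B - 1) ^ 2 :=
      Nat.mul_le_mul (by omega) (Nat.pow_le_pow_left (by omega) 2)
    have h6 : (B - 1) ^ 3 < B ^ 3 := Nat.pow_lt_pow_left (by omega) (by omega)
    have h7 : (B - 1) * (B - 1) ^ 2 = (B - 1) ^ 3 := by ring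
    omega
  have h5 : B ≤ B ^ 3 := Nat.le_self_pow (by omega) B
  -- Since `B ≥ 2`, the constant `10001 ≤ 2 ^ 14` is absorbed by `B ^ 14`; the remaining `B ^ 3`
  -- comes from the time bound.
  have h6 : 2 ^ 14 ≤ B ^ 14 := Nat.pow_le_pow_left (by omega) 14
  have h7 : B + t ≤ B ^ 17 :=
    calc B + t ≤ 2 ^ 14 * B ^ 3 := by omega
      _ ≤ B ^ 14 * B ^ 3 := Nat.mul_le_mul_right _ h6
      _ = B ^ 17 := by ring
  calc (B + t) ^ 20 ≤ (B ^ 17) ^ 20 := Nat.pow_le_pow_left h7 20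
    _ = B ^ 340 := by rw [← pow_mul]
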